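/- Consider $\varepsilon^2u''=u^3-\lambda u+\cos t$ with $\varepsilon>0$. Let $\lambda_0=3/2^{2/3}$; for $\lambda>\lambda_0$ let $\underline U(t)<U_0(t)<\bar U(t)$ be the three roots of $x^3-\lambda x+\cos t=0$. Let $V_1$ (resp. $V_{-1}$) be the nonconstant solution of $\ddot V=V^3-\lambda V+1$ (resp. $\ddot V=V^3-\lambda V-1$) with $\dot V(0)=0$ that tends to $\bar U(0)$ (resp. $\underline U(\pi)$) as $\tau\to\pm\infty$. Put $\Lambda=\inf\{\lambda>\lambda_0: V_1(0)<U_0(\pi)\}$ and $K=\sqrt{\bar U(0)-\sqrt{\lambda/3}}$. Let $u_5>0$ and $u_1<0$ be the unique bounded solutions on $\mathbb R$ of these signs satisfying $3u^2>\lambda$. For $0<\delta<\bar U(0)-\sqrt{\lambda/3}$ let $V_{0^+}$ be the solution of $\ddot V=V^3-\lambda V$ with $V(-\infty)=\bar U(\pi/2)$, $V(\infty)=\underline U(\pi/2)$, $V(0)=\bar U(\pi/2)-\delta$, and let $V_{0^-}(\tau)=-V_{0^+}(-\tau)$. **Theorem.** Let $\lambda>\Lambda$ and let $m\ge1$ be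 an integer. Consider all $2\pi$-periodic solutions $u=u_\varepsilon$ with $u'(0)=u'(\pi)=0$, $-\sqrt\lambda<u(0)<U_0(0)$, $u(\pi)>0$, whose local maxima and minima in $(0,\pi]$ are exactly $t_1,\dots,t_m$ and $s_1,\dots,s_{m-1}$ respectively, with $0<t_1<s_1<t_2<\dots<s_{m-1}<t_m=\pi$. As $\varepsilon\to0^+$ the following hold, uniformly over all such solutions (with $\lambda,m,\delta,T$ fixed). 1. $u(0)\to V_1(0)$, and for every $T>0$, $|u(\varepsilon\tau)-V_1(\tau)|+|\varepsilon u'(\varepsilon\tau)-\dot V_1(\tau)|\to0$ uniformly for $\tau\in[0,T]$. If $m\ge2$, also $u(\pi)\to V_{-1}(0)$ and $|u(\pi+\varepsilon\tau)-V_{-1}(\tau)|+|\varepsilon u'(\pi+\varepsilon\tau)-\dot V_{-1}(\tau)|\to0$ uniformly for $\tau\in[-T,0]$. 2. For $1\le j\le m-1$: $t_j\to\frac\pi2$, $s_j\to\frac\pi2$, $u(t_j)\to\bar U(\frac\pi2)$, $u(s_j)\to\underline U(\frac\pi2)$. 3. Let $T_j=\sup\{t\in(t_j,\pi):u>u_5-\delta\text{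 on }(t_j,t]\}$, $S_j=\sup\{t\in(s_j,\pi):u<u_1+\delta\text{ on }(s_j,t]\}$, $S_j^-=\inf\{t\in(0,s_j):u<u_1+\delta\text{ on }[t,s_j)\}$. For all sufficiently small $\varepsilon$: $0<T_j-t_j<\frac{3\varepsilon}K|\ln\varepsilon|$ and $0<s_j-S_j^-<\frac{3\varepsilon}K|\ln\varepsilon|$ for $1\le j\le m-1$, and $0<S_j-s_j<\frac{3\varepsilon}K|\ln\varepsilon|$ for $1\le j\le m-2$. Moreover, for every $T>0$, $|u(T_j+\varepsilon\tau)-V_{0^+}(\tau)|+|\varepsilon u'(T_j+\varepsilon\tau)-\dot V_{0^+}(\tau)|\to0$ uniformly on $[0,T]$ and $|u(S_j^-+\varepsilon\tau)-V_{0^-}(\tau)|+|\varepsilon u'(S_j^-+\varepsilon\tau)-\dot V_{0^-}(\tau)|\to0$ uniformly on $[-T,0]$ for $1\le j\le m-1$, and $|u(S_j+\varepsilon\tau)+V_{0^+}(\tau)|+|\varepsilon u'(S_j+\varepsilon\tau)+\dot V_{0^+}(\tau)|\to0$ uniformly on $[0,T]$ for $1\le j\le m-2$. 4. There is $M>0$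 depending only on $\lambda$ such that for each $\mu>0$ and all sufficiently small $\varepsilon$ (depending on $\lambda,m,\mu$), $|u-\bar U|+\varepsilon|u'-\bar U'|\le M\varepsilon^2$ on $[\mu,\frac\pi2-\mu]$ and, if $m\ge2$, $|u-\underline U|+\varepsilon|u'-\underline U'|\le M\varepsilon^2$ on $[\frac\pi2+\mu,\pi-\mu]$. -/

import Mathlib

open Set

noncomputable section

namespace ForcedDuffing

/-- `u` is a (classical, globally defined) solution of `ε² u'' = u³ - lam u + cos t`. -/
def IsSolution (lam ε : ℝ) (u : ℝ → ℝ) : Prop :=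
  ContDiff ℝ 2 u ∧ ∀ t : ℝ, ε ^ 2 * deriv (deriv u) t = u t ^ 3 - lam * u t + Real.cos t

/-- `V` is a solution on the line of the autonomous equation `V'' = V³ - lam V + κ`. -/
def IsAutonomousSolution (lam κ : ℝ) (V : ℝ → ℝ) : Prop :=
  ContDiff ℝ 2 V ∧ ∀ τ : ℝ, deriv (deriv V) τ = V τ ^ 3 - lam * V τ + κ

/-- The solutions `x` of `x³ - lam x + cos t = 0`. -/
def roots (lam t : ℝ) : Set ℝ := {x : ℝ | x ^ 3 - lam * x + Real.cos t = 0}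

/-- The smallest root at time `t`. -/
def lowerRoot (lam t : ℝ) : ℝ := sInf (roots lam t)

/-- The largest root at time `t`. -/
def upperRoot (lam t : ℝ) : ℝ := sSup (roots lam t)

/-- The middle root at time `t`: the largest one below `upperRoot`. For `lam > lambda0` there are
exactly three roots. -/
def middleRoot (lam t : ℝ) : ℝ := sSup {x : ℝ | x ∈ roots lam t ∧ x < upperRoot lam t}

/-- For `lam > lambda0` the cubic has three distinct real roots for every `t`. -/
def lambda0 : ℝ := 3 / (2 : ℝ) ^ ((2 : ℝ) / 3)

/-- `V` is the orbit of `V'' = V³ - lam V + κ` homoclinic to `p`, with time normalised by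
`V'(0) = 0`. (The equilibrium `V = p` itself is excluded.) -/
def IsHomoclinic (lam κ p : ℝ) (V : ℝ → ℝ) : Prop :=
  IsAutonomousSolution lam κ V ∧
    Filter.Tendsto V Filter.atTop (nhds p) ∧ Filter.Tendsto V Filter.atBot (nhds p) ∧
    deriv V 0 = 0 ∧ ∃ τ : ℝ, V τ ≠ p

/-- The orbit `V₁`. -/
def IsV1 (lam : ℝ) (V : ℝ → ℝ) : Prop := IsHomoclinic lam 1 (upperRoot lam 0) V

/-- The orbit `V₋₁`. -/
def IsVneg1 (lam : ℝ) (V : ℝ → ℝ) : Prop := IsHomoclinic lam (-1) (lowerRoot lam Real.pi) V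

/-- The heteroclinic orbit of `V'' = V³ - lam V` descending from the largest to the smallest
equilibrium, with time normalised by `V(0) = Ū(π/2) - δ`. -/
def IsV0plus (lam δ : ℝ) (V : ℝ → ℝ) : Prop :=
  IsAutonomousSolution lam 0 V ∧
    Filter.Tendsto V Filter.atBot (nhds (upperRoot lam (Real.pi / 2))) ∧
    Filter.Tendsto V Filter.atTop (nhds (lowerRoot lam (Real.pi / 2))) ∧
    V 0 = upperRoot lam (Real.pi / 2) - δ

/-- The threshold `Λ = inf {lam > lambda0 : V₁(0) < U₀(π)}`. -/
def capLambda : ℝ :=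
  sInf {lam : ℝ | lambda0 < lam ∧ ∃ V : ℝ → ℝ, IsV1 lam V ∧ V 0 < middleRoot lam Real.pi}

/-- The rate `K = √(Ū(0) - √(lam/3))`. -/
def rateK (lam : ℝ) : ℝ := Real.sqrt (upperRoot lam 0 - Real.sqrt (lam / 3))

/-- `v` is the (unique) bounded solution `u₅` with `v > 0` and `3 v² - lam > 0`. -/
def IsU5 (lam ε : ℝ) (v : ℝ → ℝ) : Prop :=
  IsSolution lam ε v ∧ (∃ B : ℝ, ∀ t : ℝ, |v t| ≤ B) ∧ ∀ t : ℝ, 0 < v t ∧ 0 < 3 * v t ^ 2 - lam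

/-- `v` is the (unique) bounded solution `u₁` with `v < 0` and `3 v² - lam > 0`. -/
def IsU1 (lam ε : ℝ) (v : ℝ → ℝ) : Prop :=
  IsSolution lam ε v ∧ (∃ B : ℝ, ∀ t : ℝ, |v t| ≤ B) ∧ ∀ t : ℝ, v t < 0 ∧ 0 < 3 * v t ^ 2 - lam

/-- `u` is one of the `2π`-periodic solutions under consideration, with exactly `m` local maxima
`t 1 < ⋯ < t m = π` and exactly `m - 1` local minima `s 1 < ⋯ < s (m - 1)` in `(0, π]`,
interlaced as `0 < t 1 < s 1 < t 2 < ⋯ < s (m - 1) < t m = π`.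
Values of `t`, `s` at other indices are irrelevant. -/
structure IsLayerSolution (lam ε : ℝ) (m : ℕ) (u : ℝ → ℝ) (t s : ℕ → ℝ) : Prop where
  isSolution : IsSolution lam ε u
  periodic : Function.Periodic u (2 * Real.pi)
  deriv_zero : deriv u 0 = 0
  deriv_pi : deriv u Real.pi = 0
  lower_zero : -Real.sqrt lam < u 0
  upper_zero : u 0 < middleRoot lam 0
  pos_pi : 0 < u Real.pi
  maxima : {x : ℝ | x ∈ Ioc 0 Real.pi ∧ IsLocalMax u x} = t '' Icc 1 m
  minima : {x : ℝ | x ∈ Ioc 0 Real.pi ∧ IsLocalMin u x} = s '' Ico 1 m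
  first_pos : 0 < t 1
  interlace : ∀ j ∈ Ico 1 m, t j < s j ∧ s j < t (j + 1)
  last_eq : t m = Real.pi

/-- `T_j = sup {t ∈ (a, π) : u > u₅ - δ on (a, t]}` for `a = t_j`. -/
def exitTop (u u5 : ℝ → ℝ) (δ a : ℝ) : ℝ :=
  sSup {t : ℝ | t ∈ Ioo a Real.pi ∧ ∀ x ∈ Ioc a t, u5 x - δ < u x}

/-- `S_j = sup {t ∈ (a, π) : u < u₁ + δ on (a, t]}` for `a = s_j`. -/
def exitBottom (u u1 : ℝ → ℝ) (δ a : ℝ) : ℝ :=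
  sSup {t : ℝ | t ∈ Ioo a Real.pi ∧ ∀ x ∈ Ioc a t, u x < u1 x + δ}

/-- The time-reversed counterpart `inf {t ∈ (0, a) : u < u₁ + δ on [t, a)}` for `a = s_j`. -/
def entryBottom (u u1 : ℝ → ℝ) (δ a : ℝ) : ℝ :=
  sInf {t : ℝ | t ∈ Ioo 0 a ∧ ∀ x ∈ Ico t a, u x < u1 x + δ}

/-- The distance between `(u, ε u')` at time `a + ε τ` and `(V, V')` at fast time `τ`. -/
def profileGap (ε : ℝ) (u V : ℝ → ℝ) (a τ : ℝ) : ℝ :=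
  |u (a + ε * τ) - V τ| + |ε * deriv u (a + ε * τ) - deriv V τ|

end ForcedDuffing

end

/-! Around points a → α and in the fast time (x - a)/ε, solutions bounded uniformly in ε converge to
solutions of V'' = V³ - λV + cos α, so most claims reduce to asking which limits can occur. Limits
are taken along an ultrafilter, where every bounded quantity converges without extracting
subsequences; `exists_threshold` converts "along every family with ε → 0" into "for all small ε,
uniformly in the solution".

Two facts cut down the limits. They avoid the centre: an energy relative to U₀ obeys a Gronwall
inequality in slow time, so a solution too close to U₀ with too small a velocity would stay near it
for a whole period, whereas u(π) > 0 > U₀(π) (`exists_avoid`). They are not periodic, since a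
periodic limit would create more than m maxima (`window_critical`). Hence a nonconstant limit has at
most one critical point and tends to saddles, and conservation of energy does the rest: it is
homoclinic to the upper saddle if cos α > 0, homoclinic to the lower one if cos α < 0, and has no
critical point if cos α = 0. At α = 0 this identifies V₁.

To locate the extrema, suppose s_j → α < π/2. The energy relative to Ū has derivative (u - Ū) sin x,
so the excursion around s_j costs an amount of order s_j ε, and s_j/ε → ∞. The next maximum
therefore lies below Ū by more than any given multiple of ε (`far_from_upper`), exponential
instability throws the solution off Ū within O(ε |log ε|) (`exists_departure_bound`), and the next
minimum also tends to α. The chain ends at the last maximum, which is π: a contradiction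
(`pi_div_two_le_of_s`). The symmetry u ↦ -u(π - ·) exchanges maxima and minima and bounds the t_j
from above; `pi_div_two_le_of_t` bounds t_1 from below. Apart from λ > λ₀, the hypothesis λ > Λ
enters only as V₁(0) < 0, which, with `pi_lt_sqrt`, makes the reflected solution one of the same
class.

For the widths, the gap z between u and the outer solution satisfies ε²z'' ≥ K²z until it reaches δ,
and z' + (K/ε)z is bounded below at the extremum, so the exit takes time (ε/K)(|log ε| + O(1))
(`exit_profile`). Away from the layers u lies beyond the inflection value, where the equation is
convex enough for an exponential barrier to give the O(ε²) estimate. -/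

namespace ForcedDuffing

open Filter Topology

/-! ### The cubic `x³ - lam x + c` -/

/-- Viète's formula for the largest root of `x³ - lam x + c`. -/
noncomputable def topRoot (lam c : ℝ) : ℝ :=
  2 * √(lam / 3) * Real.cos (Real.arccos (-c / (2 * √(lam / 3) ^ 3)) / 3)

lemma lam_pos {lam : ℝ} (h : lambda0 < lam) : 0 < lam :=
  lt_trans (by unfold lambda0; positivity) h

lemma inflection_pos {lam : ℝ} (h : lambda0 < lam) : 0 < √(lam / 3) :=
  Real.sqrt_pos.2 (div_pos (lam_pos h) (by norm_num))

lemma inflection_sq {lam : ℝ} (h : lambda0 < lam) : 3 * √(lam / 3) ^ 2 = lam := by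
  rw [Real.sq_sqrt (div_pos (lam_pos h) (by norm_num)).le]; ring

/-- With r² = λ/3, the condition λ > 3/2^(2/3) reads r² 2^(2/3) > 1, and cubing gives (2r³)² > 1.
This keeps the argument of the arccosine in Viète's formula strictly inside (-1, 1) when |c| ≤ 1,
hence distinct roots depending smoothly on c. -/
lemma one_lt_discriminant {lam : ℝ} (h : lambda0 < lam) : 1 < 2 * √(lam / 3) ^ 3 := by
  have hr := inflection_pos h
  have hs := inflection_sq h
  set r := √(lam / 3)
  have h1 : ((2 : ℝ) ^ ((2 : ℝ) / 3)) ^ 3 = 4 := by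
    rw [← Real.rpow_natCast, ← Real.rpow_mul (by norm_num)]
    norm_num
  have hp : 0 < (2 : ℝ) ^ ((2 : ℝ) / 3) := by positivity
  set q := (2 : ℝ) ^ ((2 : ℝ) / 3)
  have h2 : 3 / q < 3 * r ^ 2 := by rw [hs]; exact h
  have h3 : 1 < r ^ 2 * q := by
    rw [div_lt_iff₀ hp] at h2; linarith
  have h4 : 1 < (r ^ 2 * q) ^ 3 := one_lt_pow₀ h3 (by norm_num)
  have h5 : (r ^ 2 * q) ^ 3 = (2 * r ^ 3) ^ 2 := by
    rw [mul_pow, h1]; ring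
  rw [h5] at h4
  nlinarith [pow_pos hr 3]

lemma abs_discriminant_lt {lam c : ℝ} (h : lambda0 < lam) (hc : |c| ≤ 1) :
    -1 < -c / (2 * √(lam / 3) ^ 3) ∧ -c / (2 * √(lam / 3) ^ 3) < 1 := by
  have h1 := one_lt_discriminant h
  have h2 := abs_le.1 hc
  constructor
  · rw [lt_div_iff₀ (by linarith)]; linarith
  · rw [div_lt_iff₀ (by linarith)]; linarith

lemma topRoot_cubic {lam c : ℝ} (h : lambda0 < lam) (hc : |c| ≤ 1) :
    topRoot lam c ^ 3 - lam * topRoot lam c + c = 0 := by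
  have h1 := one_lt_discriminant h
  obtain ⟨h2, h3⟩ := abs_discriminant_lt h hc
  have hs := inflection_sq h
  unfold topRoot
  set r := √(lam / 3)
  set θ := Real.arccos (-c / (2 * r ^ 3)) / 3 with hθ
  have h4 : Real.cos (3 * θ) = -c / (2 * r ^ 3) := by
    rw [hθ, mul_div_cancel₀ _ (by norm_num), Real.cos_arccos h2.le h3.le]
  rw [Real.cos_three_mul, eq_div_iff (by linarith)] at h4
  rw [← hs]
  linear_combination h4

lemma inflection_lt_topRoot {lam c : ℝ} (h : lambda0 < lam) (hc : |c| ≤ 1) :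
    √(lam / 3) < topRoot lam c := by
  have hr := inflection_pos h
  obtain ⟨h2, h3⟩ := abs_discriminant_lt h hc
  unfold topRoot
  set r := √(lam / 3)
  have h5 : Real.arccos (-c / (2 * r ^ 3)) < Real.pi := by
    have := Real.arccos_lt_arccos (le_refl (-1)) h2 h3.le
    rwa [Real.arccos_neg_one] at this
  have h6 := Real.arccos_nonneg (-c / (2 * r ^ 3))
  have h7 : Real.cos (Real.pi / 3) < Real.cos (Real.arccos (-c / (2 * r ^ 3)) / 3) :=
    Real.cos_lt_cos_of_nonneg_of_le_pi (by linarith) (by linarith [Real.pi_pos]) (by linarith)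
  rw [Real.cos_pi_div_three] at h7
  nlinarith

lemma abs_neg_le {c : ℝ} (hc : |c| ≤ 1) : |-c| ≤ 1 := by rwa [abs_neg]

/-- Vieta's relations among the roots `A`, `-B`, `B - A`, where `A = topRoot lam c` and
`B = topRoot lam (-c)`. -/
lemma topRoot_vieta {lam c : ℝ} (h : lambda0 < lam) (hc : |c| ≤ 1) :
    lam = topRoot lam c ^ 2 - topRoot lam c * topRoot lam (-c) + topRoot lam (-c) ^ 2 ∧
    c = topRoot lam c * topRoot lam (-c) * (topRoot lam (-c) - topRoot lam c) := by
  have h1 := topRoot_cubic h hc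
  have h2 := topRoot_cubic h (abs_neg_le hc)
  have hr := inflection_pos h
  have h3 := inflection_lt_topRoot h hc
  have h4 := inflection_lt_topRoot h (abs_neg_le hc)
  set A := topRoot lam c
  set B := topRoot lam (-c)
  have h5 : lam = A ^ 2 - A * B + B ^ 2 := by
    -- The sum of the two cubic equations has the factor A + B, which is positive.
    have : (A + B) * (A ^ 2 - A * B + B ^ 2 - lam) = 0 := by linear_combination h1 + h2
    rcases mul_eq_zero.1 this with h | h <;> linarith
  refine ⟨h5, ?_⟩
  rw [h5] at h1
  linear_combination h1

lemma topRoot_pos {lam c : ℝ} (h : lambda0 < lam) (hc : |c| ≤ 1) : 0 < topRoot lam c :=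
  (inflection_pos h).trans (inflection_lt_topRoot h hc)

/-- Says that -B < B - A, so the lowest and middle roots are distinct. If A ≥ 2B, then λ = A(A - B)
+ B² ≥ 3B², which exceeds λ because B is beyond the inflection value. -/
lemma topRoot_lt_two_mul {lam c : ℝ} (h : lambda0 < lam) (hc : |c| ≤ 1) :
    topRoot lam c < 2 * topRoot lam (-c) := by
  obtain ⟨h1, -⟩ := topRoot_vieta h hc
  have hs := inflection_sq h
  have hr := inflection_pos h
  have h3 := inflection_lt_topRoot h hc
  have h4 := inflection_lt_topRoot h (abs_neg_le hc)
  by_contra! hcon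
  nlinarith

lemma topRoot_neg_lt_two_mul {lam c : ℝ} (h : lambda0 < lam) (hc : |c| ≤ 1) :
    topRoot lam (-c) < 2 * topRoot lam c := by
  have := topRoot_lt_two_mul h (abs_neg_le hc)
  rwa [neg_neg] at this

lemma cubic_factor {lam c : ℝ} (h : lambda0 < lam) (hc : |c| ≤ 1) (x : ℝ) :
    x ^ 3 - lam * x + c =
      (x - topRoot lam c) * (x + topRoot lam (-c)) * (x - (topRoot lam (-c) - topRoot lam c)) := by
  obtain ⟨h1, h2⟩ := topRoot_vieta h hc
  set A := topRoot lam c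
  set B := topRoot lam (-c)
  rw [h1, h2]; ring

/-- Both roots exceed √(λ/3), so A² + AB + B² > λ: the cubic is increasing there, and raising c
lowers the root. -/
lemma topRoot_strictAnti {lam c c' : ℝ} (h : lambda0 < lam) (hc : |c| ≤ 1) (hc' : |c'| ≤ 1)
    (hcc : c < c') : topRoot lam c' < topRoot lam c := by
  have h1 := topRoot_cubic h hc
  have h2 := topRoot_cubic h hc'
  have hs := inflection_sq h
  have hr := inflection_pos h
  have h3 := inflection_lt_topRoot h hc
  have h4 := inflection_lt_topRoot h hc'
  by_contra! hcon
  set A := topRoot lam c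
  set B := topRoot lam c'
  have : 0 ≤ (B - A) * (A ^ 2 + A * B + B ^ 2 - lam) := by
    apply mul_nonneg (by linarith)
    nlinarith
  nlinarith

lemma topRoot_anti {lam c c' : ℝ} (h : lambda0 < lam) (hc : |c| ≤ 1) (hc' : |c'| ≤ 1)
    (hcc : c ≤ c') : topRoot lam c' ≤ topRoot lam c := by
  rcases hcc.eq_or_lt with rfl | hlt
  · exact le_rfl
  · exact (topRoot_strictAnti h hc hc' hlt).le

lemma abs_cos_le (t : ℝ) : |Real.cos t| ≤ 1 := Real.abs_cos_le_one t

lemma mem_roots_iff {lam : ℝ} (h : lambda0 < lam) (t x : ℝ) :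
    x ∈ roots lam t ↔ x = topRoot lam (Real.cos t) ∨ x = -topRoot lam (-Real.cos t) ∨
      x = topRoot lam (-Real.cos t) - topRoot lam (Real.cos t) := by
  unfold roots
  rw [mem_ofPred_eq, cubic_factor h (abs_cos_le t), mul_eq_zero, mul_eq_zero, sub_eq_zero,
    sub_eq_zero, add_eq_zero_iff_eq_neg, or_assoc]

lemma upperRoot_eq {lam : ℝ} (h : lambda0 < lam) (t : ℝ) :
    upperRoot lam t = topRoot lam (Real.cos t) := by
  have h1 := topRoot_pos h (abs_cos_le t)
  have h2 := topRoot_pos h (abs_neg_le (abs_cos_le t))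
  have h3 := topRoot_neg_lt_two_mul h (abs_cos_le t)
  refine IsGreatest.csSup_eq ⟨(mem_roots_iff h t _).2 (Or.inl rfl), fun x hx => ?_⟩
  rcases (mem_roots_iff h t x).1 hx with rfl | rfl | rfl <;> linarith

lemma lowerRoot_eq {lam : ℝ} (h : lambda0 < lam) (t : ℝ) :
    lowerRoot lam t = -topRoot lam (-Real.cos t) := by
  have h1 := topRoot_pos h (abs_cos_le t)
  have h2 := topRoot_pos h (abs_neg_le (abs_cos_le t))
  have h3 := topRoot_lt_two_mul h (abs_cos_le t)
  refine IsLeast.csInf_eq ⟨(mem_roots_iff h t _).2 (Or.inr (Or.inl rfl)), fun x hx => ?_⟩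
  rcases (mem_roots_iff h t x).1 hx with rfl | rfl | rfl <;> linarith

lemma middleRoot_eq {lam : ℝ} (h : lambda0 < lam) (t : ℝ) :
    middleRoot lam t = topRoot lam (-Real.cos t) - topRoot lam (Real.cos t) := by
  have h1 := topRoot_pos h (abs_cos_le t)
  have h2 := topRoot_pos h (abs_neg_le (abs_cos_le t))
  have h3 := topRoot_neg_lt_two_mul h (abs_cos_le t)
  have h4 := topRoot_lt_two_mul h (abs_cos_le t)
  refine IsGreatest.csSup_eq ⟨⟨(mem_roots_iff h t _).2 (Or.inr (Or.inr rfl)), ?_⟩, ?_⟩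
  · rw [upperRoot_eq h]; linarith
  · rintro x ⟨hx, hlt⟩
    rw [upperRoot_eq h] at hlt
    rcases (mem_roots_iff h t x).1 hx with rfl | rfl | rfl <;> linarith

lemma lowerRoot_pi_sub {lam : ℝ} (h : lambda0 < lam) (t : ℝ) :
    lowerRoot lam (Real.pi - t) = -upperRoot lam t := by
  rw [lowerRoot_eq h, upperRoot_eq h, Real.cos_pi_sub, neg_neg]

lemma upperRoot_pi_sub {lam : ℝ} (h : lambda0 < lam) (t : ℝ) :
    upperRoot lam (Real.pi - t) = -lowerRoot lam t := by
  rw [lowerRoot_eq h, upperRoot_eq h, Real.cos_pi_sub, neg_neg]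

lemma middleRoot_pi_sub {lam : ℝ} (h : lambda0 < lam) (t : ℝ) :
    middleRoot lam (Real.pi - t) = -middleRoot lam t := by
  rw [middleRoot_eq h, middleRoot_eq h, Real.cos_pi_sub, neg_neg]; ring

lemma middleRoot_eq_neg_add {lam : ℝ} (h : lambda0 < lam) (t : ℝ) :
    middleRoot lam t = -(upperRoot lam t + lowerRoot lam t) := by
  rw [middleRoot_eq h, upperRoot_eq h, lowerRoot_eq h]; ring

lemma contDiff_topRoot_cos {lam : ℝ} (h : lambda0 < lam) {g : ℝ → ℝ} (hg : ContDiff ℝ 2 g)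
    (hg1 : ∀ t, |g t| ≤ 1) : ContDiff ℝ 2 fun t => topRoot lam (g t) := by
  unfold topRoot
  refine contDiff_const.mul (Real.contDiff_cos.comp (ContDiff.div_const ?_ _))
  rw [contDiff_iff_contDiffAt]
  intro t
  obtain ⟨h1, h2⟩ := abs_discriminant_lt h (hg1 t)
  have h3 : ContDiffAt ℝ 2 (fun t => -g t / (2 * √(lam / 3) ^ 3)) t :=
    (hg.neg.div_const _).contDiffAt
  exact ContDiffAt.comp (g := Real.arccos) t (Real.contDiffAt_arccos h1.ne' h2.ne) h3

lemma contDiff_upperRoot {lam : ℝ} (h : lambda0 < lam) : ContDiff ℝ 2 (upperRoot lam) := by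
  have : upperRoot lam = fun t => topRoot lam (Real.cos t) := funext (upperRoot_eq h)
  rw [this]
  exact contDiff_topRoot_cos h Real.contDiff_cos abs_cos_le

lemma contDiff_lowerRoot {lam : ℝ} (h : lambda0 < lam) : ContDiff ℝ 2 (lowerRoot lam) := by
  have : lowerRoot lam = fun t => -topRoot lam (-Real.cos t) := funext (lowerRoot_eq h)
  rw [this]
  exact (contDiff_topRoot_cos h Real.contDiff_cos.neg fun t => abs_neg_le (abs_cos_le t)).neg

lemma contDiff_middleRoot {lam : ℝ} (h : lambda0 < lam) : ContDiff ℝ 2 (middleRoot lam) := by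
  have : middleRoot lam = fun t => -(upperRoot lam t + lowerRoot lam t) :=
    funext (middleRoot_eq_neg_add h)
  rw [this]
  exact ((contDiff_upperRoot h).add (contDiff_lowerRoot h)).neg

lemma periodic_upperRoot {lam : ℝ} (h : lambda0 < lam) :
    Function.Periodic (upperRoot lam) (2 * Real.pi) := fun t => by
  rw [upperRoot_eq h, upperRoot_eq h, Real.cos_add_two_pi]

lemma periodic_lowerRoot {lam : ℝ} (h : lambda0 < lam) :
    Function.Periodic (lowerRoot lam) (2 * Real.pi) := fun t => by
  rw [lowerRoot_eq h, lowerRoot_eq h, Real.cos_add_two_pi]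

lemma periodic_middleRoot {lam : ℝ} (h : lambda0 < lam) :
    Function.Periodic (middleRoot lam) (2 * Real.pi) := fun t => by
  rw [middleRoot_eq h, middleRoot_eq h, Real.cos_add_two_pi]

lemma _root_.Function.Periodic.deriv_real {f : ℝ → ℝ} {T : ℝ} (hf : Function.Periodic f T) :
    Function.Periodic (deriv f) T := fun x => by
  rw [← deriv_comp_add_const f T x]
  congr 1
  exact funext hf

lemma _root_.Function.Periodic.exists_bound_of_continuous {f : ℝ → ℝ} {T : ℝ} (hT : 0 < T)
    (hf : Function.Periodic f T) (hc : Continuous f) : ∃ B, ∀ x, |f x| ≤ B := by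
  obtain ⟨B, hB⟩ := (isCompact_Icc (a := (0 : ℝ)) (b := T)).exists_bound_of_continuousOn
    hc.continuousOn
  refine ⟨B, fun x => ?_⟩
  obtain ⟨y, hy, hxy⟩ := hf.exists_mem_Ico₀ hT x
  rw [hxy]
  exact hB y (Ico_subset_Icc_self hy)

lemma exists_bound_derivs {f : ℝ → ℝ} (hf : ContDiff ℝ 2 f)
    (hp : Function.Periodic f (2 * Real.pi)) :
    ∃ D, 0 < D ∧ ∀ t, |f t| ≤ D ∧ |deriv f t| ≤ D ∧ |deriv (deriv f) t| ≤ D := by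
  have hT : 0 < 2 * Real.pi := Real.two_pi_pos
  have h1 : ContDiff ℝ 1 (deriv f) := by
    have : ContDiff ℝ (1 + 1) f := by norm_num; exact hf
    exact (contDiff_succ_iff_deriv.1 this).2.2
  have h2 : Continuous (deriv (deriv f)) := h1.continuous_deriv le_rfl
  obtain ⟨B0, hB0⟩ := hp.exists_bound_of_continuous hT hf.continuous
  obtain ⟨B1, hB1⟩ := hp.deriv_real.exists_bound_of_continuous hT h1.continuous
  obtain ⟨B2, hB2⟩ := hp.deriv_real.deriv_real.exists_bound_of_continuous hT h2
  refine ⟨max (max B0 B1) (max B2 1), by positivity, fun t => ⟨?_, ?_, ?_⟩⟩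
  · exact (hB0 t).trans (by simp)
  · exact (hB1 t).trans (by simp)
  · exact (hB2 t).trans (by simp)

lemma upperRoot_cubic {lam : ℝ} (h : lambda0 < lam) (t : ℝ) :
    upperRoot lam t ^ 3 - lam * upperRoot lam t + Real.cos t = 0 := by
  rw [upperRoot_eq h]; exact topRoot_cubic h (abs_cos_le t)

lemma inflection_lt_upperRoot {lam : ℝ} (h : lambda0 < lam) (t : ℝ) :
    √(lam / 3) < upperRoot lam t := by
  rw [upperRoot_eq h]; exact inflection_lt_topRoot h (abs_cos_le t)

lemma deriv_upperRoot {lam : ℝ} (h : lambda0 < lam) (t : ℝ) :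
    deriv (upperRoot lam) t * (3 * upperRoot lam t ^ 2 - lam) = Real.sin t := by
  have hd : HasDerivAt (upperRoot lam) (deriv (upperRoot lam) t) t :=
    ((contDiff_upperRoot h).differentiable (by norm_num) t).hasDerivAt
  have h1 := ((hd.pow 3).sub (hd.const_mul lam)).add (Real.hasDerivAt_cos t)
  have h2 : (upperRoot lam ^ 3 - (fun y => lam * upperRoot lam y)) + Real.cos = fun _ => 0 := by
    funext x; exact upperRoot_cubic h x
  have h3 := h1.congr_of_eventuallyEq (f₁ := fun _ => 0)
    (Eventually.of_forall fun x => (congrFun h2 x).symm)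
  have h4 := h3.unique (hasDerivAt_const t (0 : ℝ))
  push_cast at h4
  linear_combination h4

lemma upperRoot_mono {lam : ℝ} (h : lambda0 < lam) : MonotoneOn (upperRoot lam) (Icc 0 Real.pi) :=
  fun x hx y hy hxy => by
  rw [upperRoot_eq h, upperRoot_eq h]
  exact topRoot_anti h (abs_cos_le _) (abs_cos_le _)
    (Real.cos_le_cos_of_nonneg_of_le_pi hx.1 hy.2 hxy)

lemma upperRoot_strictMono {lam : ℝ} (h : lambda0 < lam) :
    StrictMonoOn (upperRoot lam) (Icc 0 Real.pi) := fun x hx y hy hxy => by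
  rw [upperRoot_eq h, upperRoot_eq h]
  exact topRoot_strictAnti h (abs_cos_le _) (abs_cos_le _)
    (Real.cos_lt_cos_of_nonneg_of_le_pi hx.1 hy.2 hxy)

lemma lowerRoot_mono {lam : ℝ} (h : lambda0 < lam) : MonotoneOn (lowerRoot lam) (Icc 0 Real.pi) :=
  fun x hx y hy hxy => by
  rw [lowerRoot_eq h, lowerRoot_eq h, neg_le_neg_iff]
  exact topRoot_anti h (abs_neg_le (abs_cos_le _)) (abs_neg_le (abs_cos_le _))
    (neg_le_neg (Real.cos_le_cos_of_nonneg_of_le_pi hx.1 hy.2 hxy))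

lemma upperRoot_zero_le {lam : ℝ} (h : lambda0 < lam) (t : ℝ) :
    upperRoot lam 0 ≤ upperRoot lam t := by
  rw [upperRoot_eq h, upperRoot_eq h, Real.cos_zero]
  exact topRoot_anti h (abs_cos_le _) (by norm_num) (Real.cos_le_one t)

lemma upperRoot_le_pi {lam : ℝ} (h : lambda0 < lam) (t : ℝ) :
    upperRoot lam t ≤ upperRoot lam Real.pi := by
  rw [upperRoot_eq h, upperRoot_eq h, Real.cos_pi]
  exact topRoot_anti h (by norm_num) (abs_cos_le _) (Real.neg_one_le_cos t)

lemma upperRoot_pi_div_two {lam : ℝ} (h : lambda0 < lam) :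
    upperRoot lam (Real.pi / 2) = √lam := by
  have h1 := upperRoot_cubic h (Real.pi / 2)
  have h2 := (inflection_pos h).trans (inflection_lt_upperRoot h (Real.pi / 2))
  rw [Real.cos_pi_div_two] at h1
  set A := upperRoot lam (Real.pi / 2)
  have h3 : A * (A ^ 2 - lam) = 0 := by linear_combination h1
  rcases mul_eq_zero.1 h3 with h4 | h4
  · linarith
  · rw [← Real.sqrt_sq h2.le]; congr 1; linarith

lemma lowerRoot_pi_div_two {lam : ℝ} (h : lambda0 < lam) :
    lowerRoot lam (Real.pi / 2) = -√lam := by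
  rw [← upperRoot_pi_div_two h, ← lowerRoot_pi_sub h]; congr 1; ring

/-- By Vieta, λ - 3(B - A)² = (2A - B)(2B - A), a product of positive factors. -/
lemma abs_middleRoot_lt {lam : ℝ} (h : lambda0 < lam) (t : ℝ) :
    |middleRoot lam t| < √(lam / 3) := by
  have hc := abs_cos_le t
  obtain ⟨h1, -⟩ := topRoot_vieta h hc
  have h2 := topRoot_lt_two_mul h hc
  have h3 := topRoot_neg_lt_two_mul h hc
  have hs := inflection_sq h
  have hr := inflection_pos h
  rw [middleRoot_eq h]
  set A := topRoot lam (Real.cos t)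
  set B := topRoot lam (-Real.cos t)
  apply abs_lt_of_sq_lt_sq _ hr.le
  nlinarith

/-! ### Tools from one-variable calculus -/

section Calculus

variable {f : ℝ → ℝ}

lemma _root_.ContDiff.hasDerivAt_real (hf : ContDiff ℝ 2 f) (t : ℝ) :
    HasDerivAt f (deriv f t) t := (hf.differentiable (by norm_num) t).hasDerivAt

lemma _root_.ContDiff.contDiff_one_deriv (hf : ContDiff ℝ 2 f) : ContDiff ℝ 1 (deriv f) := by
  have : ContDiff ℝ (1 + 1) f := by norm_num; exact hf
  exact (contDiff_succ_iff_deriv.1 this).2.2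

lemma _root_.ContDiff.hasDerivAt_deriv_real (hf : ContDiff ℝ 2 f) (t : ℝ) :
    HasDerivAt (deriv f) (deriv (deriv f) t) t :=
  (hf.contDiff_one_deriv.differentiable (by norm_num) t).hasDerivAt

lemma contDiff_two_of_hasDerivAt {f' f'' : ℝ → ℝ} (h1 : ∀ t, HasDerivAt f (f' t) t)
    (h2 : ∀ t, HasDerivAt f' (f'' t) t) (h3 : Continuous f'') :
    ContDiff ℝ 2 f ∧ deriv f = f' ∧ deriv (deriv f) = f'' := by
  have e1 : deriv f = f' := funext fun t => (h1 t).deriv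
  have e2 : deriv f' = f'' := funext fun t => (h2 t).deriv
  refine ⟨?_, e1, by rw [e1, e2]⟩
  have h4 : ContDiff ℝ 1 f' :=
    contDiff_one_iff_deriv.2 ⟨fun t => (h2 t).differentiableAt, by rw [e2]; exact h3⟩
  have h5 : ContDiff ℝ (1 + 1) f :=
    contDiff_succ_iff_deriv.2 ⟨fun t => (h1 t).differentiableAt, by simp, by rw [e1]; exact h4⟩
  norm_num at h5
  exact h5

/-- Derivatives of `t ↦ σ * f (a + b * t)`. -/
lemma deriv_affine (hf : ContDiff ℝ 2 f) (σ a b : ℝ) :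
    ContDiff ℝ 2 (fun t => σ * f (a + b * t)) ∧
    (∀ t, deriv (fun t => σ * f (a + b * t)) t = σ * b * deriv f (a + b * t)) ∧
    ∀ t, deriv (deriv fun t => σ * f (a + b * t)) t = σ * b ^ 2 * deriv (deriv f) (a + b * t) := by
  have hl : ∀ t, HasDerivAt (fun t => a + b * t) b t := fun t => by
    simpa using ((hasDerivAt_id t).const_mul b).const_add a
  obtain ⟨h1, h2, h3⟩ := contDiff_two_of_hasDerivAt (f := fun t => σ * f (a + b * t))
    (f' := fun t => σ * b * deriv f (a + b * t))
    (f'' := fun t => σ * b ^ 2 * deriv (deriv f) (a + b * t))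
    (fun t => (((hf.hasDerivAt_real _).comp t (hl t)).const_mul σ).congr_deriv (by ring))
    (fun t => (((hf.hasDerivAt_deriv_real _).comp t (hl t)).const_mul (σ * b)).congr_deriv
      (by ring))
    (continuous_const.mul ((hf.contDiff_one_deriv.continuous_deriv le_rfl).comp (by fun_prop)))
  exact ⟨h1, fun t => congrFun h2 t, fun t => congrFun h3 t⟩

lemma _root_.IsLocalMax.deriv_deriv_nonpos {x : ℝ} (h : IsLocalMax f x) (hc : ContinuousAt f x) :
    deriv (deriv f) x ≤ 0 := by
  by_contra! hcon
  have h1 := isLocalMin_of_deriv_deriv_pos hcon h.deriv_eq_zero hc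
  have h2 : f =ᶠ[𝓝 x] fun _ => f x := by
    filter_upwards [h, h1] with y hy hy' using le_antisymm hy hy'
  have h3 : deriv (deriv f) x = 0 := by
    have h4 : deriv f =ᶠ[𝓝 x] fun _ => 0 := by
      simpa using h2.deriv
    simpa using h4.deriv_eq
  linarith

lemma _root_.IsLocalMin.deriv_deriv_nonneg {x : ℝ} (h : IsLocalMin f x) (hc : ContinuousAt f x) :
    0 ≤ deriv (deriv f) x := by
  have h1 := h.neg.deriv_deriv_nonpos hc.neg
  have h2 : deriv (fun y => -f y) = fun y => -deriv f y := funext fun y => by simp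
  rw [h2, deriv.fun_neg] at h1
  linarith

lemma nonpos_of_deriv_deriv_pos {a b : ℝ} (hc : ContinuousOn f (Icc a b))
    (ha : f a ≤ 0) (hb : f b ≤ 0) (h : ∀ t ∈ Ioo a b, 0 < f t → 0 < deriv (deriv f) t) :
    ∀ t ∈ Icc a b, f t ≤ 0 := by
  intro t ht
  by_contra! hcon
  obtain ⟨x, hx, hmax⟩ := isCompact_Icc.exists_isMaxOn ⟨t, ht⟩ hc
  have hpos : 0 < f x := hcon.trans_le (hmax ht)
  have hxa : x ≠ a := by rintro rfl; linarith
  have hxb : x ≠ b := by rintro rfl; linarith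
  have hxo : x ∈ Ioo a b := ⟨lt_of_le_of_ne hx.1 hxa.symm, lt_of_le_of_ne hx.2 hxb⟩
  have hn : Icc a b ∈ 𝓝 x := Icc_mem_nhds hxo.1 hxo.2
  have := (hmax.isLocalMax hn).deriv_deriv_nonpos (hc.continuousAt hn)
  linarith [h x hxo hpos]

/-- Exponential decay of subsolutions of `w'' = κ² w - D` away from the boundary. -/
lemma le_barrier {w : ℝ → ℝ} {a b κ D B : ℝ} (hκ : 0 < κ) (hD : 0 ≤ D) (hB : 0 ≤ B)
    (hw : ContDiff ℝ 2 w) (ha : w a ≤ B) (hb : w b ≤ B)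
    (h : ∀ t ∈ Ioo a b, 0 < w t → κ ^ 2 * w t - D ≤ deriv (deriv w) t) :
    ∀ t ∈ Icc a b,
      w t ≤ D / κ ^ 2 + B * (Real.exp (-κ * (t - a)) + Real.exp (-κ * (b - t))) := by
  set ψ : ℝ → ℝ := fun t =>
    D / κ ^ 2 + B * (Real.exp (-κ * (t - a)) + Real.exp (-κ * (b - t))) with hψ
  have hE1 : ∀ t, HasDerivAt (fun t => Real.exp (-κ * (t - a)))
      (-κ * Real.exp (-κ * (t - a))) t := fun t =>
    ((((hasDerivAt_id t).sub_const a).const_mul (-κ)).exp).congr_deriv (by simp; ring)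
  have hE2 : ∀ t, HasDerivAt (fun t => Real.exp (-κ * (b - t)))
      (κ * Real.exp (-κ * (b - t))) t := fun t =>
    ((((hasDerivAt_id t).const_sub b).const_mul (-κ)).exp).congr_deriv (by simp; ring)
  have hd : ∀ t, HasDerivAt (fun t => w t - ψ t) (deriv w t -
      B * (-κ * Real.exp (-κ * (t - a)) + κ * Real.exp (-κ * (b - t)))) t := fun t =>
    (hw.hasDerivAt_real t).sub ((((hE1 t).add (hE2 t)).const_mul B).const_add _)
  have hdd : ∀ t, HasDerivAt (fun t => deriv w t -
      B * (-κ * Real.exp (-κ * (t - a)) + κ * Real.exp (-κ * (b - t))))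
      (deriv (deriv w) t - κ ^ 2 * (ψ t - D / κ ^ 2)) t := fun t =>
    ((hw.hasDerivAt_deriv_real t).sub
      ((((hE1 t).const_mul (-κ)).add ((hE2 t).const_mul κ)).const_mul B)).congr_deriv
      (by simp only [hψ]; ring)
  have e1 := funext fun t => (hd t).deriv
  have hψpos : ∀ t, 0 ≤ ψ t := fun t => by positivity
  have key := nonpos_of_deriv_deriv_pos (f := fun t => w t - ψ t) (a := a) (b := b)
    (fun t _ => (hd t).continuousAt.continuousWithinAt) ?_ ?_ ?_
  · intro t ht
    have := key t ht
    simp only [hψ] at this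
    linarith
  · have h1 : B * 1 ≤ B * (Real.exp (-κ * (a - a)) + Real.exp (-κ * (b - a))) := by
      apply mul_le_mul_of_nonneg_left _ hB
      rw [sub_self, mul_zero, Real.exp_zero]
      linarith [Real.exp_pos (-κ * (b - a))]
    have h2 : 0 ≤ D / κ ^ 2 := by positivity
    simp only [hψ]
    linarith
  · have h1 : B * 1 ≤ B * (Real.exp (-κ * (b - a)) + Real.exp (-κ * (b - b))) := by
      apply mul_le_mul_of_nonneg_left _ hB
      rw [sub_self, mul_zero, Real.exp_zero]
      linarith [Real.exp_pos (-κ * (b - a))]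
    have h2 : 0 ≤ D / κ ^ 2 := by positivity
    simp only [hψ]
    linarith
  · intro t ht hpos
    rw [e1, (hdd t).deriv]
    have h1 : 0 < w t - ψ t := hpos
    have h2 := h t ht (by linarith [hψpos t])
    have h3 : κ ^ 2 * (D / κ ^ 2) = D := by field_simp
    nlinarith [pow_pos hκ 2]

/-- Exponential growth of supersolutions of `h'' = κ² h`. -/
lemma growth_le {h : ℝ → ℝ} {a b κ : ℝ} (hκ : 0 < κ) (hh : ContDiff ℝ 2 h)
    (hconv : ∀ t ∈ Icc a b, κ ^ 2 * h t ≤ deriv (deriv h) t) :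
    ∀ t ∈ Icc a b, h a + (deriv h a + κ * h a) * ((Real.exp (2 * κ * (t - a)) - 1) / (2 * κ)) ≤
      h t * Real.exp (κ * (t - a)) := by
  set g0 := deriv h a + κ * h a
  have hE : ∀ c t, HasDerivAt (fun t => Real.exp (c * (t - a)))
      (c * Real.exp (c * (t - a))) t := fun c t =>
    ((((hasDerivAt_id t).sub_const a).const_mul c).exp).congr_deriv (by simp; ring)
  -- Factor d² - κ² as (d - κ)(d + κ): first integrate for h' + κh with the weight exp(-κ(t - a)),
  -- then for h with exp(κ(t - a)).
  have step1 : ∀ t ∈ Icc a b, g0 * Real.exp (κ * (t - a)) ≤ deriv h t + κ * h t := by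
    have hd : ∀ t, HasDerivAt (fun t => (deriv h t + κ * h t) * Real.exp (-κ * (t - a)))
        ((deriv (deriv h) t - κ ^ 2 * h t) * Real.exp (-κ * (t - a))) t := fun t =>
      (((hh.hasDerivAt_deriv_real t).add ((hh.hasDerivAt_real t).const_mul κ)).mul
        (hE (-κ) t)).congr_deriv (by simp; ring)
    have hm : MonotoneOn (fun t => (deriv h t + κ * h t) * Real.exp (-κ * (t - a)))
        (Icc a b) := by
      apply monotoneOn_of_deriv_nonneg (convex_Icc a b)
      · exact fun t _ => (hd t).continuousAt.continuousWithinAt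
      · exact fun t _ => (hd t).differentiableAt.differentiableWithinAt
      · intro t ht
        rw [(hd t).deriv]
        exact mul_nonneg (by linarith [hconv t (interior_subset ht)]) (Real.exp_pos _).le
    intro t ht
    have h1 := hm (left_mem_Icc.2 (ht.1.trans ht.2)) ht ht.1
    simp only [sub_self, mul_zero, Real.exp_zero, mul_one] at h1
    have h2 : Real.exp (-κ * (t - a)) * Real.exp (κ * (t - a)) = 1 := by
      rw [← Real.exp_add]; simp
    calc g0 * Real.exp (κ * (t - a)) ≤
        (deriv h t + κ * h t) * Real.exp (-κ * (t - a)) * Real.exp (κ * (t - a)) :=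
          mul_le_mul_of_nonneg_right h1 (Real.exp_pos _).le
      _ = _ := by rw [mul_assoc, h2, mul_one]
  have hd : ∀ t, HasDerivAt (fun t => h t * Real.exp (κ * (t - a)) -
      g0 * ((Real.exp (2 * κ * (t - a)) - 1) / (2 * κ)))
      ((deriv h t + κ * h t) * Real.exp (κ * (t - a)) - g0 * Real.exp (2 * κ * (t - a))) t :=
    fun t => (((hh.hasDerivAt_real t).mul (hE κ t)).sub
      ((((hE (2 * κ) t).sub_const 1).div_const (2 * κ)).const_mul g0)).congr_deriv
      (by field_simp)
  have hm : MonotoneOn (fun t => h t * Real.exp (κ * (t - a)) -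
      g0 * ((Real.exp (2 * κ * (t - a)) - 1) / (2 * κ))) (Icc a b) := by
    apply monotoneOn_of_deriv_nonneg (convex_Icc a b)
    · exact fun t _ => (hd t).continuousAt.continuousWithinAt
    · exact fun t _ => (hd t).differentiableAt.differentiableWithinAt
    · intro t ht
      rw [(hd t).deriv]
      have h1 := mul_le_mul_of_nonneg_right (step1 t (interior_subset ht))
        (Real.exp_pos (κ * (t - a))).le
      have h2 : Real.exp (2 * κ * (t - a)) = Real.exp (κ * (t - a)) * Real.exp (κ * (t - a)) := by
        rw [← Real.exp_add]; congr 1; ring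
      rw [h2]; linarith
  intro t ht
  have h1 := hm (left_mem_Icc.2 (ht.1.trans ht.2)) ht ht.1
  simp only [sub_self, mul_zero, Real.exp_zero, mul_one, zero_div, sub_zero] at h1
  linarith

/-- A bounded function which is strictly convex wherever it is positive is nonpositive. -/
lemma nonpos_of_bounded {z : ℝ → ℝ} {B : ℝ} (hz : ContDiff ℝ 2 z) (hB : ∀ t, z t ≤ B)
    (h : ∀ t, 0 < z t → 0 < deriv (deriv z) t) : ∀ t, z t ≤ 0 := by
  have right : ∀ {z : ℝ → ℝ}, ContDiff ℝ 2 z → (∀ t, z t ≤ B) →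
      (∀ t, 0 < z t → 0 < deriv (deriv z) t) → ∀ t0, 0 < z t0 → ∀ t, t0 ≤ t → z t ≤ z t0 := by
    intro z hz hB h t0 h0 t ht
    have hB0 : 0 < B := h0.trans_le (hB t0)
    -- Comparison on [t0, t0 + R] with a line of slope B/R; letting R → ∞ removes the slope. Applied
    -- in both directions, it makes every point of positivity a local maximum, against strict
    -- convexity.
    have key : ∀ R, 0 < R → t ≤ t0 + R → z t - z t0 ≤ (t - t0) * B / R := by
      intro R hR htR
      have hl : ∀ x, HasDerivAt (fun x => z x - (z t0 + (x - t0) * (B / R)))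
          (deriv z x - B / R) x := fun x =>
        ((hz.hasDerivAt_real x).sub ((((hasDerivAt_id x).sub_const t0).mul_const
          (B / R)).const_add (z t0))).congr_deriv (by simp)
      have e1 := funext fun x => (hl x).deriv
      have := nonpos_of_deriv_deriv_pos (f := fun x => z x - (z t0 + (x - t0) * (B / R)))
        (a := t0) (b := t0 + R) (fun x _ => (hl x).continuousAt.continuousWithinAt)
        (by simp) (by
          have h1 : (t0 + R - t0) * (B / R) = B := by field_simp; ring
          rw [h1]; linarith [hB (t0 + R)]) (by
          intro x hx hpos
          rw [e1, deriv_sub_const]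
          have h2 : 0 ≤ (x - t0) * (B / R) := mul_nonneg (by linarith [hx.1]) (by positivity)
          exact h x (by linarith)) t ⟨ht, htR⟩
      have h3 : (t - t0) * B / R = (t - t0) * (B / R) := by ring
      linarith
    have hlim : Tendsto (fun R : ℝ => (t - t0) * B / R) atTop (𝓝 0) :=
      tendsto_const_nhds.div_atTop tendsto_id
    have := ge_of_tendsto hlim (b := z t - z t0) (by
      filter_upwards [eventually_gt_atTop 0, eventually_ge_atTop (t - t0)] with R h1 h2
      exact key R h1 (by linarith))
    linarith
  intro t0
  by_contra! h0
  have hmax : IsLocalMax z t0 := by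
    refine Eventually.of_forall fun t => ?_
    rcases le_total t0 t with ht | ht
    · exact right hz hB h t0 h0 t ht
    · obtain ⟨h1, h2, h3⟩ := deriv_affine hz 1 0 (-1)
      have := right h1 (by intro t; simpa using hB _) (by
        intro t; rw [h3]; simpa using h _) (-t0) (by simpa using h0) (-t) (by linarith)
      simpa using this
  linarith [hmax.deriv_deriv_nonpos hz.continuous.continuousAt, h t0 h0]

/-- The mean value theorem on [t, t + 1] provides the points; convergence of the derivative itself
is not assumed. -/
lemma exists_tendsto_deriv_zero {g g' : ℝ → ℝ} {ℓ : ℝ} (hg : ∀ t, HasDerivAt g (g' t) t)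
    (h1 : Tendsto g atTop (𝓝 ℓ)) :
    ∃ ξ : ℝ → ℝ, Tendsto ξ atTop atTop ∧ Tendsto (fun t => g' (ξ t)) atTop (𝓝 0) := by
  have h3 : ∀ t : ℝ, ∃ ξ ∈ Ioo t (t + 1), g' ξ = g (t + 1) - g t := by
    intro t
    obtain ⟨ξ, hξ, he⟩ := exists_hasDerivAt_eq_slope g g' (by linarith : t < t + 1)
      (fun x _ => (hg x).continuousAt.continuousWithinAt) (fun x _ => hg x)
    exact ⟨ξ, hξ, by rw [he]; simp⟩
  choose ξ hξ he using h3
  refine ⟨ξ, tendsto_atTop_mono (fun t => (hξ t).1.le) tendsto_id, ?_⟩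
  have h5 : Tendsto (fun t => g (t + 1) - g t) atTop (𝓝 (ℓ - ℓ)) :=
    (h1.comp (tendsto_atTop_add_const_right _ _ tendsto_id)).sub h1
  simp_rw [he]
  rwa [sub_self] at h5

lemma eq_zero_of_tendsto_deriv {g g' : ℝ → ℝ} {ℓ d : ℝ} (hg : ∀ t, HasDerivAt g (g' t) t)
    (h1 : Tendsto g atTop (𝓝 ℓ)) (h2 : Tendsto g' atTop (𝓝 d)) : d = 0 := by
  obtain ⟨ξ, h3, h4⟩ := exists_tendsto_deriv_zero hg h1
  exact tendsto_nhds_unique (h2.comp h3) h4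

/-- Each low-high-low triple has an interior maximum, and the triples occupy disjoint open
intervals. -/
lemma card_localMax_of_alternating (hf : Continuous f) {a b : ℝ} {N : ℕ} {x : ℕ → ℝ}
    (hx : StrictMono x) (ha : a ≤ x 0) (hb : x (2 * N) ≤ b)
    (h1 : ∀ i < N, f (x (2 * i)) < f (x (2 * i + 1)))
    (h2 : ∀ i < N, f (x (2 * i + 2)) < f (x (2 * i + 1))) {S : Finset ℝ}
    (hS : ∀ y ∈ Ioo a b, IsLocalMax f y → y ∈ S) : N ≤ S.card := by
  have key : ∀ i, ∃ y, i < N → y ∈ Ioo (x (2 * i)) (x (2 * i + 2)) ∧ IsLocalMax f y := by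
    intro i
    by_cases hi : i < N
    · have hlt1 : x (2 * i) < x (2 * i + 1) := hx (by omega)
      have hlt2 : x (2 * i + 1) < x (2 * i + 2) := hx (by omega)
      have hmem : x (2 * i + 1) ∈ Icc (x (2 * i)) (x (2 * i + 2)) := ⟨hlt1.le, hlt2.le⟩
      obtain ⟨y, hy, hmax⟩ := isCompact_Icc.exists_isMaxOn ⟨_, hmem⟩ hf.continuousOn
      have hge : f (x (2 * i + 1)) ≤ f y := hmax hmem
      have hne1 : y ≠ x (2 * i) := by rintro rfl; linarith [h1 i hi]
      have hne2 : y ≠ x (2 * i + 2) := by rintro rfl; linarith [h2 i hi]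
      have hyo : y ∈ Ioo (x (2 * i)) (x (2 * i + 2)) :=
        ⟨lt_of_le_of_ne hy.1 hne1.symm, lt_of_le_of_ne hy.2 hne2⟩
      exact ⟨y, fun _ => ⟨hyo, hmax.isLocalMax (Icc_mem_nhds hyo.1 hyo.2)⟩⟩
    · exact ⟨0, fun h => absurd h hi⟩
  choose y hy using key
  have hinj : Set.InjOn y (Finset.range N : Set ℕ) := by
    intro i hi j hj hij
    simp only [Finset.coe_range, mem_Iio] at hi hj
    by_contra hne
    rcases lt_or_gt_of_ne hne with hlt | hlt
    · have : x (2 * i + 2) ≤ x (2 * j) := hx.monotone (by omega)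
      linarith [(hy i hi).1.2, (hy j hj).1.1]
    · have : x (2 * j + 2) ≤ x (2 * i) := hx.monotone (by omega)
      linarith [(hy j hj).1.2, (hy i hi).1.1]
  have hsub : (Finset.range N).image y ⊆ S := by
    intro z hz
    obtain ⟨i, hi, rfl⟩ := Finset.mem_image.1 hz
    have hi := Finset.mem_range.1 hi
    obtain ⟨h3, h4⟩ := hy i hi
    refine hS _ ⟨?_, ?_⟩ h4
    · exact (ha.trans (hx.monotone (by omega))).trans_lt h3.1
    · exact h3.2.trans_le ((hx.monotone (by omega)).trans hb)
  have := Finset.card_le_card hsub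
  rwa [Finset.card_image_of_injOn hinj, Finset.card_range] at this

/-- Two equal values would force an interior extremum, as in Rolle's theorem; so f is injective, and
continuity makes it monotone. -/
lemma strictMonoOn_or_strictAntiOn_of_no_extr (hf : Continuous f) {a b : ℝ} (hab : a ≤ b)
    (h : ∀ y ∈ Ioo a b, ¬IsLocalExtr f y) :
    StrictMonoOn f (Icc a b) ∨ StrictAntiOn f (Icc a b) := by
  refine ContinuousOn.strictMonoOn_of_injOn_Icc' hab hf.continuousOn ?_
  have key : ∀ x ∈ Icc a b, ∀ y ∈ Icc a b, x < y → f x ≠ f y := by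
    intro x hx y hy hxy he
    obtain ⟨c, hc, hext⟩ := exists_isLocalExtr_Ioo hxy hf.continuousOn he
    exact h c ⟨hx.1.trans_lt hc.1, hc.2.trans_le hy.2⟩ hext
  intro x hx y hy he
  by_contra hne
  rcases lt_or_gt_of_ne hne with hlt | hlt
  · exact key x hx y hy hlt he
  · exact key y hy x hx hlt he.symm

/-- Uniqueness for `d'' = Q d` with vanishing initial data. -/
lemma eq_zero_of_linear_ode {d Q : ℝ → ℝ} {a : ℝ} (hd : ContDiff ℝ 2 d) (hQ : Continuous Q)
    (h : ∀ t, deriv (deriv d) t = Q t * d t) (h0 : d a = 0) (h1 : deriv d a = 0) :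
    ∀ t, d t = 0 := by
  have right : ∀ {d Q : ℝ → ℝ} {a : ℝ}, ContDiff ℝ 2 d → Continuous Q →
      (∀ t, deriv (deriv d) t = Q t * d t) → d a = 0 → deriv d a = 0 → ∀ t, a ≤ t → d t = 0 := by
    intro d Q a hd hQ h h0 h1 t hat
    obtain ⟨C, hC⟩ := (isCompact_Icc (a := a) (b := t)).exists_bound_of_continuousOn
      hQ.continuousOn
    -- Gronwall: d² + d'² grows at rate at most 1 + C, so the weighted quantity is nonincreasing and
    -- starts at 0.
    set e : ℝ → ℝ := fun s => (d s ^ 2 + deriv d s ^ 2) * Real.exp (-(1 + C) * (s - a))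
    have he : ∀ s, HasDerivAt e ((2 * d s * deriv d s * (1 + Q s) -
        (1 + C) * (d s ^ 2 + deriv d s ^ 2)) * Real.exp (-(1 + C) * (s - a))) s := by
      intro s
      have h2 := ((hd.hasDerivAt_real s).pow 2).add ((hd.hasDerivAt_deriv_real s).pow 2)
      have h3 : HasDerivAt (fun s => Real.exp (-(1 + C) * (s - a)))
          (-(1 + C) * Real.exp (-(1 + C) * (s - a))) s :=
        ((((hasDerivAt_id s).sub_const a).const_mul (-(1 + C))).exp).congr_deriv (by simp; ring)
      refine (h2.mul h3).congr_deriv ?_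
      rw [h s]
      simp only [Pi.add_apply, Pi.pow_apply]
      push_cast
      ring
    have hanti : AntitoneOn e (Icc a t) := by
      apply antitoneOn_of_deriv_nonpos (convex_Icc a t)
      · exact fun s _ => (he s).continuousAt.continuousWithinAt
      · exact fun s _ => (he s).differentiableAt.differentiableWithinAt
      · intro s hs
        rw [(he s).deriv]
        refine mul_nonpos_of_nonpos_of_nonneg ?_ (Real.exp_pos _).le
        have h4 := abs_le.1 (hC s (interior_subset hs))
        nlinarith [sq_nonneg (d s - deriv d s), sq_nonneg (d s + deriv d s),
          mul_nonneg (sub_nonneg.2 h4.2) (sq_nonneg (d s + deriv d s)),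
          mul_nonneg (by linarith : 0 ≤ Q s + C) (sq_nonneg (d s - deriv d s))]
    have h5 := hanti (left_mem_Icc.2 hat) (right_mem_Icc.2 hat) hat
    have h6 : e a = 0 := by simp [e, h0, h1]
    rw [h6] at h5
    have h7 : d t ^ 2 + deriv d t ^ 2 ≤ 0 :=
      nonpos_of_mul_nonpos_left h5 (Real.exp_pos _)
    nlinarith [sq_nonneg (d t), sq_nonneg (deriv d t)]
  intro t
  rcases le_total a t with hat | hat
  · exact right hd hQ h h0 h1 t hat
  · obtain ⟨h2, h3, h4⟩ := deriv_affine hd 1 0 (-1)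
    have := right (a := -a) h2 (Q := fun t => Q (-t)) (hQ.comp continuous_neg)
      (fun t => by rw [h4, h]; simp) (by simpa using h0) (by rw [h3]; simpa using h1) (-t)
      (by linarith)
    simpa using this

end Calculus

/-- Solutions of the autonomous equation are determined by position and velocity at one time. -/
lemma IsAutonomousSolution.eq_of_initial {lam κ a : ℝ} {V W : ℝ → ℝ}
    (hV : IsAutonomousSolution lam κ V) (hW : IsAutonomousSolution lam κ W) (h0 : V a = W a)
    (h1 : deriv V a = deriv W a) : V = W := by
  have hd : ∀ t, HasDerivAt (fun t => V t - W t) (deriv V t - deriv W t) t := fun t =>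
    (hV.1.hasDerivAt_real t).sub (hW.1.hasDerivAt_real t)
  have hdd : ∀ t, HasDerivAt (fun t => deriv V t - deriv W t)
      (deriv (deriv V) t - deriv (deriv W) t) t := fun t =>
    (hV.1.hasDerivAt_deriv_real t).sub (hW.1.hasDerivAt_deriv_real t)
  have e1 : deriv (fun t => V t - W t) = fun t => deriv V t - deriv W t :=
    funext fun t => (hd t).deriv
  have := eq_zero_of_linear_ode (d := fun t => V t - W t)
    (Q := fun t => V t ^ 2 + V t * W t + W t ^ 2 - lam) (a := a) (hV.1.sub hW.1)
    (by have := hV.1.continuous; have := hW.1.continuous; fun_prop)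
    (fun t => by rw [e1, (hdd t).deriv, hV.2, hW.2]; ring) (by simp [h0]) (by rw [e1]; simp [h1])
  exact funext fun t => sub_eq_zero.1 (this t)

lemma IsAutonomousSolution.affine {lam κ : ℝ} {V : ℝ → ℝ} (hV : IsAutonomousSolution lam κ V)
    {σ b : ℝ} (hσ : σ ^ 2 = 1) (hb : b ^ 2 = 1) (a : ℝ) :
    IsAutonomousSolution lam (σ * κ) fun τ => σ * V (a + b * τ) := by
  obtain ⟨h1, -, h3⟩ := deriv_affine hV.1 σ a b
  refine ⟨h1, fun τ => ?_⟩
  rw [h3, hV.2, hb]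
  linear_combination (-σ * V (a + b * τ) ^ 3) * hσ

/-! ### Fast-time limits of bounded families of solutions -/

/-- Ultrafilters replace the extraction of subsequences throughout: one limit along `𝓤` serves all
bounded quantities at once. -/
lemma exists_tendsto_of_bounded {ι : Type*} {𝓤 : Ultrafilter ι} {g : ι → ℝ} {a b : ℝ}
    (hg : ∀ᶠ i in 𝓤, g i ∈ Icc a b) : ∃ x ∈ Icc a b, Tendsto g 𝓤 (𝓝 x) := by
  obtain ⟨x, hx, hle⟩ := isCompact_Icc.ultrafilter_le_nhds (𝓤.map g)
    (le_principal_iff.2 hg)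
  exact ⟨x, hx, hle⟩

lemma tendsto_atTop_or_exists_tendsto {ι : Type*} {𝓤 : Ultrafilter ι} {g : ι → ℝ}
    (hg : ∀ᶠ i in 𝓤, 0 ≤ g i) : Tendsto g 𝓤 atTop ∨ ∃ x, 0 ≤ x ∧ Tendsto g 𝓤 (𝓝 x) := by
  by_cases h : Tendsto g 𝓤 atTop
  · exact Or.inl h
  · right
    rw [tendsto_atTop] at h
    push Not at h
    obtain ⟨R, hR⟩ := h
    obtain ⟨x, hx, hlim⟩ := exists_tendsto_of_bounded (𝓤 := 𝓤) (g := g) (a := 0) (b := R) (by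
      filter_upwards [hg, hR] with i h1 h2
      exact ⟨h1, h2.le⟩)
    exact ⟨x, hx.1, hlim⟩

/-- A Taylor inequality with a uniform constant survives pointwise limits. This lets derivatives
pass to fast-time limits without Arzelà–Ascoli. -/
lemma hasDerivAt_of_quadratic {f : ℝ → ℝ} {f' x C : ℝ}
    (h : ∀ η, |f (x + η) - f x - η * f'| ≤ C * η ^ 2) : HasDerivAt f f' x := by
  rw [hasDerivAt_iff_isLittleO_nhds_zero]
  have h1 : (fun η => f (x + η) - f x - η • f') =O[𝓝 0] fun η : ℝ => η ^ 2 := by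
    refine Asymptotics.IsBigO.of_bound C (Eventually.of_forall fun η => ?_)
    rw [Real.norm_eq_abs, Real.norm_eq_abs, abs_of_nonneg (sq_nonneg η), smul_eq_mul]
    exact h η
  exact h1.trans_isLittleO (Asymptotics.isLittleO_pow_id (by norm_num))

/-! ### Taylor estimates in fast time with constants independent of ε. -/

section Estimates

variable {lam ε B : ℝ} {u : ℝ → ℝ}

/-- A bound for `u³ - lam u + cos t` when `|u| ≤ B`. -/
noncomputable def forceBound (lam B : ℝ) : ℝ := B ^ 3 + |lam| * B + 1

lemma abs_force_le (hB : ∀ t, |u t| ≤ B) (t : ℝ) :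
    |u t ^ 3 - lam * u t + Real.cos t| ≤ forceBound lam B := by
  have h1 : |u t| ^ 3 ≤ B ^ 3 := pow_le_pow_left₀ (abs_nonneg _) (hB t) 3
  have h2 : |lam| * |u t| ≤ |lam| * B := mul_le_mul_of_nonneg_left (hB t) (abs_nonneg _)
  have h3 := abs_cos_le t
  calc |u t ^ 3 - lam * u t + Real.cos t| ≤ |u t ^ 3 - lam * u t| + |Real.cos t| := abs_add_le _ _
    _ ≤ |u t ^ 3| + |lam * u t| + |Real.cos t| := by gcongr; exact abs_sub _ _
    _ = |u t| ^ 3 + |lam| * |u t| + |Real.cos t| := by rw [abs_pow, abs_mul]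
    _ ≤ _ := by unfold forceBound; linarith

lemma forceBound_pos (hB : ∀ t, |u t| ≤ B) : 0 < forceBound lam B := by
  have : 0 ≤ B := (abs_nonneg _).trans (hB 0)
  unfold forceBound; positivity

lemma exists_slope_mul {f f' : ℝ → ℝ} (hf : ∀ x, HasDerivAt f (f' x) x) (t η : ℝ) :
    ∃ ξ, |ξ - t| ≤ |η| ∧ f (t + η) - f t = η * f' ξ := by
  rcases lt_trichotomy η 0 with h | h | h
  · obtain ⟨ξ, hξ, he⟩ := exists_hasDerivAt_eq_slope f f' (by linarith : t + η < t)
      (fun x _ => (hf x).continuousAt.continuousWithinAt) fun x _ => hf x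
    refine ⟨ξ, ?_, ?_⟩
    · rw [abs_of_neg h, abs_of_neg (by linarith [hξ.2])]; linarith [hξ.1]
    · rw [he, show t - (t + η) = -η by ring]; have := h.ne; field_simp; ring
  · exact ⟨t, by simp [h], by simp [h]⟩
  · obtain ⟨ξ, hξ, he⟩ := exists_hasDerivAt_eq_slope f f' (by linarith : t < t + η)
      (fun x _ => (hf x).continuousAt.continuousWithinAt) fun x _ => hf x
    refine ⟨ξ, ?_, ?_⟩
    · rw [abs_of_pos h, abs_of_pos (by linarith [hξ.1])]; linarith [hξ.2]
    · rw [he, add_sub_cancel_left]; field_simp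

lemma abs_velocity_sub_le (hu : IsSolution lam ε u) (hB : ∀ t, |u t| ≤ B)
    (t η : ℝ) : |ε * deriv u (t + ε * η) - ε * deriv u t| ≤ forceBound lam B * |η| := by
  obtain ⟨ξ, -, he⟩ := exists_slope_mul hu.1.hasDerivAt_deriv_real t (ε * η)
  rw [← mul_sub, he]
  have h1 : ε * (ε * η * deriv (deriv u) ξ) = η * (u ξ ^ 3 - lam * u ξ + Real.cos ξ) := by
    rw [← hu.2]; ring
  rw [h1, abs_mul, mul_comm]
  exact mul_le_mul_of_nonneg_right (abs_force_le hB ξ) (abs_nonneg _)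

/-- A bound for `|ε u'|` when `|u| ≤ B`. -/
noncomputable def velocityBound (lam B : ℝ) : ℝ := 2 * B + forceBound lam B

/-- Some ξ within ε of t has |ε u'(ξ)| ≤ 2B by the mean value theorem, and the bound on the force
carries this back to t. -/
lemma abs_velocity_le (hε : 0 < ε) (hu : IsSolution lam ε u) (hB : ∀ t, |u t| ≤ B) (t : ℝ) :
    |ε * deriv u t| ≤ velocityBound lam B := by
  obtain ⟨ξ, hξ, he⟩ := exists_slope_mul hu.1.hasDerivAt_real t ε
  have h1 : |ε * deriv u ξ| ≤ 2 * B := by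
    rw [← he]
    calc |u (t + ε) - u t| ≤ |u (t + ε)| + |u t| := abs_sub _ _
      _ ≤ _ := by linarith [hB (t + ε), hB t]
  have h2 := abs_velocity_sub_le hu hB t ((ξ - t) / ε)
  rw [mul_div_cancel₀ _ hε.ne', add_sub_cancel, abs_div, abs_of_pos hε] at h2
  have h3 : |ξ - t| / ε ≤ 1 := by rw [div_le_one hε]; rwa [abs_of_pos hε] at hξ
  have h4 : forceBound lam B * (|ξ - t| / ε) ≤ forceBound lam B :=
    mul_le_of_le_one_right (forceBound_pos hB).le h3
  have h5 := abs_sub_abs_le_abs_sub (ε * deriv u t) (ε * deriv u ξ)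
  rw [abs_sub_comm] at h5
  unfold velocityBound
  linarith

lemma velocityBound_pos (hB : ∀ t, |u t| ≤ B) : 0 < velocityBound lam B := by
  have : 0 ≤ B := (abs_nonneg _).trans (hB 0)
  have := forceBound_pos (lam := lam) hB
  unfold velocityBound; positivity

lemma abs_position_sub_le (hε : 0 < ε) (hu : IsSolution lam ε u) (hB : ∀ t, |u t| ≤ B)
    (t η : ℝ) : |u (t + ε * η) - u t| ≤ velocityBound lam B * |η| := by
  obtain ⟨ξ, -, he⟩ := exists_slope_mul hu.1.hasDerivAt_real t (ε * η)
  rw [he, show ε * η * deriv u ξ = ε * deriv u ξ * η by ring, abs_mul]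
  exact mul_le_mul_of_nonneg_right (abs_velocity_le hε hu hB ξ) (abs_nonneg _)

lemma abs_position_sub_sub_le (hε : 0 < ε) (hu : IsSolution lam ε u) (hB : ∀ t, |u t| ≤ B)
    (t η : ℝ) :
    |u (t + ε * η) - u t - η * (ε * deriv u t)| ≤ forceBound lam B * η ^ 2 := by
  obtain ⟨ξ, hξ, he⟩ := exists_slope_mul hu.1.hasDerivAt_real t (ε * η)
  have h2 := abs_velocity_sub_le hu hB t ((ξ - t) / ε)
  rw [mul_div_cancel₀ _ hε.ne', add_sub_cancel, abs_div, abs_of_pos hε] at h2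
  have h3 : |ξ - t| / ε ≤ |η| := by
    rw [div_le_iff₀ hε, mul_comm]; rwa [abs_mul, abs_of_pos hε] at hξ
  rw [he, show ε * η * deriv u ξ - η * (ε * deriv u t) =
    η * (ε * deriv u ξ - ε * deriv u t) by ring, abs_mul]
  calc |η| * |ε * deriv u ξ - ε * deriv u t| ≤ |η| * (forceBound lam B * |η|) := by
        gcongr
        exact h2.trans (mul_le_mul_of_nonneg_left h3 (forceBound_pos hB).le)
    _ = forceBound lam B * η ^ 2 := by rw [← sq_abs η]; ring

lemma abs_velocity_sub_sub_le (hε : 0 < ε) (hε1 : ε ≤ 1) (hu : IsSolution lam ε u)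
    (hB : ∀ t, |u t| ≤ B) (t η : ℝ) :
    |ε * deriv u (t + ε * η) - ε * deriv u t - η * (u t ^ 3 - lam * u t + Real.cos t)| ≤
      ((3 * B ^ 2 + |lam|) * velocityBound lam B + 1) * η ^ 2 := by
  obtain ⟨ξ, hξ, he⟩ := exists_slope_mul hu.1.hasDerivAt_deriv_real t (ε * η)
  have h2 := abs_position_sub_le hε hu hB t ((ξ - t) / ε)
  rw [mul_div_cancel₀ _ hε.ne', add_sub_cancel, abs_div, abs_of_pos hε] at h2
  have hB0 : 0 ≤ B := (abs_nonneg _).trans (hB 0)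
  have hξ' : |ξ - t| ≤ ε * |η| := by rwa [abs_mul, abs_of_pos hε] at hξ
  have h3 : |ξ - t| / ε ≤ |η| := by
    rw [div_le_iff₀ hε, mul_comm]; exact hξ'
  have h4 : |u ξ - u t| ≤ velocityBound lam B * |η| :=
    h2.trans (mul_le_mul_of_nonneg_left h3 (velocityBound_pos hB).le)
  have h5 : |Real.cos ξ - Real.cos t| ≤ |η| := by
    calc |Real.cos ξ - Real.cos t| ≤ |ξ - t| := by
          obtain ⟨z, -, hz⟩ := exists_slope_mul Real.hasDerivAt_cos t (ξ - t)
          rw [add_sub_cancel] at hz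
          rw [hz, abs_mul]
          apply mul_le_of_le_one_right (abs_nonneg _)
          rw [abs_neg]; exact Real.abs_sin_le_one z
      _ ≤ ε * |η| := hξ'
      _ ≤ |η| := mul_le_of_le_one_left (abs_nonneg _) hε1
  have h6 : |u ξ ^ 2 + u ξ * u t + u t ^ 2 - lam| ≤ 3 * B ^ 2 + |lam| := by
    have e1 := abs_le.1 (hB ξ)
    have e2 := abs_le.1 (hB t)
    have e3 := neg_abs_le lam
    have e4 := le_abs_self lam
    rw [abs_le]
    constructor
    · nlinarith [sq_nonneg (u ξ + u t)]
    · nlinarith [sq_nonneg (u ξ - u t)]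
  have h7 : ε * deriv u (t + ε * η) - ε * deriv u t =
      η * (u ξ ^ 3 - lam * u ξ + Real.cos ξ) := by
    rw [← mul_sub, he, ← hu.2]; ring
  rw [h7, ← mul_sub, abs_mul]
  have h8 : |u ξ ^ 3 - lam * u ξ + Real.cos ξ - (u t ^ 3 - lam * u t + Real.cos t)| ≤
      ((3 * B ^ 2 + |lam|) * velocityBound lam B + 1) * |η| := by
    have e : u ξ ^ 3 - lam * u ξ + Real.cos ξ - (u t ^ 3 - lam * u t + Real.cos t) =
        (u ξ ^ 2 + u ξ * u t + u t ^ 2 - lam) * (u ξ - u t) + (Real.cos ξ - Real.cos t) := by ring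
    rw [e]
    calc _ ≤ |(u ξ ^ 2 + u ξ * u t + u t ^ 2 - lam) * (u ξ - u t)| + |Real.cos ξ - Real.cos t| :=
          abs_add_le _ _
      _ ≤ (3 * B ^ 2 + |lam|) * (velocityBound lam B * |η|) + |η| := by
          rw [abs_mul]
          gcongr
      _ = _ := by ring
  calc _ ≤ |η| * (((3 * B ^ 2 + |lam|) * velocityBound lam B + 1) * |η|) := by gcongr
    _ = _ := by rw [← sq_abs η]; ring

end Estimates

/-! ### Fast-time limits along an ultrafilter. -/

section Window

variable {ι : Type*} {𝓤 : Ultrafilter ι} {lam B α : ℝ} {ε : ι → ℝ} {u : ι → ℝ → ℝ} {a : ι → ℝ}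
  {v : ℝ → ℝ}

/-- Along `𝓤`, the `u i` are solutions bounded by `B` with parameters `ε i → 0⁺`. -/
structure BoundedFamily (𝓤 : Ultrafilter ι) (lam B : ℝ) (ε : ι → ℝ) (u : ι → ℝ → ℝ) : Prop where
  pos : ∀ᶠ i in 𝓤, 0 < ε i
  lim : Tendsto ε 𝓤 (𝓝 0)
  sol : ∀ᶠ i in 𝓤, IsSolution lam (ε i) (u i)
  bound : ∀ᶠ i in 𝓤, ∀ t, |u i t| ≤ B

/-- `v` is the limit along `𝓤` of the `u i` in fast time around `a i → α`. -/
structure IsWindow (𝓤 : Ultrafilter ι) (lam : ℝ) (ε : ι → ℝ) (u : ι → ℝ → ℝ) (a : ι → ℝ)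
    (α : ℝ) (v : ℝ → ℝ) : Prop where
  sol : IsAutonomousSolution lam (Real.cos α) v
  base : Tendsto a 𝓤 (𝓝 α)
  pos : ∀ {θ : ι → ℝ} {τ : ℝ}, Tendsto θ 𝓤 (𝓝 τ) →
    Tendsto (fun i => u i (a i + ε i * θ i)) 𝓤 (𝓝 (v τ))
  vel : ∀ {θ : ι → ℝ} {τ : ℝ}, Tendsto θ 𝓤 (𝓝 τ) →
    Tendsto (fun i => ε i * deriv (u i) (a i + ε i * θ i)) 𝓤 (𝓝 (deriv v τ))

lemma tendsto_abs_sub_zero {θ : ι → ℝ} {τ : ℝ} (h : Tendsto θ 𝓤 (𝓝 τ)) :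
    Tendsto (fun i => |θ i - τ|) 𝓤 (𝓝 0) := by
  have := (h.sub_const τ).abs
  simpa using this

/-- Position and velocity converge pointwise by boundedness, and the uniform Taylor estimates pass
to the limit, where cos is frozen at α. Uniform Lipschitz bounds extend the convergence to moving
fast times θ i → τ, which encodes locally uniform convergence. -/
theorem BoundedFamily.exists_window (h : BoundedFamily 𝓤 lam B ε u) (ha : Tendsto a 𝓤 (𝓝 α)) :
    ∃ v, IsWindow 𝓤 lam ε u a α v ∧ ∀ τ, |v τ| ≤ B := by
  obtain ⟨hpos, hlim, hsol, hbound⟩ := h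
  have hε1 : ∀ᶠ i in 𝓤, ε i ≤ 1 := (hlim.eventually_lt_const one_pos).mono fun i hi => hi.le
  have hv : ∀ τ : ℝ, ∃ x ∈ Icc (-B) B, Tendsto (fun i => u i (a i + ε i * τ)) 𝓤 (𝓝 x) :=
    fun τ => exists_tendsto_of_bounded (hbound.mono fun i hi => abs_le.1 (hi _))
  have hw : ∀ τ : ℝ, ∃ x ∈ Icc (-velocityBound lam B) (velocityBound lam B),
      Tendsto (fun i => ε i * deriv (u i) (a i + ε i * τ)) 𝓤 (𝓝 x) := fun τ =>
    exists_tendsto_of_bounded (by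
      filter_upwards [hpos, hsol, hbound] with i h1 h2 h3
      exact abs_le.1 (abs_velocity_le h1 h2 h3 _))
  choose v hvB hv using hv
  choose w _ hw using hw
  have hd : ∀ τ, HasDerivAt v (w τ) τ := fun τ => by
    refine hasDerivAt_of_quadratic (C := forceBound lam B) fun η => ?_
    have hl := (((hv (τ + η)).sub (hv τ)).sub ((hw τ).const_mul η)).abs
    refine le_of_tendsto hl ?_
    filter_upwards [hpos, hsol, hbound] with i h1 h2 h3
    have := abs_position_sub_sub_le h1 h2 h3 (a i + ε i * τ) η
    rwa [add_assoc, ← mul_add] at this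
  have hdd : ∀ τ, HasDerivAt w (v τ ^ 3 - lam * v τ + Real.cos α) τ := fun τ => by
    refine hasDerivAt_of_quadratic
      (C := (3 * B ^ 2 + |lam|) * velocityBound lam B + 1) fun η => ?_
    have hb : Tendsto (fun i => a i + ε i * τ) 𝓤 (𝓝 α) := by
      simpa using ha.add (hlim.mul_const τ)
    have hc := (Real.continuous_cos.tendsto α).comp hb
    have hl := (((hw (τ + η)).sub (hw τ)).sub
      (((((hv τ).pow 3).sub ((hv τ).const_mul lam)).add hc).const_mul η)).abs
    refine le_of_tendsto hl ?_
    filter_upwards [hpos, hsol, hbound, hε1] with i h1 h2 h3 h4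
    have := abs_velocity_sub_sub_le h1 h4 h2 h3 (a i + ε i * τ) η
    rwa [add_assoc, ← mul_add] at this
  have hvc : Continuous v := continuous_iff_continuousAt.2 fun τ => (hd τ).continuousAt
  obtain ⟨h1, h2, h3⟩ := contDiff_two_of_hasDerivAt hd hdd (by fun_prop)
  refine ⟨v, ⟨⟨h1, fun τ => congrFun h3 τ⟩, ha, ?_, ?_⟩, fun τ => abs_le.2 (hvB τ)⟩
  · intro θ τ hθ
    have hz := (tendsto_abs_sub_zero hθ).const_mul (velocityBound lam B)
    rw [mul_zero] at hz
    have : Tendsto (fun i => u i (a i + ε i * θ i) - u i (a i + ε i * τ)) 𝓤 (𝓝 0) := by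
      refine squeeze_zero_norm' ?_ hz
      filter_upwards [hpos, hsol, hbound] with i h1 h2 h3
      have := abs_position_sub_le h1 h2 h3 (a i + ε i * τ) (θ i - τ)
      rwa [add_assoc, ← mul_add, add_sub_cancel] at this
    simpa using this.add (hv τ)
  · intro θ τ hθ
    have hz := (tendsto_abs_sub_zero hθ).const_mul (forceBound lam B)
    rw [mul_zero] at hz
    have : Tendsto (fun i => ε i * deriv (u i) (a i + ε i * θ i) -
        ε i * deriv (u i) (a i + ε i * τ)) 𝓤 (𝓝 0) := by
      refine squeeze_zero_norm' ?_ hz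
      filter_upwards [hpos, hsol, hbound] with i _ h2 h3
      have := abs_velocity_sub_le h2 h3 (a i + ε i * τ) (θ i - τ)
      rwa [add_assoc, ← mul_add, add_sub_cancel] at this
    rw [h2]
    simpa using this.add (hw τ)

lemma IsWindow.pos_at (h : IsWindow 𝓤 lam ε u a α v) (τ : ℝ) :
    Tendsto (fun i => u i (a i + ε i * τ)) 𝓤 (𝓝 (v τ)) := h.pos tendsto_const_nhds

lemma IsWindow.vel_at (h : IsWindow 𝓤 lam ε u a α v) (τ : ℝ) :
    Tendsto (fun i => ε i * deriv (u i) (a i + ε i * τ)) 𝓤 (𝓝 (deriv v τ)) :=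
  h.vel tendsto_const_nhds

lemma IsWindow.pos_zero (h : IsWindow 𝓤 lam ε u a α v) :
    Tendsto (fun i => u i (a i)) 𝓤 (𝓝 (v 0)) := by simpa using h.pos_at 0

lemma IsWindow.vel_zero (h : IsWindow 𝓤 lam ε u a α v) :
    Tendsto (fun i => ε i * deriv (u i) (a i)) 𝓤 (𝓝 (deriv v 0)) := by simpa using h.vel_at 0

lemma IsWindow.deriv_zero_eq (h : IsWindow 𝓤 lam ε u a α v)
    (h0 : ∀ᶠ i in 𝓤, deriv (u i) (a i) = 0) : deriv v 0 = 0 :=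
  tendsto_nhds_unique h.vel_zero
    (tendsto_const_nhds.congr' (h0.mono fun i hi => by simp [hi]))

end Window

/-! ### Bounded solutions of the autonomous equation -/

/-- The potential of the autonomous equation. -/
noncomputable def potential (lam c x : ℝ) : ℝ := x ^ 4 / 4 - lam * x ^ 2 / 2 + c * x

/-- The turning point of the orbit homoclinic to `topRoot lam c`, for `c > 0`. -/
noncomputable def turningPoint (lam c : ℝ) : ℝ := -topRoot lam c + √(2 * c / topRoot lam c)

/-- A saddle is a critical point of the potential, hence a double zero of the difference; the
remaining quadratic factor displays the turning points. -/
lemma potential_sub_top {lam c : ℝ} (h : lambda0 < lam) (hc : |c| ≤ 1) (x : ℝ) :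
    potential lam c x - potential lam c (topRoot lam c) =
      (x - topRoot lam c) ^ 2 * ((x + topRoot lam c) ^ 2 - 2 * c / topRoot lam c) / 4 := by
  obtain ⟨h1, h2⟩ := topRoot_vieta h hc
  have hA := topRoot_pos h hc
  set A := topRoot lam c
  set B := topRoot lam (-c)
  have h3 : 2 * c / A = 2 * B * (B - A) := by rw [h2]; field_simp
  unfold potential
  rw [h3, h1, h2]; ring

lemma potential_neg (lam c x : ℝ) : potential lam (-c) (-x) = potential lam c x := by
  unfold potential; ring

lemma potential_sub_bot {lam c : ℝ} (h : lambda0 < lam) (hc : |c| ≤ 1) (x : ℝ) :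
    potential lam c x - potential lam c (-topRoot lam (-c)) =
      (x + topRoot lam (-c)) ^ 2 * ((x - topRoot lam (-c)) ^ 2 + 2 * c / topRoot lam (-c)) / 4 := by
  have := potential_sub_top h (abs_neg_le hc) (-x)
  rw [potential_neg, ← neg_neg (topRoot lam (-c)), potential_neg, neg_neg] at this
  rw [this]; ring

section Autonomous

variable {lam c e : ℝ} {v : ℝ → ℝ}

namespace IsAutonomousSolution

lemma hasDerivAt_energy (hv : IsAutonomousSolution lam c v) (τ : ℝ) :
    HasDerivAt (fun τ => deriv v τ ^ 2 / 2 - potential lam c (v τ)) 0 τ := by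
  have h1 := hv.1.hasDerivAt_real τ
  have h2 := hv.1.hasDerivAt_deriv_real τ
  have h3 := ((h2.pow 2).div_const 2).sub
    (((((h1.pow 4).div_const 4).sub (((h1.pow 2).const_mul lam).div_const 2))).add
      (h1.const_mul c))
  refine h3.congr_deriv ?_
  rw [hv.2]; push_cast; ring

lemma energy_eq (hv : IsAutonomousSolution lam c v) (τ σ : ℝ) :
    deriv v τ ^ 2 / 2 - potential lam c (v τ) = deriv v σ ^ 2 / 2 - potential lam c (v σ) :=
  is_const_of_deriv_eq_zero (fun x => (hv.hasDerivAt_energy x).differentiableAt)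
    (fun x => (hv.hasDerivAt_energy x).deriv) τ σ

lemma continuous_potential (lam c : ℝ) : Continuous (potential lam c) := by
  unfold potential; fun_prop

/-- Energy is constant, and along a sequence of times with velocity tending to 0 it tends to minus
the potential at the limit point. -/
lemma energy_of_tendsto (hv : IsAutonomousSolution lam c v) (he : Tendsto v atTop (𝓝 e)) (τ : ℝ) :
    deriv v τ ^ 2 / 2 = potential lam c (v τ) - potential lam c e := by
  obtain ⟨ξ, h1, h2⟩ := exists_tendsto_deriv_zero hv.1.hasDerivAt_real he
  have h3 : Tendsto (fun t => deriv v (ξ t) ^ 2 / 2 - potential lam c (v (ξ t))) atTop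
      (𝓝 (0 ^ 2 / 2 - potential lam c e)) :=
    ((h2.pow 2).div_const 2).sub
      (((continuous_potential lam c).tendsto e).comp (he.comp h1))
  have h4 : (fun t => deriv v (ξ t) ^ 2 / 2 - potential lam c (v (ξ t))) =
      fun _ => deriv v τ ^ 2 / 2 - potential lam c (v τ) := funext fun t => hv.energy_eq _ _
  rw [h4] at h3
  have h5 := tendsto_nhds_unique h3 tendsto_const_nhds
  linarith

lemma deriv_tendsto_zero (hv : IsAutonomousSolution lam c v) (he : Tendsto v atTop (𝓝 e)) :
    Tendsto (deriv v) atTop (𝓝 0) := by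
  have h1 : Tendsto (fun τ => 2 * (potential lam c (v τ) - potential lam c e)) atTop (𝓝 0) := by
    have := ((((continuous_potential lam c).tendsto e).comp he).sub_const
      (potential lam c e)).const_mul 2
    simpa using this
  have h2 : (fun τ => 2 * (potential lam c (v τ) - potential lam c e)) =
      fun τ => deriv v τ ^ 2 := funext fun τ => by rw [← hv.energy_of_tendsto he]; ring
  rw [h2] at h1
  have h3 := (Real.continuous_sqrt.tendsto 0).comp h1
  rw [Real.sqrt_zero] at h3
  refine squeeze_zero_norm (fun τ => ?_) h3
  simp [Real.sqrt_sq_eq_abs]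

lemma root_of_tendsto (hv : IsAutonomousSolution lam c v) (he : Tendsto v atTop (𝓝 e)) :
    e ^ 3 - lam * e + c = 0 := by
  refine eq_zero_of_tendsto_deriv (g' := fun τ => v τ ^ 3 - lam * v τ + c) (fun τ => ?_)
    (hv.deriv_tendsto_zero he) (((he.pow 3).sub (he.const_mul lam)).add_const c)
  rw [← hv.2]; exact hv.1.hasDerivAt_deriv_real τ

lemma neg (hv : IsAutonomousSolution lam c v) : IsAutonomousSolution lam (-c) fun τ => -v τ := by
  simpa using hv.affine (σ := -1) (b := 1) (by norm_num) (by norm_num) 0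

lemma reverse (hv : IsAutonomousSolution lam c v) (a : ℝ) :
    IsAutonomousSolution lam c fun τ => v (a - τ) := by
  simpa [sub_eq_add_neg] using hv.affine (σ := 1) (b := -1) (by norm_num) (by norm_num) a

lemma deriv_neg_apply (v : ℝ → ℝ) (τ : ℝ) : deriv (fun τ => -v τ) τ = -deriv v τ := by simp

lemma deriv_reverse (v : ℝ → ℝ) (a τ : ℝ) : deriv (fun τ => v (a - τ)) τ = -deriv v (a - τ) := by
  exact deriv_comp_const_sub v a τ

lemma eq_const_of_equilibrium (hv : IsAutonomousSolution lam c v) {a : ℝ} (h1 : deriv v a = 0)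
    (h2 : v a ^ 3 - lam * v a + c = 0) (τ : ℝ) : v τ = v a := by
  have hc : IsAutonomousSolution lam c fun _ => v a := ⟨contDiff_const, fun τ => by simp [h2]⟩
  exact congrFun (hv.eq_of_initial hc (a := a) rfl (by simp [h1])) τ

lemma symm_of_critical (hv : IsAutonomousSolution lam c v) {a : ℝ} (h1 : deriv v a = 0) (τ : ℝ) :
    v (2 * a - τ) = v τ :=
  congrFun ((hv.reverse (2 * a)).eq_of_initial hv (a := a) (by ring_nf)
    (by rw [deriv_reverse, show 2 * a - a = a by ring, h1, neg_zero])) τ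

/-- By uniqueness the orbit is symmetric about each critical time, and two reflections compose to a
translation. -/
lemma periodic_of_critical (hv : IsAutonomousSolution lam c v) {a b : ℝ} (h1 : deriv v a = 0)
    (h2 : deriv v b = 0) : Function.Periodic v (2 * (b - a)) := fun τ => by
  rw [← hv.symm_of_critical h1 τ, ← hv.symm_of_critical h2]
  congr 1; ring

end IsAutonomousSolution

lemma pos_or_neg_of_ne_zero {g : ℝ → ℝ} (hg : Continuous g) {a : ℝ} (h : ∀ τ, a < τ → g τ ≠ 0) :
    (∀ τ, a < τ → 0 < g τ) ∨ ∀ τ, a < τ → g τ < 0 := by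
  by_contra! hcon
  obtain ⟨⟨x, hx, hx'⟩, y, hy, hy'⟩ := hcon
  obtain ⟨z, hz, hz'⟩ := intermediate_value_uIcc (a := x) (b := y) hg.continuousOn
    (mem_uIcc.2 (Or.inl ⟨hx', hy'⟩) : (0 : ℝ) ∈ _)
  refine h z ?_ hz'
  rcases mem_uIcc.1 hz with h1 | h1
  · exact hx.trans_le h1.1
  · exact hy.trans_le h1.1

/-! ### Asymptotics of orbits with few critical points. -/

namespace IsAutonomousSolution

lemma exists_tendsto_of_deriv_pos {a B : ℝ} (hv : IsAutonomousSolution lam c v)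
    (hB : ∀ τ, v τ ≤ B) (h : ∀ τ, a < τ → 0 < deriv v τ) : ∃ e, Tendsto v atTop (𝓝 e) := by
  have hm : MonotoneOn v (Ici a) := by
    apply monotoneOn_of_deriv_nonneg (convex_Ici a) hv.1.continuous.continuousOn
      (hv.1.differentiable (by norm_num)).differentiableOn
    intro τ hτ
    rw [interior_Ici] at hτ
    exact (h τ hτ).le
  have hm' : Monotone fun τ => v (max τ a) := fun x y hxy =>
    hm (mem_Ici.2 (le_max_right _ _)) (mem_Ici.2 (le_max_right _ _)) (max_le_max_right _ hxy)
  refine ⟨_, (tendsto_atTop_ciSup hm' ⟨B, ?_⟩).congr' ?_⟩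
  · rintro _ ⟨τ, rfl⟩; exact hB _
  · filter_upwards [eventually_ge_atTop a] with τ hτ
    rw [max_eq_left hτ]

lemma exists_tendsto_of_deriv_ne_zero {a B : ℝ} (hv : IsAutonomousSolution lam c v)
    (hB : ∀ τ, |v τ| ≤ B) (h : ∀ τ, a < τ → deriv v τ ≠ 0) : ∃ e, Tendsto v atTop (𝓝 e) := by
  rcases pos_or_neg_of_ne_zero (hv.1.contDiff_one_deriv.continuous) h with h1 | h1
  · exact hv.exists_tendsto_of_deriv_pos (fun τ => (abs_le.1 (hB τ)).2) h1
  · obtain ⟨e, he⟩ := hv.neg.exists_tendsto_of_deriv_pos (a := a) (B := B)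
      (fun τ => by linarith [(abs_le.1 (hB τ)).1])
      (fun τ hτ => by rw [deriv_neg_apply]; linarith [h1 τ hτ])
    exact ⟨-e, by simpa using he.neg⟩

lemma tendsto_ne_of_deriv_ne_zero {e' : ℝ} (hv : IsAutonomousSolution lam c v)
    (h : ∀ τ, deriv v τ ≠ 0) (h1 : Tendsto v atTop (𝓝 e)) (h2 : Tendsto v atBot (𝓝 e')) :
    e ≠ e' := by
  have hinj : Function.Injective v := by
    intro x y hxy
    by_contra hne
    rcases lt_or_gt_of_ne hne with hlt | hlt
    · obtain ⟨z, -, hz⟩ := exists_deriv_eq_zero hlt hv.1.continuous.continuousOn hxy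
      exact h z hz
    · obtain ⟨z, -, hz⟩ := exists_deriv_eq_zero hlt hv.1.continuous.continuousOn hxy.symm
      exact h z hz
  rcases hv.1.continuous.strictMono_of_inj hinj with hm | hm
  · have a1 := hm.monotone.ge_of_tendsto h1 1
    have a2 := hm.monotone.le_of_tendsto h2 0
    have a3 : v 0 < v 1 := hm one_pos
    linarith
  · have a1 := hm.antitone.le_of_tendsto h1 1
    have a2 := hm.antitone.ge_of_tendsto h2 0
    have a3 : v 1 < v 0 := hm one_pos
    linarith

/-- The critical values of an orbit homoclinic to the larger saddle. -/
lemma critical_value_of_homoclinic (h : lambda0 < lam) (hc : |c| ≤ 1) (hc0 : 0 < c)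
    (hv : IsAutonomousSolution lam c v) (h1 : Tendsto v atTop (𝓝 (topRoot lam c)))
    (hne : ¬∀ τ, v τ = v 0) {a : ℝ} (ha : deriv v a = 0) : v a = turningPoint lam c := by
  have hA := topRoot_pos h hc
  have hroot := topRoot_cubic h hc
  have hE := hv.energy_of_tendsto h1
  simp_rw [potential_sub_top h hc] at hE
  have ht : turningPoint lam c = -topRoot lam c + √(2 * c / topRoot lam c) := rfl
  set A := topRoot lam c
  have hq : 0 < 2 * c / A := by positivity
  have hs : √(2 * c / A) ^ 2 = 2 * c / A := Real.sq_sqrt hq.le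
  have hs0 : 0 < √(2 * c / A) := Real.sqrt_pos.2 hq
  set s := √(2 * c / A)
  have h2 := hE a
  rw [ha, ← hs] at h2
  have h3 : (v a - A) ^ 2 * ((v a + A - s) * (v a + A + s)) = 0 := by linear_combination -4 * h2
  rcases mul_eq_zero.1 h3 with h4 | h4
  · have h5 : v a = A := by
      have := pow_eq_zero_iff (two_ne_zero) |>.1 h4; linarith
    exact absurd (fun τ => by
      rw [hv.eq_const_of_equilibrium ha (by rw [h5]; exact hroot) τ,
        hv.eq_const_of_equilibrium ha (by rw [h5]; exact hroot) 0]) hne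
  · rcases mul_eq_zero.1 h4 with h5 | h5
    · rw [ht]; linarith
    -- The other candidate is v a = -A - s. To tend to A the orbit would have to cross -A, where the
    -- energy identity makes v'² negative.
    · exfalso
      obtain ⟨b, hb⟩ : ∃ b, -A < v b :=
        ((h1.eventually (lt_mem_nhds (by linarith : -A < A))).exists)
      obtain ⟨z, -, hz⟩ := intermediate_value_uIcc (a := a) (b := b) hv.1.continuous.continuousOn
        (mem_uIcc.2 (Or.inl ⟨by linarith, hb.le⟩) : -A ∈ _)
      have h6 := hE z
      rw [hz, ← hs] at h6
      have : (0 : ℝ) < (-A - A) ^ 2 * s ^ 2 := by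
        have : (-A - A) ≠ 0 := by linarith
        positivity
      nlinarith [sq_nonneg (deriv v z)]

end IsAutonomousSolution

/-- The properties of fast-time limits of layer solutions: they are bounded, stay away from the
center equilibrium, and are constant if their velocity vanishes twice. -/
structure IsAdmissible (lam c : ℝ) (v : ℝ → ℝ) : Prop where
  sol : IsAutonomousSolution lam c v
  bounded : ∃ B, ∀ τ, |v τ| ≤ B
  avoid : ∃ η > 0, ∀ τ, η ≤ |v τ - (topRoot lam (-c) - topRoot lam c)| + |deriv v τ|
  critical : ∀ a b, a ≠ b → deriv v a = 0 → deriv v b = 0 → ∀ τ, v τ = v 0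

namespace IsAdmissible

lemma neg (hv : IsAdmissible lam c v) : IsAdmissible lam (-c) fun τ => -v τ := by
  obtain ⟨h1, ⟨B, hB⟩, ⟨η, hη, h3⟩, h4⟩ := hv
  refine ⟨h1.neg, ⟨B, fun τ => by rw [abs_neg]; exact hB τ⟩, ⟨η, hη, fun τ => ?_⟩, ?_⟩
  · rw [IsAutonomousSolution.deriv_neg_apply, abs_neg, neg_neg, ← abs_neg (-v τ - _)]
    convert h3 τ using 3; ring
  · intro a b hab ha hb τ
    rw [IsAutonomousSolution.deriv_neg_apply, neg_eq_zero] at ha hb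
    rw [h4 a b hab ha hb τ]

lemma reverse (hv : IsAdmissible lam c v) : IsAdmissible lam c fun τ => v (-τ) := by
  obtain ⟨h1, ⟨B, hB⟩, ⟨η, hη, h3⟩, h4⟩ := hv
  have hd : ∀ τ, deriv (fun τ => v (-τ)) τ = -deriv v (-τ) := fun τ => deriv_comp_neg v τ
  refine ⟨by simpa using h1.reverse 0, ⟨B, fun τ => hB _⟩, ⟨η, hη, fun τ => ?_⟩, ?_⟩
  · rw [hd, abs_neg]; exact h3 _
  · intro a b hab ha hb τ
    rw [hd, neg_eq_zero] at ha hb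
    rw [h4 (-a) (-b) (by simpa using hab) ha hb (-τ), neg_zero]

lemma nonconst_neg (hne : ¬∀ τ, v τ = v 0) : ¬∀ τ, (fun τ => -v τ) τ = (fun τ => -v τ) 0 :=
  fun h => hne fun τ => neg_injective (h τ)

lemma nonconst_reverse (hne : ¬∀ τ, v τ = v 0) :
    ¬∀ τ, (fun τ => v (-τ)) τ = (fun τ => v (-τ)) 0 :=
  fun h => hne fun τ => by simpa using h (-τ)

/-- The limit is an equilibrium approached with velocity tending to 0; the middle one is ruled out
by the uniform distance from the centre. -/
lemma root_cases (h : lambda0 < lam) (hc : |c| ≤ 1) (hv : IsAdmissible lam c v)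
    (he : Tendsto v atTop (𝓝 e)) : e = topRoot lam c ∨ e = -topRoot lam (-c) := by
  have h1 := hv.sol.root_of_tendsto he
  rw [cubic_factor h hc, mul_eq_zero, mul_eq_zero] at h1
  rcases h1 with (h1 | h1) | h1
  · left; linarith
  · right; linarith
  · exfalso
    obtain ⟨η, hη, h3⟩ := hv.avoid
    have h4 : Tendsto (fun τ => |v τ - (topRoot lam (-c) - topRoot lam c)| + |deriv v τ|) atTop
        (𝓝 (|e - (topRoot lam (-c) - topRoot lam c)| + |0|)) :=
      (he.sub_const _).abs.add (hv.sol.deriv_tendsto_zero he).abs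
    have := ge_of_tendsto' h4 h3
    rw [h1] at this
    simp at this
    linarith

lemma const_cases (h : lambda0 < lam) (hc : |c| ≤ 1) (hv : IsAdmissible lam c v)
    (hconst : ∀ τ, v τ = v 0) : v 0 = topRoot lam c ∨ v 0 = -topRoot lam (-c) := by
  refine hv.root_cases h hc (e := v 0) ?_
  exact tendsto_const_nhds.congr fun τ => (hconst τ).symm

lemma exists_tendsto (hv : IsAdmissible lam c v) (hne : ¬∀ τ, v τ = v 0) :
    ∃ e, Tendsto v atTop (𝓝 e) := by
  obtain ⟨B, hB⟩ := hv.bounded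
  by_cases hz : ∃ a, deriv v a = 0
  · obtain ⟨a, ha⟩ := hz
    exact hv.sol.exists_tendsto_of_deriv_ne_zero hB (a := a) fun τ hτ h0 =>
      hne (hv.critical a τ hτ.ne ha h0)
  · push Not at hz
    exact hv.sol.exists_tendsto_of_deriv_ne_zero hB (a := 0) fun τ _ => hz τ

/-- For c > 0 the energy level of the lower saddle has nonzero velocity everywhere except at that
saddle. The orbit would be strictly monotone, so its other end would be the upper saddle, which lies
on a different level. -/
lemma not_tendsto_bot_of_pos (h : lambda0 < lam) (hc : |c| ≤ 1) (hc0 : 0 < c)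
    (hv : IsAdmissible lam c v) (hne : ¬∀ τ, v τ = v 0) :
    ¬Tendsto v atTop (𝓝 (-topRoot lam (-c))) := by
  intro he
  have hB := topRoot_pos h (abs_neg_le hc)
  have hA := topRoot_pos h hc
  have hE := hv.sol.energy_of_tendsto he
  have hroot := topRoot_cubic h (abs_neg_le hc)
  simp_rw [potential_sub_bot h hc] at hE
  have hq : 0 < 2 * c / topRoot lam (-c) := by positivity
  have hnz : ∀ τ, deriv v τ ≠ 0 := by
    intro τ h0
    have h1 := hE τ
    rw [h0] at h1
    have h2 : 0 < (v τ - topRoot lam (-c)) ^ 2 + 2 * c / topRoot lam (-c) := by positivity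
    have h3 : (v τ + topRoot lam (-c)) ^ 2 *
      ((v τ - topRoot lam (-c)) ^ 2 + 2 * c / topRoot lam (-c)) = 0 := by linarith
    have h4 : v τ = -topRoot lam (-c) := by
      rcases mul_eq_zero.1 h3 with h4 | h4
      · have := pow_eq_zero_iff (two_ne_zero) |>.1 h4; linarith
      · linarith
    have h5 := hv.sol.eq_const_of_equilibrium h0 (by rw [h4]; linear_combination -hroot)
    exact hne fun τ => by rw [h5 τ, h5 0]
  obtain ⟨e', he'⟩ := hv.reverse.exists_tendsto (nonconst_reverse hne)
  have hbot : Tendsto v atBot (𝓝 e') := by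
    have := he'.comp tendsto_neg_atBot_atTop
    simpa [Function.comp_def] using this
  have hne' := hv.sol.tendsto_ne_of_deriv_ne_zero hnz he hbot
  rcases hv.reverse.root_cases h hc he' with h1 | h1
  · have h2 : Tendsto (fun τ => (v τ + topRoot lam (-c)) ^ 2 *
        ((v τ - topRoot lam (-c)) ^ 2 + 2 * c / topRoot lam (-c)) / 4) atBot
        (𝓝 ((e' + topRoot lam (-c)) ^ 2 *
        ((e' - topRoot lam (-c)) ^ 2 + 2 * c / topRoot lam (-c)) / 4)) :=
      (((hbot.add_const _).pow 2).mul (((hbot.sub_const _).pow 2).add_const _)).div_const 4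
    have h3 : Tendsto (fun τ => deriv v τ ^ 2 / 2) atBot (𝓝 (0 ^ 2 / 2)) := by
      have h4 := hv.reverse.sol.deriv_tendsto_zero he'
      have hd : ∀ τ, deriv (fun τ => v (-τ)) τ = -deriv v (-τ) := fun τ => deriv_comp_neg v τ
      have h5 := (h4.comp tendsto_neg_atBot_atTop).neg
      have h6 : (fun x => -((deriv fun τ => v (-τ)) ∘ Neg.neg) x) = deriv v := by
        funext x; simp [hd]
      rw [h6, neg_zero] at h5
      exact (h5.pow 2).div_const 2
    simp_rw [hE] at h3
    have h4 := tendsto_nhds_unique h2 h3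
    rw [h1] at h4
    have : 0 < (topRoot lam c + topRoot lam (-c)) ^ 2 *
      ((topRoot lam c - topRoot lam (-c)) ^ 2 + 2 * c / topRoot lam (-c)) / 4 := by positivity
    linarith
  · exact hne' h1.symm

theorem tendsto_top_of_pos (h : lambda0 < lam) (hc : |c| ≤ 1) (hc0 : 0 < c)
    (hv : IsAdmissible lam c v) (hne : ¬∀ τ, v τ = v 0) :
    Tendsto v atTop (𝓝 (topRoot lam c)) := by
  obtain ⟨e, he⟩ := hv.exists_tendsto hne
  rcases hv.root_cases h hc he with rfl | rfl
  · exact he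
  · exact absurd he (hv.not_tendsto_bot_of_pos h hc hc0 hne)

theorem critical_value_of_pos (h : lambda0 < lam) (hc : |c| ≤ 1) (hc0 : 0 < c)
    (hv : IsAdmissible lam c v) (hne : ¬∀ τ, v τ = v 0) {a : ℝ} (ha : deriv v a = 0) :
    v a = turningPoint lam c :=
  hv.sol.critical_value_of_homoclinic h hc hc0 (hv.tendsto_top_of_pos h hc hc0 hne) hne ha

theorem tendsto_bot_of_neg (h : lambda0 < lam) (hc : |c| ≤ 1) (hc0 : c < 0)
    (hv : IsAdmissible lam c v) (hne : ¬∀ τ, v τ = v 0) :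
    Tendsto v atTop (𝓝 (-topRoot lam (-c))) := by
  have := (hv.neg.tendsto_top_of_pos h (abs_neg_le hc) (by linarith) (nonconst_neg hne)).neg
  simpa using this

theorem critical_value_of_neg (h : lambda0 < lam) (hc : |c| ≤ 1) (hc0 : c < 0)
    (hv : IsAdmissible lam c v) (hne : ¬∀ τ, v τ = v 0) {a : ℝ} (ha : deriv v a = 0) :
    v a = -turningPoint lam (-c) := by
  have := hv.neg.critical_value_of_pos h (abs_neg_le hc) (by linarith) (nonconst_neg hne) (a := a)
    (by rw [IsAutonomousSolution.deriv_neg_apply, ha, neg_zero])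
  linarith

lemma topRoot_zero (h : lambda0 < lam) : topRoot lam 0 = √lam := by
  rw [← upperRoot_pi_div_two h, upperRoot_eq h, Real.cos_pi_div_two]

lemma _root_.ForcedDuffing.potential_sub_sqrt {e : ℝ} (he : e ^ 2 = lam)
    (x : ℝ) : potential lam 0 x - potential lam 0 e = (x ^ 2 - lam) ^ 2 / 4 := by
  unfold potential
  rw [← he]; ring

/-- For c = 0 both saddles ±√λ lie on the same energy level, so it does not matter which one is the
limit. -/
theorem sq_deriv_of_zero (h : lambda0 < lam) (hv : IsAdmissible lam 0 v)
    (hne : ¬∀ τ, v τ = v 0) (τ : ℝ) : deriv v τ ^ 2 = (v τ ^ 2 - lam) ^ 2 / 2 := by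
  obtain ⟨e, he⟩ := hv.exists_tendsto hne
  have h1 : e ^ 2 = lam := by
    rcases hv.root_cases h (by norm_num) he with rfl | rfl
    · rw [topRoot_zero h, Real.sq_sqrt (lam_pos h).le]
    · rw [neg_zero, topRoot_zero h, neg_sq, Real.sq_sqrt (lam_pos h).le]
  have h2 := hv.sol.energy_of_tendsto he τ
  rw [potential_sub_sqrt h1] at h2
  linarith

theorem not_critical_of_zero (h : lambda0 < lam) (hv : IsAdmissible lam 0 v)
    (hne : ¬∀ τ, v τ = v 0) (τ : ℝ) : deriv v τ ≠ 0 := by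
  intro h0
  have h1 := hv.sq_deriv_of_zero h hne τ
  rw [h0] at h1
  have h2 : v τ ^ 2 - lam = 0 := by
    have : (v τ ^ 2 - lam) ^ 2 = 0 := by linarith
    exact pow_eq_zero_iff (two_ne_zero) |>.1 this
  have h3 := hv.sol.eq_const_of_equilibrium h0 (by linear_combination v τ * h2)
  exact hne fun σ => by rw [h3 σ, h3 0]

end IsAdmissible

end Autonomous

/-! ### A priori properties of layer solutions -/

lemma force_factor {lam : ℝ} (h : lambda0 < lam) (t x : ℝ) :
    x ^ 3 - lam * x + Real.cos t =
      (x - upperRoot lam t) * (x - lowerRoot lam t) * (x - middleRoot lam t) := by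
  rw [cubic_factor h (abs_cos_le t), upperRoot_eq h, lowerRoot_eq h, middleRoot_eq h]; ring

lemma lowerRoot_lt_middleRoot {lam : ℝ} (h : lambda0 < lam) (t : ℝ) :
    lowerRoot lam t < middleRoot lam t := by
  rw [lowerRoot_eq h, middleRoot_eq h]
  linarith [topRoot_lt_two_mul h (abs_cos_le t)]

lemma middleRoot_lt_upperRoot {lam : ℝ} (h : lambda0 < lam) (t : ℝ) :
    middleRoot lam t < upperRoot lam t := by
  rw [upperRoot_eq h, middleRoot_eq h]
  linarith [topRoot_neg_lt_two_mul h (abs_cos_le t)]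

lemma force_nonpos_iff {lam : ℝ} (h : lambda0 < lam) (t x : ℝ) :
    x ^ 3 - lam * x + Real.cos t ≤ 0 ↔
      x ≤ lowerRoot lam t ∨ (middleRoot lam t ≤ x ∧ x ≤ upperRoot lam t) := by
  rw [force_factor h]
  have h1 := lowerRoot_lt_middleRoot h t
  have h2 := middleRoot_lt_upperRoot h t
  constructor
  · intro h3
    by_contra! hcon
    obtain ⟨h4, h5⟩ := hcon
    rcases lt_or_ge x (middleRoot lam t) with h6 | h6
    · have := mul_pos_of_neg_of_neg (mul_neg_of_neg_of_pos (by linarith : x - upperRoot lam t < 0)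
        (by linarith : 0 < x - lowerRoot lam t)) (by linarith : x - middleRoot lam t < 0)
      linarith
    · have h7 := h5 h6
      have := mul_pos (mul_pos (by linarith : 0 < x - upperRoot lam t)
        (by linarith : 0 < x - lowerRoot lam t)) (by linarith : 0 < x - middleRoot lam t)
      linarith
  · rintro (h3 | ⟨h3, h4⟩)
    · exact mul_nonpos_of_nonneg_of_nonpos (mul_nonneg_of_nonpos_of_nonpos (by linarith)
        (by linarith)) (by linarith)
    · exact mul_nonpos_of_nonpos_of_nonneg (mul_nonpos_of_nonpos_of_nonneg (by linarith)
        (by linarith)) (by linarith)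

lemma force_nonneg_iff {lam : ℝ} (h : lambda0 < lam) (t x : ℝ) :
    0 ≤ x ^ 3 - lam * x + Real.cos t ↔
      (lowerRoot lam t ≤ x ∧ x ≤ middleRoot lam t) ∨ upperRoot lam t ≤ x := by
  have := force_nonpos_iff h (Real.pi - t) (-x)
  rw [lowerRoot_pi_sub h, upperRoot_pi_sub h, middleRoot_pi_sub h, Real.cos_pi_sub] at this
  rw [show (-x) ^ 3 - lam * -x + -Real.cos t = -(x ^ 3 - lam * x + Real.cos t) by ring,
    Left.neg_nonpos_iff] at this
  rw [this]
  constructor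
  · rintro (h1 | ⟨h1, h2⟩)
    · right; linarith
    · left; constructor <;> linarith
  · rintro (⟨h1, h2⟩ | h1)
    · right; constructor <;> linarith
    · left; linarith

lemma exists_global_max {f : ℝ → ℝ} {T : ℝ} (hT : 0 < T) (hf : Function.Periodic f T)
    (hc : Continuous f) : ∃ x, ∀ y, f y ≤ f x := by
  obtain ⟨x, -, hx⟩ := (isCompact_Icc (a := (0 : ℝ)) (b := T)).exists_isMaxOn
    ⟨0, left_mem_Icc.2 hT.le⟩ hc.continuousOn
  refine ⟨x, fun y => ?_⟩
  obtain ⟨z, hz, hyz⟩ := hf.exists_mem_Ico₀ hT y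
  rw [hyz]
  exact hx (Ico_subset_Icc_self hz)

section Solution

variable {lam ε : ℝ} {u : ℝ → ℝ}

lemma IsSolution.force_nonpos (hε : 0 < ε) (hu : IsSolution lam ε u) {x : ℝ}
    (hx : IsLocalMax u x) : u x ^ 3 - lam * u x + Real.cos x ≤ 0 := by
  rw [← hu.2]
  exact mul_nonpos_of_nonneg_of_nonpos (by positivity)
    (hx.deriv_deriv_nonpos hu.1.continuous.continuousAt)

lemma IsSolution.force_nonneg (hε : 0 < ε) (hu : IsSolution lam ε u) {x : ℝ}
    (hx : IsLocalMin u x) : 0 ≤ u x ^ 3 - lam * u x + Real.cos x := by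
  rw [← hu.2]
  exact mul_nonneg (by positivity) (hx.deriv_deriv_nonneg hu.1.continuous.continuousAt)

/-- The symmetry `u ↦ -u(π - ·)` of the equation. -/
noncomputable def reflect (u : ℝ → ℝ) : ℝ → ℝ := fun x => -u (Real.pi - x)

lemma reflect_eq (u : ℝ → ℝ) : reflect u = fun x => -1 * u (Real.pi + -1 * x) := by
  funext x; unfold reflect; ring_nf

lemma deriv_reflect (u : ℝ → ℝ) (x : ℝ) : deriv (reflect u) x = deriv u (Real.pi - x) := by
  unfold reflect
  rw [deriv.fun_neg, deriv_comp_const_sub, neg_neg]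

lemma IsSolution.reflect (hu : IsSolution lam ε u) : IsSolution lam ε (reflect u) := by
  obtain ⟨h1, -, h3⟩ := deriv_affine hu.1 (-1) Real.pi (-1)
  rw [reflect_eq]
  refine ⟨h1, fun x => ?_⟩
  rw [h3]
  have := hu.2 (Real.pi + -1 * x)
  have hcos : Real.cos (Real.pi + -1 * x) = -Real.cos x := by
    rw [← Real.cos_pi_sub]; congr 1; ring
  rw [hcos] at this
  linear_combination -this

lemma reflect_periodic (hp : Function.Periodic u (2 * Real.pi)) :
    Function.Periodic (reflect u) (2 * Real.pi) := fun x => by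
  unfold reflect
  rw [← hp (Real.pi - (x + 2 * Real.pi))]
  congr 2; ring

/-- Maximum principle: at a global maximum x the force is nonpositive, so u x ≤ Ū(x) ≤ Ū(π). -/
lemma IsSolution.le_upperRoot_pi (h : lambda0 < lam) (hε : 0 < ε) (hu : IsSolution lam ε u)
    (hp : Function.Periodic u (2 * Real.pi)) (t : ℝ) : u t ≤ upperRoot lam Real.pi := by
  obtain ⟨x, hx⟩ := exists_global_max Real.two_pi_pos hp hu.1.continuous
  have h1 := (force_nonpos_iff h x (u x)).1
    (hu.force_nonpos hε (Eventually.of_forall hx : IsLocalMax u x))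
  have h2 : u x ≤ upperRoot lam x := by
    rcases h1 with h1 | h1
    · linarith [lowerRoot_lt_middleRoot h x, middleRoot_lt_upperRoot h x]
    · exact h1.2
  exact (hx t).trans (h2.trans (upperRoot_le_pi h x))

lemma IsSolution.abs_le_upperRoot_pi (h : lambda0 < lam) (hε : 0 < ε) (hu : IsSolution lam ε u)
    (hp : Function.Periodic u (2 * Real.pi)) (t : ℝ) : |u t| ≤ upperRoot lam Real.pi := by
  rw [abs_le]
  refine ⟨?_, hu.le_upperRoot_pi h hε hp t⟩
  have := hu.reflect.le_upperRoot_pi h hε (reflect_periodic hp) (Real.pi - t)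
  unfold ForcedDuffing.reflect at this
  rw [sub_sub_cancel] at this
  linarith

/-- The convexity rate above the inflection point. -/
lemma rate_pos (h : lambda0 < lam) : 0 < 3 * upperRoot lam 0 ^ 2 - lam := by
  have h1 := inflection_lt_upperRoot h 0
  have h2 := inflection_pos h
  have h3 := inflection_sq h
  nlinarith

lemma hasDerivAt_sub_root {g : ℝ → ℝ} (hu : ContDiff ℝ 2 u) (hg : ContDiff ℝ 2 g) :
    ContDiff ℝ 2 (fun t => u t - g t) ∧
    (∀ t, deriv (fun t => u t - g t) t = deriv u t - deriv g t) ∧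
    ∀ t, deriv (deriv fun t => u t - g t) t = deriv (deriv u) t - deriv (deriv g) t := by
  obtain ⟨h1, h2, h3⟩ := contDiff_two_of_hasDerivAt
    (fun t => (hu.hasDerivAt_real t).sub (hg.hasDerivAt_real t))
    (fun t => (hu.hasDerivAt_deriv_real t).sub (hg.hasDerivAt_deriv_real t))
    ((hu.contDiff_one_deriv.continuous_deriv le_rfl).sub
      (hg.contDiff_one_deriv.continuous_deriv le_rfl))
  exact ⟨h1, fun t => congrFun h2 t, fun t => congrFun h3 t⟩

lemma IsSolution.sub_upperRoot (h : lambda0 < lam) (hu : IsSolution lam ε u) (t : ℝ) :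
    ε ^ 2 * deriv (deriv fun t => u t - upperRoot lam t) t =
      (u t ^ 2 + u t * upperRoot lam t + upperRoot lam t ^ 2 - lam) * (u t - upperRoot lam t) -
        ε ^ 2 * deriv (deriv (upperRoot lam)) t := by
  rw [(hasDerivAt_sub_root hu.1 (contDiff_upperRoot h)).2.2, mul_sub, hu.2]
  linear_combination upperRoot_cubic h t

/-- At a maximum of u - Ū the difference quotient of the force is at least 3Ū(0)² - λ when u > Ū,
and it has to be balanced by ε²Ū''. -/
lemma IsSolution.le_upperRoot_add (h : lambda0 < lam) (hε : 0 < ε) (hu : IsSolution lam ε u)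
    (hp : Function.Periodic u (2 * Real.pi)) {D : ℝ}
    (hD : ∀ t, |deriv (deriv (upperRoot lam)) t| ≤ D) (t : ℝ) :
    u t ≤ upperRoot lam t + D / (3 * upperRoot lam 0 ^ 2 - lam) * ε ^ 2 := by
  have hk := rate_pos h
  set k := 3 * upperRoot lam 0 ^ 2 - lam with hk'
  obtain ⟨hw, -, -⟩ := hasDerivAt_sub_root hu.1 (contDiff_upperRoot h)
  obtain ⟨x, hx⟩ := exists_global_max (f := fun t => u t - upperRoot lam t) Real.two_pi_pos
    (hp.sub (periodic_upperRoot h)) hw.continuous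
  have hloc : IsLocalMax (fun t => u t - upperRoot lam t) x := Eventually.of_forall hx
  have h1 := hloc.deriv_deriv_nonpos hw.continuous.continuousAt
  have h2 := hu.sub_upperRoot h x
  have h3 : ε ^ 2 * deriv (deriv fun t => u t - upperRoot lam t) x ≤ 0 :=
    mul_nonpos_of_nonneg_of_nonpos (by positivity) h1
  have hD0 : 0 ≤ D := (abs_nonneg _).trans (hD 0)
  have h4 : u x - upperRoot lam x ≤ D / k * ε ^ 2 := by
    rw [div_mul_eq_mul_div, le_div_iff₀ hk]
    rcases le_or_gt (u x) (upperRoot lam x) with h5 | h5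
    · have : (u x - upperRoot lam x) * k ≤ 0 :=
        mul_nonpos_of_nonpos_of_nonneg (by linarith) hk.le
      have : 0 ≤ D * ε ^ 2 := by positivity
      linarith
    · have h6 := upperRoot_zero_le h x
      have h7 := (inflection_pos h).trans (inflection_lt_upperRoot h 0)
      have h8 : k ≤ u x ^ 2 + u x * upperRoot lam x + upperRoot lam x ^ 2 - lam := by
        rw [hk']; nlinarith
      have h9 : ε ^ 2 * deriv (deriv (upperRoot lam)) x ≤ ε ^ 2 * D :=
        mul_le_mul_of_nonneg_left (abs_le.1 (hD x)).2 (by positivity)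
      have h10 := mul_le_mul_of_nonneg_right h8 (by linarith : 0 ≤ u x - upperRoot lam x)
      linarith
  linarith [hx t]

end Solution

/-! ### Layer solutions avoid the middle root -/

lemma middleRoot_zero_pos {lam : ℝ} (h : lambda0 < lam) : 0 < middleRoot lam 0 := by
  rw [middleRoot_eq h, Real.cos_zero, sub_pos]
  exact topRoot_strictAnti h (by norm_num) (by norm_num) (by norm_num)

lemma abs_middleRoot_le {lam : ℝ} (h : lambda0 < lam) (t : ℝ) :
    |middleRoot lam t| ≤ middleRoot lam 0 := by
  rw [middleRoot_eq h, middleRoot_eq h, Real.cos_zero]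
  have h1 := topRoot_anti h (abs_cos_le t) (by norm_num) (Real.cos_le_one t)
  have h2 := topRoot_anti h (by norm_num) (abs_cos_le t) (Real.neg_one_le_cos t)
  have h3 := topRoot_anti h (abs_neg_le (abs_cos_le t)) (by norm_num)
    (by linarith [Real.neg_one_le_cos t] : -Real.cos t ≤ 1)
  have h4 := topRoot_anti h (by norm_num) (abs_neg_le (abs_cos_le t))
    (by linarith [Real.cos_le_one t] : -1 ≤ -Real.cos t)
  rw [abs_le]
  constructor <;> linarith

lemma middleRoot_cubic {lam : ℝ} (h : lambda0 < lam) (t : ℝ) :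
    middleRoot lam t ^ 3 - lam * middleRoot lam t + Real.cos t = 0 := by
  rw [force_factor h]; ring

section Avoid

variable {lam ε : ℝ} {u : ℝ → ℝ}

/-- The energy of the deviation from the middle root. -/
noncomputable def middleEnergy (lam ε : ℝ) (u : ℝ → ℝ) (t : ℝ) : ℝ :=
  (ε * (deriv u t - deriv (middleRoot lam) t)) ^ 2 / 2 -
    ((3 * middleRoot lam t ^ 2 - lam) * (u t - middleRoot lam t) ^ 2 / 2 +
      middleRoot lam t * (u t - middleRoot lam t) ^ 3 + (u t - middleRoot lam t) ^ 4 / 4)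

/-- The leading terms cancel through the equations for u and for U₀. What remains contains only slow
derivatives of U₀ and no factor 1/ε, so the energy changes slowly. -/
lemma hasDerivAt_middleEnergy (h : lambda0 < lam) (hu : IsSolution lam ε u) (t : ℝ) :
    HasDerivAt (middleEnergy lam ε u)
      (-(ε * (ε * (deriv u t - deriv (middleRoot lam) t)) * deriv (deriv (middleRoot lam)) t) -
        3 * middleRoot lam t * deriv (middleRoot lam) t * (u t - middleRoot lam t) ^ 2 -
        deriv (middleRoot lam) t * (u t - middleRoot lam t) ^ 3) t := by
  have hM := contDiff_middleRoot h
  have hm := hM.hasDerivAt_real t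
  have hw := (hu.1.hasDerivAt_real t).sub hm
  have hq := ((hu.1.hasDerivAt_deriv_real t).sub (hM.hasDerivAt_deriv_real t)).const_mul ε
  have h1 := ((hq.pow 2).div_const 2).sub
    ((((((((hm.pow 2).const_mul 3).sub_const lam).mul (hw.pow 2)).div_const 2)).add
      (hm.mul (hw.pow 3))).add ((hw.pow 4).div_const 4))
  refine h1.congr_deriv ?_
  have h2 := hu.2 t
  have h3 := middleRoot_cubic h t
  simp only [Pi.sub_apply, Pi.pow_apply]
  push_cast
  linear_combination (deriv u t - deriv (middleRoot lam) t) * (h2 + h3)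

/-- At the centre 3M² - λ ≤ -κ, so the quadratic term contributes κw²/2; for |w| ≤ w0 the cubic and
quartic terms cost at most half of it. -/
lemma quartic_lower {lam M w q κ D w0 : ℝ} (hκ : κ ≤ lam - 3 * M ^ 2) (hM : |M| ≤ D)
    (hw : |w| ≤ w0) (hw1 : w0 ≤ 1) (hwκ : (D + 1) * w0 ≤ κ / 4) (hD : 0 ≤ D) :
    q ^ 2 / 2 + κ * w ^ 2 / 4 ≤
      q ^ 2 / 2 - ((3 * M ^ 2 - lam) * w ^ 2 / 2 + M * w ^ 3 + w ^ 4 / 4) := by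
  have hw0 : 0 ≤ w0 := (abs_nonneg _).trans hw
  have e1 : M * w ≤ D * w0 := by
    calc _ ≤ |M * w| := le_abs_self _
      _ = |M| * |w| := abs_mul _ _
      _ ≤ _ := mul_le_mul hM hw (abs_nonneg _) hD
  have e2 : w ^ 2 ≤ w0 ^ 2 := sq_le_sq' (abs_le.1 hw).1 (abs_le.1 hw).2
  have e3 : w0 ^ 2 ≤ w0 := by nlinarith
  have h1 : M * w + w ^ 2 / 4 ≤ κ / 4 := by linarith
  have h2 : 0 ≤ w ^ 2 * ((lam - 3 * M ^ 2) / 2 - κ / 4 - (M * w + w ^ 2 / 4)) := by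
    apply mul_nonneg (sq_nonneg _)
    linarith
  linarith

lemma energy_rate_le {ε M M' M'' w q κ D E : ℝ} (hκ : 0 < κ) (hD : 0 < D) (b0 : |M| ≤ D)
    (b1 : |M'| ≤ D) (b2 : |M''| ≤ D) (hw : |w| ≤ 1) (hE : q ^ 2 / 2 + κ * w ^ 2 / 4 ≤ E) :
    -(ε * q * M'') - 3 * M * M' * w ^ 2 - M' * w ^ 3 ≤
      (D + 4 * (3 * D ^ 2 + D) / κ) * (E + ε ^ 2) := by
  have e1 : -(ε * q * M'') ≤ D * (q ^ 2 / 2 + ε ^ 2) := by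
    calc _ ≤ |ε * q * M''| := neg_le_abs _
      _ = |ε * q| * |M''| := abs_mul _ _
      _ ≤ |ε * q| * D := mul_le_mul_of_nonneg_left b2 (abs_nonneg _)
      _ ≤ (q ^ 2 / 2 + ε ^ 2) * D := by
        apply mul_le_mul_of_nonneg_right _ hD.le
        rw [abs_le]
        constructor <;> nlinarith only [sq_nonneg (q + ε), sq_nonneg (q - ε), sq_nonneg ε]
      _ = _ := mul_comm _ _
  have e2 : -(3 * M * M' * w ^ 2) ≤ 3 * D ^ 2 * w ^ 2 := by
    rw [← neg_mul]
    apply mul_le_mul_of_nonneg_right _ (sq_nonneg _)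
    calc _ ≤ |3 * M * M'| := neg_le_abs _
      _ = 3 * (|M| * |M'|) := by
        rw [abs_mul, abs_mul, abs_of_pos (by norm_num : (0 : ℝ) < 3), mul_assoc]
      _ ≤ 3 * (D * D) := by gcongr
      _ = _ := by ring
  have e3 : -(M' * w ^ 3) ≤ D * w ^ 2 := by
    rw [show -(M' * w ^ 3) = -(M' * w) * w ^ 2 by ring]
    apply mul_le_mul_of_nonneg_right _ (sq_nonneg _)
    calc _ ≤ |M' * w| := neg_le_abs _
      _ = |M'| * |w| := abs_mul _ _
      _ ≤ D * 1 := mul_le_mul b1 hw (abs_nonneg _) hD.le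
      _ = D := mul_one D
  have hw2 : 0 ≤ κ * w ^ 2 / 4 := by positivity
  have e5 : (3 * D ^ 2 + D) * w ^ 2 = 4 * (3 * D ^ 2 + D) / κ * (κ * w ^ 2 / 4) := by
    field_simp
  have e6 : 4 * (3 * D ^ 2 + D) / κ * (κ * w ^ 2 / 4) ≤
      4 * (3 * D ^ 2 + D) / κ * (E + ε ^ 2) := by
    apply mul_le_mul_of_nonneg_left _ (by positivity)
    linarith [sq_nonneg q, sq_nonneg ε]
  have e7 : D * (q ^ 2 / 2 + ε ^ 2) ≤ D * (E + ε ^ 2) := by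
    apply mul_le_mul_of_nonneg_left _ hD.le
    linarith
  rw [add_mul]
  linarith

lemma quartic_upper {lam ε M M' w u' D : ℝ} (hlam : 0 < lam) (hD : 0 < D) (b0 : |M| ≤ D)
    (b1 : |M'| ≤ D) (hw : |w| ≤ 1) (hp : |ε * u'| ≤ 1) :
    (ε * (u' - M')) ^ 2 / 2 - ((3 * M ^ 2 - lam) * w ^ 2 / 2 + M * w ^ 3 + w ^ 4 / 4) ≤
      (lam / 2 + D + 2) * (|w| + |ε * u'|) + ε ^ 2 * D ^ 2 := by
  have e1 : (ε * (u' - M')) ^ 2 / 2 ≤ |ε * u'| ^ 2 + ε ^ 2 * D ^ 2 := by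
    rw [sq_abs]
    have e2 : (ε * M') ^ 2 ≤ ε ^ 2 * D ^ 2 := by
      rw [mul_pow]
      apply mul_le_mul_of_nonneg_left _ (sq_nonneg _)
      exact sq_le_sq' (abs_le.1 b1).1 (abs_le.1 b1).2
    linarith [sq_nonneg (ε * u' + ε * M'),
      show (ε * (u' - M')) ^ 2 / 2 + (ε * u' + ε * M') ^ 2 / 2 = (ε * u') ^ 2 + (ε * M') ^ 2 by
        ring]
  have e2 : -(M * w ^ 3) ≤ D * |w| ^ 3 := by
    calc _ ≤ |M * w ^ 3| := neg_le_abs _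
      _ = |M| * |w| ^ 3 := by rw [abs_mul, abs_pow]
      _ ≤ _ := mul_le_mul_of_nonneg_right b0 (by positivity)
  have e3 : -((3 * M ^ 2 - lam) * w ^ 2 / 2) ≤ lam * |w| ^ 2 / 2 := by
    rw [sq_abs]
    linarith [mul_nonneg (sq_nonneg M) (sq_nonneg w)]
  have e8 : 0 ≤ w ^ 4 := by positivity
  have hW0 := abs_nonneg w
  have hp0 := abs_nonneg (ε * u')
  set W := |w|
  set p := |ε * u'|
  have e4 : W ^ 2 ≤ W := by nlinarith only [hW0, hw]
  have e5 : W ^ 3 ≤ W := by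
    calc W ^ 3 = W ^ 2 * W := by ring
      _ ≤ 1 * W := mul_le_mul_of_nonneg_right (by linarith) hW0
      _ = W := one_mul W
  have e6 : p ^ 2 ≤ p := by nlinarith only [hp0, hp]
  have e9 : D * W ^ 3 ≤ D * W := mul_le_mul_of_nonneg_left e5 hD.le
  have e10 : lam * W ^ 2 / 2 ≤ lam * W / 2 := by
    have := mul_le_mul_of_nonneg_left e4 hlam.le
    linarith
  have e12 : 0 ≤ (lam / 2 + D) * p := by positivity
  linarith

/-- The energy E about U₀ is positive definite near U₀ and E' ≤ C(E + ε²) there. Over one period it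
grows at most by exp(2πC), so if it starts too small the solution stays near U₀, contradicting u(π)
> 0 > U₀(π). -/
theorem exists_avoid (h : lambda0 < lam) : ∃ η > 0, ∃ e0 > 0, ∀ (ε : ℝ) (u : ℝ → ℝ), 0 < ε →
    ε ^ 2 ≤ e0 → IsSolution lam ε u → Function.Periodic u (2 * Real.pi) → 0 < u Real.pi →
    ∀ t, η ≤ |u t - middleRoot lam t| + |ε * deriv u t| := by
  obtain ⟨D, hD, hbd⟩ := exists_bound_derivs (contDiff_middleRoot h) (periodic_middleRoot h)
  have hM0 := middleRoot_zero_pos h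
  have hlam := lam_pos h
  have hκ : 0 < lam - 3 * middleRoot lam 0 ^ 2 := by
    have h1 := abs_lt.1 (abs_middleRoot_lt h 0)
    have h2 := inflection_sq h
    nlinarith
  set κ := lam - 3 * middleRoot lam 0 ^ 2 with hκ'
  have hκt : ∀ t, κ ≤ lam - 3 * middleRoot lam t ^ 2 := fun t => by
    have := abs_middleRoot_le h t
    have := sq_le_sq' (abs_le.1 this).1 (abs_le.1 this).2
    linarith
  -- The radius must keep the energy definite and also be smaller than U₀(0) = -U₀(π), so that u is
  -- outside the neighbourhood at π.
  obtain ⟨w0, hw0, hw1, hwκ, hwM⟩ : ∃ w0 : ℝ, 0 < w0 ∧ w0 ≤ 1 ∧ (D + 1) * w0 ≤ κ / 4 ∧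
      w0 < middleRoot lam 0 := by
    refine ⟨min (min 1 (κ / (4 * (D + 1)))) (middleRoot lam 0 / 2), by positivity, ?_, ?_, ?_⟩
    · exact (min_le_left _ _).trans (min_le_left _ _)
    · calc _ ≤ (D + 1) * (κ / (4 * (D + 1))) := by
            apply mul_le_mul_of_nonneg_left _ (by positivity)
            exact (min_le_left _ _).trans (min_le_right _ _)
        _ = κ / 4 := by field_simp
    · exact (min_le_right _ _).trans_lt (by linarith)
  set C := D + 4 * (3 * D ^ 2 + D) / κ with hC
  have hC0 : 0 < C := by positivity
  -- The energy at the boundary |w| = w0, divided by the largest Gronwall factor over one period.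
  set η' := Real.exp (-C * (2 * Real.pi)) * (κ * w0 ^ 2 / 4) with hη'
  have hη0 : 0 < η' := by positivity
  set C' := lam / 2 + D + 2
  have hC'0 : 0 < C' := by positivity
  refine ⟨min w0 (η' / (4 * C')), by positivity, η' / (4 * (1 + D ^ 2)), by positivity, ?_⟩
  intro ε u hε hεe hu hp hpi t0
  by_contra! hcon
  obtain ⟨hc1, hc2⟩ := lt_min_iff.1 hcon
  set w : ℝ → ℝ := fun t => u t - middleRoot lam t with hw
  set q : ℝ → ℝ := fun t => ε * (deriv u t - deriv (middleRoot lam) t) with hq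
  have hwc : Continuous w := hu.1.continuous.sub (contDiff_middleRoot h).continuous
  have hwt0 : |w t0| < w0 := by
    have : |w t0| = |u t0 - middleRoot lam t0| := rfl
    linarith [abs_nonneg (ε * deriv u t0)]
  -- the energy is positive definite near the middle root
  have hlow : ∀ t, |w t| ≤ w0 → q t ^ 2 / 2 + κ * w t ^ 2 / 4 ≤ middleEnergy lam ε u t := by
    intro t ht
    exact quartic_lower (hκt t) (hbd t).1 ht hw1 hwκ hD.le
  have hder : ∀ t, |w t| ≤ w0 → deriv (middleEnergy lam ε u) t ≤
      C * (middleEnergy lam ε u t + ε ^ 2) := by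
    intro t ht
    rw [(hasDerivAt_middleEnergy h hu t).deriv]
    obtain ⟨b0, b1, b2⟩ := hbd t
    exact energy_rate_le hκ hD b0 b1 b2 (ht.trans hw1) (hlow t ht)
  -- the solution leaves the neighborhood before the next odd multiple of `π`
  obtain ⟨t1, ht1, hwt1⟩ : ∃ t1 ∈ Icc t0 (t0 + 2 * Real.pi), w0 ≤ |w t1| := by
    obtain ⟨n, hn⟩ := (show ∃ n : ℤ, Real.pi + n • (2 * Real.pi) ∈ Ico t0 (t0 + 2 * Real.pi) from
      (existsUnique_add_zsmul_mem_Ico Real.two_pi_pos Real.pi t0).exists)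
    refine ⟨_, Ico_subset_Icc_self hn, ?_⟩
    have hwp : Function.Periodic w (2 * Real.pi) := hp.sub (periodic_middleRoot h)
    rw [hwp.zsmul n Real.pi]
    have h1 : middleRoot lam Real.pi = -middleRoot lam 0 := by
      rw [← middleRoot_pi_sub h, sub_zero]
    have h2 : w Real.pi = u Real.pi + middleRoot lam 0 := by simp only [hw, h1]; ring
    rw [h2, abs_of_pos (by linarith)]
    linarith
  have hcpt : IsCompact {t | t ∈ Icc t0 t1 ∧ w0 ≤ |w t|} :=
    (isCompact_Icc (a := t0) (b := t1)).inter_right (isClosed_le continuous_const hwc.abs)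
  obtain ⟨x, ⟨hx, hwx⟩, hleast⟩ := hcpt.exists_isLeast ⟨t1, ⟨ht1.1, le_rfl⟩, hwt1⟩
  have hlt : ∀ t ∈ Ico t0 x, |w t| < w0 := fun t ht => by
    by_contra! hge
    have := hleast ⟨⟨ht.1, ht.2.le.trans hx.2⟩, hge⟩
    linarith [ht.2]
  have ht0x : t0 < x := lt_of_le_of_ne hx.1 (by rintro rfl; linarith)
  have hwx' : |w x| ≤ w0 := by
    refine le_of_tendsto (f := fun t => |w t|) (x := 𝓝[<] x)
      ((hwc.abs.tendsto x).mono_left nhdsWithin_le_nhds) ?_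
    filter_upwards [Ico_mem_nhdsLT ht0x] with t ht using (hlt t ht).le
  have hE : ∀ t, HasDerivAt (fun t => (middleEnergy lam ε u t + ε ^ 2) * Real.exp (-C * (t - t0)))
      ((deriv (middleEnergy lam ε u) t - C * (middleEnergy lam ε u t + ε ^ 2)) *
        Real.exp (-C * (t - t0))) t := fun t => by
    have h1 : HasDerivAt (fun t => Real.exp (-C * (t - t0)))
        (-C * Real.exp (-C * (t - t0))) t :=
      ((((hasDerivAt_id t).sub_const t0).const_mul (-C)).exp).congr_deriv (by simp; ring)
    have h2 := (hasDerivAt_middleEnergy h hu t)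
    rw [h2.deriv]
    exact ((h2.add_const (ε ^ 2)).mul h1).congr_deriv (by ring)
  -- Gronwall up to x, the first time at which |w| reaches w0.
  have hanti : AntitoneOn
      (fun t => (middleEnergy lam ε u t + ε ^ 2) * Real.exp (-C * (t - t0))) (Icc t0 x) := by
    apply antitoneOn_of_deriv_nonpos (convex_Icc t0 x)
    · exact fun t _ => (hE t).continuousAt.continuousWithinAt
    · exact fun t _ => (hE t).differentiableAt.differentiableWithinAt
    · intro t ht
      rw [interior_Icc] at ht
      rw [(hE t).deriv]
      refine mul_nonpos_of_nonpos_of_nonneg ?_ (Real.exp_pos _).le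
      linarith [hder t (hlt t ⟨ht.1.le, ht.2⟩).le]
  have h1 := hanti (left_mem_Icc.2 hx.1) (right_mem_Icc.2 hx.1) hx.1
  simp only [sub_self, mul_zero, Real.exp_zero, mul_one] at h1
  have h2 : η' ≤ middleEnergy lam ε u t0 + ε ^ 2 := by
    refine le_trans ?_ h1
    have e1 := hlow x hwx'
    have e2 : w0 ^ 2 ≤ w x ^ 2 := by
      rw [← sq_abs (w x)]; exact pow_le_pow_left₀ hw0.le hwx 2
    have e3 : κ * w0 ^ 2 / 4 ≤ middleEnergy lam ε u x + ε ^ 2 := by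
      nlinarith [sq_nonneg (q x), sq_nonneg ε, mul_le_mul_of_nonneg_left e2 hκ.le]
    rw [hη', mul_comm]
    refine mul_le_mul e3 (Real.exp_le_exp.2 ?_) (Real.exp_pos _).le
      ((by positivity : 0 ≤ κ * w0 ^ 2 / 4).trans e3)
    have : x - t0 ≤ 2 * Real.pi := by linarith [hx.2, ht1.2]
    nlinarith
  have h3 : middleEnergy lam ε u t0 ≤ C' * (|w t0| + |ε * deriv u t0|) + ε ^ 2 * D ^ 2 := by
    obtain ⟨b0, b1, -⟩ := hbd t0
    have hp1 : |ε * deriv u t0| ≤ 1 := by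
      have : |w t0| = |u t0 - middleRoot lam t0| := rfl
      linarith [abs_nonneg (w t0)]
    exact quartic_upper hlam hD b0 b1 (hwt0.le.trans hw1) hp1
  have h4 : C' * (|w t0| + |ε * deriv u t0|) < η' / 4 := by
    have := mul_lt_mul_of_pos_left hc2 hC'0
    calc _ < C' * (η' / (4 * C')) := this
      _ = η' / 4 := by field_simp
  have h5 : ε ^ 2 * (1 + D ^ 2) ≤ η' / 4 := by
    rw [le_div_iff₀ (by positivity)] at hεe
    linarith
  linarith

end Avoid

/-! ### Extrema of layer solutions -/

section MonotoneExtr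

variable {f : ℝ → ℝ} {a b : ℝ}

lemma not_isLocalMax_left (hab : a < b) (hf : StrictMonoOn f (Icc a b)) : ¬IsLocalMax f a := by
  intro h
  have h1 : ∀ᶠ y in 𝓝[>] a, f y ≤ f a := h.filter_mono nhdsWithin_le_nhds
  obtain ⟨y, hy1, hy2⟩ := (h1.and (Ioo_mem_nhdsGT hab)).exists
  have := hf (left_mem_Icc.2 hab.le) (Ioo_subset_Icc_self hy2) hy2.1
  linarith

lemma not_isLocalMax_right (hab : a < b) (hf : StrictAntiOn f (Icc a b)) : ¬IsLocalMax f b := by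
  intro h
  have h1 : ∀ᶠ y in 𝓝[<] b, f y ≤ f b := h.filter_mono nhdsWithin_le_nhds
  obtain ⟨y, hy1, hy2⟩ := (h1.and (Ioo_mem_nhdsLT hab)).exists
  have := hf (Ioo_subset_Icc_self hy2) (right_mem_Icc.2 hab.le) hy2.2
  linarith

end MonotoneExtr

/-! ### Monotonicity and the values at the extrema. -/

namespace IsLayerSolution

variable {lam ε : ℝ} {m : ℕ} {u : ℝ → ℝ} {t s : ℕ → ℝ}

lemma t_mem (L : IsLayerSolution lam ε m u t s) {j : ℕ} (h1 : 1 ≤ j) (h2 : j ≤ m) :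
    t j ∈ Ioc 0 Real.pi ∧ IsLocalMax u (t j) := by
  have : t j ∈ t '' Icc 1 m := ⟨j, ⟨h1, h2⟩, rfl⟩
  rwa [← L.maxima] at this

lemma s_mem (L : IsLayerSolution lam ε m u t s) {j : ℕ} (h1 : 1 ≤ j) (h2 : j < m) :
    s j ∈ Ioc 0 Real.pi ∧ IsLocalMin u (s j) := by
  have : s j ∈ s '' Ico 1 m := ⟨j, ⟨h1, h2⟩, rfl⟩
  rwa [← L.minima] at this

lemma t_lt_s (L : IsLayerSolution lam ε m u t s) {j : ℕ} (h1 : 1 ≤ j) (h2 : j < m) : t j < s j :=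
  (L.interlace j ⟨h1, h2⟩).1

lemma s_lt_t (L : IsLayerSolution lam ε m u t s) {j : ℕ} (h1 : 1 ≤ j) (h2 : j < m) :
    s j < t (j + 1) := (L.interlace j ⟨h1, h2⟩).2

lemma t_le_t (L : IsLayerSolution lam ε m u t s) {i j : ℕ} (h1 : 1 ≤ i) (hij : i ≤ j) :
    j ≤ m → t i ≤ t j := by
  induction j, hij using Nat.le_induction with
  | base => exact fun _ => le_rfl
  | succ k hk ih =>
    intro hm
    exact (ih (by omega)).trans
      ((L.t_lt_s (by omega) (by omega)).trans (L.s_lt_t (by omega) (by omega))).le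

lemma s_le_s (L : IsLayerSolution lam ε m u t s) {i j : ℕ} (h1 : 1 ≤ i) (hij : i ≤ j) :
    j < m → s i ≤ s j := by
  induction j, hij using Nat.le_induction with
  | base => exact fun _ => le_rfl
  | succ k hk ih =>
    intro hm
    exact (ih (by omega)).trans
      ((L.s_lt_t (by omega) (by omega)).trans (L.t_lt_s (by omega) hm)).le

lemma s_lt_pi (L : IsLayerSolution lam ε m u t s) {j : ℕ} (h1 : 1 ≤ j) (h2 : j < m) :
    s j < Real.pi := (L.s_lt_t h1 h2).trans_le (L.t_mem (by omega) (by omega)).1.2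

lemma t_lt_pi (L : IsLayerSolution lam ε m u t s) {j : ℕ} (h1 : 1 ≤ j) (h2 : j < m) :
    t j < Real.pi := (L.t_lt_s h1 h2).trans (L.s_lt_pi h1 h2)

lemma t_pos (L : IsLayerSolution lam ε m u t s) {j : ℕ} (h1 : 1 ≤ j) (h2 : j ≤ m) : 0 < t j :=
  (L.t_mem h1 h2).1.1

lemma s_pos (L : IsLayerSolution lam ε m u t s) {j : ℕ} (h1 : 1 ≤ j) (h2 : j < m) : 0 < s j :=
  (L.s_mem h1 h2).1.1

lemma deriv_t (L : IsLayerSolution lam ε m u t s) {j : ℕ} (h1 : 1 ≤ j) (h2 : j ≤ m) :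
    deriv u (t j) = 0 := (L.t_mem h1 h2).2.deriv_eq_zero

lemma deriv_s (L : IsLayerSolution lam ε m u t s) {j : ℕ} (h1 : 1 ≤ j) (h2 : j < m) :
    deriv u (s j) = 0 := (L.s_mem h1 h2).2.deriv_eq_zero

lemma isLocalExtr_cases (L : IsLayerSolution lam ε m u t s) {y : ℝ} (hy : y ∈ Ioc 0 Real.pi)
    (h : IsLocalExtr u y) : (∃ j, 1 ≤ j ∧ j ≤ m ∧ t j = y) ∨ ∃ j, 1 ≤ j ∧ j < m ∧ s j = y := by
  rcases h with h | h
  · have : y ∈ {x : ℝ | x ∈ Ioc 0 Real.pi ∧ IsLocalMin u x} := ⟨hy, h⟩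
    rw [L.minima] at this
    obtain ⟨j, hj, rfl⟩ := this
    exact Or.inr ⟨j, hj.1, hj.2, rfl⟩
  · have : y ∈ {x : ℝ | x ∈ Ioc 0 Real.pi ∧ IsLocalMax u x} := ⟨hy, h⟩
    rw [L.maxima] at this
    obtain ⟨j, hj, rfl⟩ := this
    exact Or.inl ⟨j, hj.1, hj.2, rfl⟩

/-- All extrema in (0, π] are listed and none lies strictly between t_j and s_j; being increasing is
excluded by the maximum at t_j. -/
lemma strictAntiOn (L : IsLayerSolution lam ε m u t s) {j : ℕ} (h1 : 1 ≤ j) (h2 : j < m) :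
    StrictAntiOn u (Icc (t j) (s j)) := by
  have hlt := L.t_lt_s h1 h2
  refine (strictMonoOn_or_strictAntiOn_of_no_extr L.isSolution.1.continuous hlt.le ?_).resolve_left
    fun hm => not_isLocalMax_left hlt hm (L.t_mem h1 h2.le).2
  intro y hy hext
  have hy' : y ∈ Ioc 0 Real.pi :=
    ⟨(L.t_pos h1 h2.le).trans hy.1, (hy.2.trans (L.s_lt_pi h1 h2)).le⟩
  rcases L.isLocalExtr_cases hy' hext with ⟨i, hi1, hi2, rfl⟩ | ⟨i, hi1, hi2, rfl⟩
  · rcases le_or_gt i j with hij | hij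
    · linarith [L.t_le_t hi1 hij h2.le, hy.1]
    · linarith [L.t_le_t (by omega : 1 ≤ j + 1) hij hi2, hy.2, L.s_lt_t h1 h2]
  · rcases lt_or_ge i j with hij | hij
    · linarith [L.t_le_t (by omega : 1 ≤ i + 1) hij h2.le, hy.1, L.s_lt_t hi1 hi2]
    · linarith [L.s_le_s h1 hij hi2, hy.2]

lemma strictMonoOn (L : IsLayerSolution lam ε m u t s) {j : ℕ} (h1 : 1 ≤ j) (h2 : j < m) :
    StrictMonoOn u (Icc (s j) (t (j + 1))) := by
  have hlt := L.s_lt_t h1 h2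
  refine (strictMonoOn_or_strictAntiOn_of_no_extr L.isSolution.1.continuous hlt.le ?_).resolve_right
    fun hm => not_isLocalMax_right hlt hm (L.t_mem (by omega) h2).2
  intro y hy hext
  have hy' : y ∈ Ioc 0 Real.pi :=
    ⟨(L.s_pos h1 h2).trans hy.1, hy.2.le.trans (L.t_mem (by omega) h2).1.2⟩
  rcases L.isLocalExtr_cases hy' hext with ⟨i, hi1, hi2, rfl⟩ | ⟨i, hi1, hi2, rfl⟩
  · rcases le_or_gt i j with hij | hij
    · linarith [L.t_le_t hi1 hij h2.le, hy.1, L.t_lt_s h1 h2]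
    · linarith [L.t_le_t (by omega : 1 ≤ j + 1) hij hi2, hy.2]
  · rcases le_or_gt i j with hij | hij
    · linarith [L.s_le_s hi1 hij h2, hy.1]
    · linarith [L.t_le_t (by omega : 1 ≤ j + 1) hij hi2.le, hy.2, L.t_lt_s hi1 hi2]

lemma strictMonoOn_first (L : IsLayerSolution lam ε m u t s) (hm : 1 ≤ m) :
    StrictMonoOn u (Icc 0 (t 1)) := by
  have hlt := L.first_pos
  refine (strictMonoOn_or_strictAntiOn_of_no_extr L.isSolution.1.continuous hlt.le ?_).resolve_right
    fun hm' => not_isLocalMax_right hlt hm' (L.t_mem le_rfl hm).2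
  intro y hy hext
  have hy' : y ∈ Ioc 0 Real.pi := ⟨hy.1, hy.2.le.trans (L.t_mem le_rfl hm).1.2⟩
  rcases L.isLocalExtr_cases hy' hext with ⟨i, hi1, hi2, rfl⟩ | ⟨i, hi1, hi2, rfl⟩
  · linarith [L.t_le_t le_rfl hi1 hi2, hy.2]
  · linarith [L.t_le_t le_rfl hi1 hi2.le, hy.2, L.t_lt_s hi1 hi2]

lemma t_le_upperRoot (h : lambda0 < lam) (hε : 0 < ε) (L : IsLayerSolution lam ε m u t s) {j : ℕ}
    (h1 : 1 ≤ j) (h2 : j ≤ m) : u (t j) ≤ upperRoot lam (t j) := by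
  rcases (force_nonpos_iff h _ _).1 (L.isSolution.force_nonpos hε (L.t_mem h1 h2).2) with h3 | h3
  · linarith [lowerRoot_lt_middleRoot h (t j), middleRoot_lt_upperRoot h (t j)]
  · exact h3.2

/-- At a minimum the force is nonnegative; the alternative u(s_j) ≥ Ū(s_j) fails because Ū(s_j) ≥
Ū(t_j) ≥ u(t_j) > u(s_j), as Ū increases on [0, π]. -/
lemma s_bounds (h : lambda0 < lam) (hε : 0 < ε) (L : IsLayerSolution lam ε m u t s) {j : ℕ}
    (h1 : 1 ≤ j) (h2 : j < m) :
    lowerRoot lam (s j) ≤ u (s j) ∧ u (s j) ≤ middleRoot lam (s j) := by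
  have hlt := L.t_lt_s h1 h2
  refine ((force_nonneg_iff h _ _).1
    (L.isSolution.force_nonneg hε (L.s_mem h1 h2).2)).resolve_right fun h3 => ?_
  have h4 := L.strictAntiOn h1 h2 (left_mem_Icc.2 hlt.le) (right_mem_Icc.2 hlt.le) hlt
  have h5 := L.t_le_upperRoot h hε h1 h2.le
  have h6 := upperRoot_mono h (Ioc_subset_Icc_self (L.t_mem h1 h2.le).1)
    (Ioc_subset_Icc_self (L.s_mem h1 h2).1) hlt.le
  linarith

/-- For j < m the alternative u(t_j) ≤ lower root is excluded by comparison with s_j, the lower root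
being increasing. For j = m it is u(π) > 0 > U₀(π). -/
lemma middleRoot_le_t (h : lambda0 < lam) (hε : 0 < ε) (L : IsLayerSolution lam ε m u t s) {j : ℕ}
    (h1 : 1 ≤ j) (h2 : j ≤ m) : middleRoot lam (t j) ≤ u (t j) := by
  rcases h2.eq_or_lt with rfl | h2
  · have h3 := middleRoot_zero_pos h
    rw [L.last_eq, ← sub_zero Real.pi, middleRoot_pi_sub h, sub_zero]
    linarith [L.pos_pi]
  have hlt := L.t_lt_s h1 h2
  refine (((force_nonpos_iff h _ _).1
    (L.isSolution.force_nonpos hε (L.t_mem h1 h2.le).2)).resolve_left fun h3 => ?_).1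
  have h4 := L.strictAntiOn h1 h2 (left_mem_Icc.2 hlt.le) (right_mem_Icc.2 hlt.le) hlt
  have h5 := (L.s_bounds h hε h1 h2).1
  have h6 := lowerRoot_mono h (Ioc_subset_Icc_self (L.t_mem h1 h2.le).1)
    (Ioc_subset_Icc_self (L.s_mem h1 h2).1) hlt.le
  linarith

lemma lowerRoot_zero_lt (h : lambda0 < lam) : lowerRoot lam 0 < -√lam := by
  rw [← lowerRoot_pi_div_two h, lowerRoot_eq h, lowerRoot_eq h, Real.cos_zero,
    Real.cos_pi_div_two, neg_lt_neg_iff]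
  exact topRoot_strictAnti h (by norm_num) (by norm_num) (by norm_num)

/-- The value u(0) lies strictly between the lower and middle roots at 0. Hence u''(0) > 0 and 0 is
a minimum, which becomes the last maximum after reflection. -/
lemma force_zero_pos (h : lambda0 < lam) (L : IsLayerSolution lam ε m u t s) :
    0 < u 0 ^ 3 - lam * u 0 + Real.cos 0 := by
  by_contra! hcon
  have h1 := lowerRoot_zero_lt h
  have h2 := L.lower_zero
  have h3 := L.upper_zero
  rcases (force_nonpos_iff h _ _).1 hcon with h4 | h4 <;> linarith

lemma deriv_deriv_zero_pos (h : lambda0 < lam) (hε : 0 < ε) (L : IsLayerSolution lam ε m u t s) :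
    0 < deriv (deriv u) 0 := by
  have h1 := L.force_zero_pos h
  rw [← L.isSolution.2] at h1
  exact pos_of_mul_pos_right h1 (by positivity)

lemma card_le_of_alternating (L : IsLayerSolution lam ε m u t s) {N : ℕ}
    {x : ℕ → ℝ} (hx : StrictMono x) (ha : 0 ≤ x 0) (hb : x (2 * N) ≤ Real.pi)
    (h1 : ∀ i < N, u (x (2 * i)) < u (x (2 * i + 1)))
    (h2 : ∀ i < N, u (x (2 * i + 2)) < u (x (2 * i + 1))) : N ≤ m := by
  classical
  refine (card_localMax_of_alternating L.isSolution.1.continuous hx ha hb h1 h2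
    (S := (Finset.Icc 1 m).image t) fun y hy hmax => ?_).trans
    (Finset.card_image_le.trans (by simp))
  rcases (by
    have : y ∈ {x : ℝ | x ∈ Ioc 0 Real.pi ∧ IsLocalMax u x} := ⟨Ioo_subset_Ioc_self hy, hmax⟩
    rw [L.maxima] at this
    exact this : y ∈ t '' Icc 1 m) with ⟨j, hj, rfl⟩
  exact Finset.mem_image_of_mem _ (Finset.mem_Icc.2 hj)

/-- The maxima and minima of the reflected solution. -/
noncomputable def reflectMax (m : ℕ) (s : ℕ → ℝ) : ℕ → ℝ :=
  fun j => if j = m then Real.pi else Real.pi - s (m - j)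

/-- The maximum of u at π is sent to 0, outside (0, π], so exactly m - 1 minima remain, in reversed
order. -/
noncomputable def reflectMin (m : ℕ) (t : ℕ → ℝ) : ℕ → ℝ := fun j => Real.pi - t (m - j)

lemma isLocalMax_reflect {x : ℝ} : IsLocalMax (ForcedDuffing.reflect u) x ↔
    IsLocalMin u (Real.pi - x) := by
  have hc : ∀ y : ℝ, Tendsto (fun z => Real.pi - z) (𝓝 y) (𝓝 (Real.pi - y)) := fun y =>
    (continuous_const.sub continuous_id).tendsto y
  constructor
  · intro h
    have h1 : ∀ᶠ y in 𝓝 (Real.pi - x), ForcedDuffing.reflect u (Real.pi - y) ≤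
        ForcedDuffing.reflect u x := by
      have := hc (Real.pi - x)
      rw [sub_sub_cancel] at this
      exact this.eventually h
    filter_upwards [h1] with y hy
    simpa [ForcedDuffing.reflect] using hy
  · intro h
    filter_upwards [(hc x).eventually h] with y hy
    simpa [ForcedDuffing.reflect] using hy

lemma reflect_reflect (u : ℝ → ℝ) : ForcedDuffing.reflect (ForcedDuffing.reflect u) = u := by
  funext x; simp [ForcedDuffing.reflect]

lemma isLocalMin_reflect {x : ℝ} : IsLocalMin (ForcedDuffing.reflect u) x ↔
    IsLocalMax u (Real.pi - x) := by
  have := isLocalMax_reflect (u := ForcedDuffing.reflect u) (x := Real.pi - x)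
  rw [sub_sub_cancel, reflect_reflect] at this
  exact this.symm

/-- The two value hypotheses become conditions at the opposite ends: u(0) < 0 gives positivity at π,
and u(π) < √λ gives the lower bound at 0. -/
theorem reflect (h : lambda0 < lam) (hε : 0 < ε) (hm : 2 ≤ m) (L : IsLayerSolution lam ε m u t s)
    (h0 : u 0 < 0) (hpi : u Real.pi < √lam) :
    IsLayerSolution lam ε m (ForcedDuffing.reflect u) (reflectMax m s) (reflectMin m t) := by
  have hdd := L.deriv_deriv_zero_pos h hε
  have hcont := L.isSolution.1.continuous
  refine ⟨L.isSolution.reflect, reflect_periodic L.periodic, ?_, ?_, ?_, ?_, ?_, ?_, ?_, ?_, ?_, ?_⟩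
  · rw [deriv_reflect, sub_zero, L.deriv_pi]
  · rw [deriv_reflect, sub_self, L.deriv_zero]
  · simp only [ForcedDuffing.reflect, sub_zero]; linarith
  · simp only [ForcedDuffing.reflect, sub_zero]
    linarith [L.pos_pi, middleRoot_zero_pos h]
  · simp only [ForcedDuffing.reflect, sub_self]; linarith
  · ext x
    simp only [mem_ofPred_eq, isLocalMax_reflect, mem_image]
    constructor
    · rintro ⟨hx, hmin⟩
      rcases hx.2.eq_or_lt with rfl | hlt
      · exact ⟨m, ⟨by omega, le_rfl⟩, by simp [reflectMax]⟩
      · have : Real.pi - x ∈ {x : ℝ | x ∈ Ioc 0 Real.pi ∧ IsLocalMin u x} :=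
          ⟨⟨by linarith, by linarith [hx.1]⟩, hmin⟩
        rw [L.minima] at this
        obtain ⟨j, hj, he⟩ := this
        obtain ⟨hj1, hj2⟩ := hj
        refine ⟨m - j, ⟨by omega, by omega⟩, ?_⟩
        have e1 : m - j ≠ m := by omega
        have e2 : m - (m - j) = j := by omega
        simp only [reflectMax, e1, if_false, e2]
        linarith
    · rintro ⟨j, ⟨hj1, hj2⟩, rfl⟩
      by_cases hjm : j = m
      · simp only [reflectMax, hjm, if_true, sub_self]
        exact ⟨⟨Real.pi_pos, le_rfl⟩, isLocalMin_of_deriv_deriv_pos hdd L.deriv_zero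
          hcont.continuousAt⟩
      · obtain ⟨e1, e2⟩ := L.s_mem (j := m - j) (by omega) (by omega)
        have e3 := L.s_lt_pi (j := m - j) (by omega) (by omega)
        simp only [reflectMax, hjm, if_false, sub_sub_cancel]
        exact ⟨⟨by linarith, by linarith [e1.1]⟩, e2⟩
  · ext x
    simp only [mem_ofPred_eq, isLocalMin_reflect, mem_image]
    constructor
    · rintro ⟨hx, hmax⟩
      rcases hx.2.eq_or_lt with rfl | hlt
      · rw [sub_self] at hmax
        linarith [hmax.deriv_deriv_nonpos hcont.continuousAt]
      · have : Real.pi - x ∈ {x : ℝ | x ∈ Ioc 0 Real.pi ∧ IsLocalMax u x} :=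
          ⟨⟨by linarith, by linarith [hx.1]⟩, hmax⟩
        rw [L.maxima] at this
        obtain ⟨j, hj, he⟩ := this
        obtain ⟨hj1, hj2⟩ := hj
        have hjm : j ≠ m := by
          rintro rfl
          rw [L.last_eq] at he
          linarith [hx.1]
        refine ⟨m - j, ⟨by omega, by omega⟩, ?_⟩
        have e2 : m - (m - j) = j := by omega
        simp only [reflectMin, e2]
        linarith
    · rintro ⟨j, ⟨hj1, hj2⟩, rfl⟩
      obtain ⟨e1, e2⟩ := L.t_mem (j := m - j) (by omega) (by omega)
      have e3 := L.t_lt_pi (j := m - j) (by omega) (by omega)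
      simp only [reflectMin, sub_sub_cancel]
      exact ⟨⟨by linarith, by linarith [e1.1]⟩, e2⟩
  · have e1 : (1 : ℕ) ≠ m := by omega
    simp only [reflectMax, e1, if_false]
    linarith [L.s_lt_pi (j := m - 1) (by omega) (by omega)]
  · rintro j ⟨hj1, hj2⟩
    have e1 : j ≠ m := by omega
    simp only [reflectMax, reflectMin, e1, if_false]
    refine ⟨by linarith [L.t_lt_s (j := m - j) (by omega) (by omega)], ?_⟩
    by_cases hjm : j + 1 = m
    · have e2 : m - j = 1 := by omega
      rw [if_pos hjm, e2]
      linarith [L.first_pos]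
    · rw [if_neg hjm]
      have := L.s_lt_t (j := m - (j + 1)) (by omega) (by omega)
      rw [show m - (j + 1) + 1 = m - j by omega] at this
      linarith
  · simp [reflectMax]

end IsLayerSolution

/-! ### Families of layer solutions and their fast-time limits -/

section Family

variable {ι : Type*} {𝓤 : Ultrafilter ι} {lam α : ℝ} {m : ℕ} {ε : ι → ℝ} {u : ι → ℝ → ℝ}
  {t s : ι → ℕ → ℝ} {a b l r : ι → ℝ} {v : ℝ → ℝ}

/-- Along `𝓤`, the `u i` are layer solutions with parameters `ε i → 0⁺`. -/
structure LayerFamily (𝓤 : Ultrafilter ι) (lam : ℝ) (m : ℕ) (ε : ι → ℝ) (u : ι → ℝ → ℝ)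
    (t s : ι → ℕ → ℝ) : Prop where
  pos : ∀ᶠ i in 𝓤, 0 < ε i
  lim : Tendsto ε 𝓤 (𝓝 0)
  layer : ∀ᶠ i in 𝓤, IsLayerSolution lam (ε i) m (u i) (t i) (s i)

lemma eventually_add_le (hpos : ∀ᶠ i in 𝓤, 0 < ε i)
    (h : Tendsto (fun i => (b i - a i) / ε i) 𝓤 atTop) (σ : ℝ) :
    ∀ᶠ i in 𝓤, a i + ε i * σ ≤ b i := by
  filter_upwards [hpos, h.eventually_ge_atTop σ] with i h1 h2
  rw [le_div_iff₀ h1] at h2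
  linarith

lemma IsWindow.le_of_monotoneOn (hv : IsWindow 𝓤 lam ε u a α v) (hpos : ∀ᶠ i in 𝓤, 0 < ε i)
    (hm : ∀ᶠ i in 𝓤, MonotoneOn (u i) (Icc (l i) (r i))) {τ σ : ℝ} (hτσ : τ ≤ σ)
    (hl : ∀ᶠ i in 𝓤, l i ≤ a i + ε i * τ) (hr : ∀ᶠ i in 𝓤, a i + ε i * σ ≤ r i) :
    v τ ≤ v σ := by
  refine le_of_tendsto_of_tendsto (hv.pos_at τ) (hv.pos_at σ) ?_
  filter_upwards [hpos, hm, hl, hr] with i h1 h2 h3 h4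
  have h5 : a i + ε i * τ ≤ a i + ε i * σ := by
    have := mul_le_mul_of_nonneg_left hτσ h1.le; linarith
  exact h2 ⟨h3, h5.trans h4⟩ ⟨h3.trans h5, h4⟩ h5

lemma IsWindow.le_of_antitoneOn (hv : IsWindow 𝓤 lam ε u a α v) (hpos : ∀ᶠ i in 𝓤, 0 < ε i)
    (hm : ∀ᶠ i in 𝓤, AntitoneOn (u i) (Icc (l i) (r i))) {τ σ : ℝ} (hτσ : τ ≤ σ)
    (hl : ∀ᶠ i in 𝓤, l i ≤ a i + ε i * τ) (hr : ∀ᶠ i in 𝓤, a i + ε i * σ ≤ r i) :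
    v σ ≤ v τ := by
  refine le_of_tendsto_of_tendsto (hv.pos_at σ) (hv.pos_at τ) ?_
  filter_upwards [hpos, hm, hl, hr] with i h1 h2 h3 h4
  have h5 : a i + ε i * τ ≤ a i + ε i * σ := by
    have := mul_le_mul_of_nonneg_left hτσ h1.le; linarith
  exact h2 ⟨h3, h5.trans h4⟩ ⟨h3.trans h5, h4⟩ h5

lemma tendsto_add_mul (hlim : Tendsto ε 𝓤 (𝓝 0)) (ha : Tendsto a 𝓤 (𝓝 α)) {θ : ι → ℝ} {x : ℝ}
    (hθ : Tendsto θ 𝓤 (𝓝 x)) : Tendsto (fun i => a i + ε i * θ i) 𝓤 (𝓝 α) := by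
  simpa using ha.add (hlim.mul hθ)

/-- Two critical points collapsing in fast time force a constant limit. -/
lemma IsWindow.tendsto_gap (hv : IsWindow 𝓤 lam ε u a α v)
    (hF : ∀ᶠ i in 𝓤, 0 < ε i ∧ IsSolution lam (ε i) (u i)) (hlim : Tendsto ε 𝓤 (𝓝 0))
    (hadm : IsAdmissible lam (Real.cos α) v) (hne : ¬∀ τ, v τ = v 0)
    (ha0 : ∀ᶠ i in 𝓤, deriv (u i) (a i) = 0) (hb0 : ∀ᶠ i in 𝓤, deriv (u i) (b i) = 0)
    (hab : ∀ᶠ i in 𝓤, a i < b i) : Tendsto (fun i => (b i - a i) / ε i) 𝓤 atTop := by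
  have hdv := hv.deriv_zero_eq ha0
  refine (tendsto_atTop_or_exists_tendsto (by
    filter_upwards [hF, hab] with i h1 h2
    exact div_nonneg (by linarith) h1.1.le)).resolve_right ?_
  rintro ⟨x, hx0, hx⟩
  have hcancel : ∀ c : ι → ℝ, ∀ᶠ i in 𝓤, a i + ε i * ((c i - a i) / ε i) = c i := fun c => by
    filter_upwards [hF] with i h1
    rw [mul_div_cancel₀ _ h1.1.ne']; ring
  have hdx : deriv v x = 0 := by
    refine tendsto_nhds_unique (hv.vel hx) (tendsto_const_nhds.congr' ?_)
    filter_upwards [hcancel b, hb0] with i h1 h2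
    rw [h1, h2, mul_zero]
  -- If the fast-time distance tends to 0, Rolle for u' gives a zero of u'' in between, so v 0 is an
  -- equilibrium; if it tends to x > 0, then v has two critical points.
  rcases hx0.eq_or_lt with rfl | hxpos
  · have hex : ∀ᶠ i in 𝓤, ∃ ξ, ξ ∈ Ioo (a i) (b i) ∧ deriv (deriv (u i)) ξ = 0 := by
      filter_upwards [hF, ha0, hb0, hab] with i h1 h2 h3 h4
      obtain ⟨ξ, hξ, he⟩ := exists_deriv_eq_zero h4
        h1.2.1.contDiff_one_deriv.continuous.continuousOn (h2.trans h3.symm)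
      exact ⟨ξ, hξ, he⟩
    obtain ⟨ξ, hξ⟩ := hex.choice
    have hθ : Tendsto (fun i => (ξ i - a i) / ε i) 𝓤 (𝓝 0) := by
      refine tendsto_of_tendsto_of_tendsto_of_le_of_le' tendsto_const_nhds hx ?_ ?_
      · filter_upwards [hF, hξ] with i h1 h2
        exact div_nonneg (by linarith [h2.1.1]) h1.1.le
      · filter_upwards [hF, hξ] with i h1 h2
        exact div_le_div_of_nonneg_right (by linarith [h2.1.2]) h1.1.le
    have hu : Tendsto (fun i => u i (ξ i)) 𝓤 (𝓝 (v 0)) :=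
      (hv.pos hθ).congr' ((hcancel ξ).mono fun i hi => by simp only [hi])
    have hξα : Tendsto ξ 𝓤 (𝓝 α) :=
      (tendsto_add_mul hlim hv.base hθ).congr' (hcancel ξ)
    have hf : Tendsto (fun i => u i (ξ i) ^ 3 - lam * u i (ξ i) + Real.cos (ξ i)) 𝓤
        (𝓝 (v 0 ^ 3 - lam * v 0 + Real.cos α)) :=
      ((hu.pow 3).sub (hu.const_mul lam)).add ((Real.continuous_cos.tendsto α).comp hξα)
    have h0 := tendsto_nhds_unique hf (tendsto_const_nhds.congr' (by
      filter_upwards [hF, hξ] with i h1 h2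
      rw [← h1.2.2, h2.2, mul_zero]))
    exact hne fun τ => hv.sol.eq_const_of_equilibrium hdv h0 τ
  · exact hne (hadm.critical 0 x hxpos.ne hdv hdx)

/-- Points where the solution differs from a constant limit are far away in fast time. -/
lemma IsWindow.tendsto_gap_of_const (hv : IsWindow 𝓤 lam ε u a α v)
    (hpos : ∀ᶠ i in 𝓤, 0 < ε i) (hc : ∀ τ, v τ = v 0) {ρ : ℝ} (hρ : ρ ≠ v 0)
    (hb : ∀ᶠ i in 𝓤, u i (b i) = ρ) : Tendsto (fun i => |b i - a i| / ε i) 𝓤 atTop := by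
  refine (tendsto_atTop_or_exists_tendsto (hpos.mono fun i h1 =>
    div_nonneg (abs_nonneg _) h1.le)).resolve_right ?_
  rintro ⟨x, -, hx⟩
  obtain ⟨y, -, hy⟩ := exists_tendsto_of_bounded (𝓤 := 𝓤) (g := fun i => (b i - a i) / ε i)
    (a := -(x + 1)) (b := x + 1) (by
    filter_upwards [hpos, hx.eventually_lt_const (lt_add_one x)] with i h1 h2
    have h3 : |(b i - a i) / ε i| ≤ x + 1 := by
      rw [abs_div, abs_of_pos h1]; exact h2.le
    exact abs_le.1 h3)
  have h1 : Tendsto (fun i => u i (b i)) 𝓤 (𝓝 (v y)) := (hv.pos hy).congr' (by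
    filter_upwards [hpos] with i h1
    rw [mul_div_cancel₀ _ h1.ne', add_sub_cancel])
  rw [hc y] at h1
  exact hρ (tendsto_nhds_unique (tendsto_const_nhds.congr' (hb.mono fun i hi => hi.symm)) h1)

/-! ### Admissible limits of layer solutions. -/

namespace LayerFamily

lemma solution (F : LayerFamily 𝓤 lam m ε u t s) :
    ∀ᶠ i in 𝓤, 0 < ε i ∧ IsSolution lam (ε i) (u i) := by
  filter_upwards [F.pos, F.layer] with i h1 h2
  exact ⟨h1, h2.isSolution⟩

lemma bounded (h : lambda0 < lam) (F : LayerFamily 𝓤 lam m ε u t s) :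
    BoundedFamily 𝓤 lam (upperRoot lam Real.pi) ε u := by
  refine ⟨F.pos, F.lim, F.layer.mono fun i hi => hi.isSolution, ?_⟩
  filter_upwards [F.pos, F.layer] with i h1 h2
  exact h2.isSolution.abs_le_upperRoot_pi h h1 h2.periodic

/-- The two points are translated by successive periods; if the first value is the larger, the pair
(y, x + P) is used instead. -/
lemma exists_alternating {v : ℝ → ℝ} {P x y : ℝ} (hP : Function.Periodic v P) (hxy : x < y)
    (hy : y < x + P) (hv : v x ≠ v y) :
    ∃ X : ℕ → ℝ, StrictMono X ∧ ∃ p q, p < q ∧ (∀ k, v (X (2 * k)) = p) ∧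
      ∀ k, v (X (2 * k + 1)) = q := by
  have key : ∀ {x y : ℝ}, x < y → y < x + P → v x < v y →
      ∃ X : ℕ → ℝ, StrictMono X ∧ ∃ p q, p < q ∧ (∀ k, v (X (2 * k)) = p) ∧
        ∀ k, v (X (2 * k + 1)) = q := by
    intro x y hxy hy hv
    have e0 : ∀ k : ℕ, (2 * k) % 2 = 0 := fun k => by omega
    have e1 : ∀ k : ℕ, (2 * k + 1) % 2 = 1 := fun k => by omega
    have d0 : ∀ k : ℕ, (2 * k) / 2 = k := fun k => by omega
    have d1 : ∀ k : ℕ, (2 * k + 1) / 2 = k := fun k => by omega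
    refine ⟨fun n => (if n % 2 = 0 then x else y) + (n / 2 : ℕ) * P, ?_, v x, v y, hv, ?_, ?_⟩
    · refine strictMono_nat_of_lt_succ fun n => ?_
      rcases Nat.even_or_odd' n with ⟨k, rfl | rfl⟩
      · simp only [e0, e1, d0, d1, if_true, one_ne_zero, if_false]
        linarith
      · have e2 : (2 * k + 1 + 1) % 2 = 0 := by omega
        have d2 : (2 * k + 1 + 1) / 2 = k + 1 := by omega
        simp only [e1, d1, e2, d2, if_true, one_ne_zero, if_false]
        push_cast
        linarith
    · intro k
      simp only [e0, d0, if_true]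
      exact hP.nat_mul k x
    · intro k
      simp only [e1, d1, one_ne_zero, if_false]
      exact hP.nat_mul k y
  rcases lt_or_gt_of_ne hv with hlt | hlt
  · exact key hxy hy hlt
  · exact key hy (by linarith) (by rw [hP]; exact hlt)

/-- A nonconstant fast-time limit has at most one critical point, as periodic limits would
produce too many maxima. -/
lemma window_critical (F : LayerFamily 𝓤 lam m ε u t s) (hv : IsWindow 𝓤 lam ε u a α v)
    (ha : ∀ᶠ i in 𝓤, a i ∈ Icc 0 Real.pi) {x y : ℝ} (hxy : x < y) (hx : deriv v x = 0)
    (hy : deriv v y = 0) (τ : ℝ) : v τ = v 0 := by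
  by_contra hτ
  have hP := hv.sol.periodic_of_critical hx hy
  set P := 2 * (y - x) with hPdef
  have hP0 : 0 < P := by linarith
  obtain ⟨z, hz⟩ : ∃ z, v z ≠ v x := by
    by_contra! hcon
    exact hτ (by rw [hcon τ, hcon 0])
  obtain ⟨z', hz', hzz'⟩ := hP.exists_mem_Ico hP0 z x
  rw [hzz'] at hz
  have hz'x : x < z' := lt_of_le_of_ne hz'.1 (by rintro rfl; exact hz rfl)
  obtain ⟨X, hX, p, q, hpq, hXp, hXq⟩ := exists_alternating hP hz'x hz'.2 hz.symm
  -- shift the alternating points to one side of the origin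
  obtain ⟨K, hK⟩ : ∃ K : ℤ, (α < Real.pi → 0 ≤ X 0 + K * P) ∧
      (Real.pi ≤ α → X (2 * (m + 1)) + K * P ≤ 0) := by
    by_cases hα : α < Real.pi
    · obtain ⟨K, hK⟩ := exists_nat_ge (-X 0 / P)
      refine ⟨K, fun _ => ?_, fun h => absurd hα (not_lt.2 h)⟩
      rw [div_le_iff₀ hP0] at hK
      push_cast; linarith
    · obtain ⟨K, hK⟩ := exists_nat_ge (X (2 * (m + 1)) / P)
      refine ⟨-K, fun h => absurd h hα, fun _ => ?_⟩
      rw [div_le_iff₀ hP0] at hK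
      push_cast; linarith
  set Y : ℕ → ℝ := fun n => X n + K * P with hY
  have hYm : StrictMono Y := fun i j hij => by simp only [hY]; linarith [hX hij]
  have hYp : ∀ k, v (Y (2 * k)) = p := fun k => by simp only [hY]; rw [hP.int_mul K, hXp]
  have hYq : ∀ k, v (Y (2 * k + 1)) = q := fun k => by simp only [hY]; rw [hP.int_mul K, hXq]
  have hev1 : ∀ᶠ i in 𝓤, ∀ k ∈ Finset.range (m + 1),
      u i (a i + ε i * Y (2 * k)) < u i (a i + ε i * Y (2 * k + 1)) := by
    rw [eventually_all_finset]
    intro k _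
    refine (hv.pos_at _).eventually_lt (hv.pos_at _) ?_
    rw [hYp, hYq]; exact hpq
  have hev2 : ∀ᶠ i in 𝓤, ∀ k ∈ Finset.range (m + 1),
      u i (a i + ε i * Y (2 * k + 2)) < u i (a i + ε i * Y (2 * k + 1)) := by
    rw [eventually_all_finset]
    intro k _
    refine (hv.pos_at _).eventually_lt (hv.pos_at _) ?_
    rw [show 2 * k + 2 = 2 * (k + 1) by ring, hYp, hYq]; exact hpq
  -- The base points may tend to 0 or π. The shift by whole periods goes right if α < π and left
  -- otherwise, which keeps all points inside [0, π], where the extrema are counted.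
  have hin : ∀ᶠ i in 𝓤, 0 ≤ a i + ε i * Y 0 ∧ a i + ε i * Y (2 * (m + 1)) ≤ Real.pi := by
    have hl := fun n => tendsto_add_mul F.lim hv.base
      (tendsto_const_nhds (x := Y n) (f := (𝓤 : Filter ι)))
    by_cases hα : α < Real.pi
    · filter_upwards [F.pos, ha, (hl (2 * (m + 1))).eventually_lt_const hα] with i h1 h2 h3
      exact ⟨add_nonneg h2.1 (mul_nonneg h1.le (hK.1 hα)), h3.le⟩
    · have hα0 : 0 < α := Real.pi_pos.trans_le (not_lt.1 hα)
      filter_upwards [F.pos, ha, (hl 0).eventually_const_lt hα0] with i h1 h2 h3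
      refine ⟨h3.le, ?_⟩
      have := mul_nonpos_of_nonneg_of_nonpos h1.le (hK.2 (not_lt.1 hα))
      linarith [h2.2]
  obtain ⟨i, h1, h2, h3, h4, h5⟩ := (F.pos.and (F.layer.and (hev1.and (hev2.and hin)))).exists
  have := h2.card_le_of_alternating (N := m + 1) (x := fun n => a i + ε i * Y n)
    (fun n k hnk => by
      have := mul_lt_mul_of_pos_left (hYm hnk) h1
      simp only; linarith) h5.1 h5.2
    (fun k hk => h3 k (Finset.mem_range.2 hk)) (fun k hk => h4 k (Finset.mem_range.2 hk))
  omega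

theorem exists_window (h : lambda0 < lam) (F : LayerFamily 𝓤 lam m ε u t s)
    (ha : ∀ᶠ i in 𝓤, a i ∈ Icc 0 Real.pi) :
    ∃ α ∈ Icc 0 Real.pi, ∃ v, IsWindow 𝓤 lam ε u a α v ∧ IsAdmissible lam (Real.cos α) v := by
  obtain ⟨α, hα, hlim⟩ := exists_tendsto_of_bounded ha
  obtain ⟨v, hv, hB⟩ := (F.bounded h).exists_window hlim
  refine ⟨α, hα, v, hv, hv.sol, ⟨_, hB⟩, ?_, ?_⟩
  · obtain ⟨η, hη, e0, he0, hav⟩ := exists_avoid h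
    refine ⟨η, hη, fun τ => ?_⟩
    have hb := tendsto_add_mul F.lim hlim (tendsto_const_nhds (x := τ) (f := (𝓤 : Filter ι)))
    have h1 : Tendsto (fun i => |u i (a i + ε i * τ) - middleRoot lam (a i + ε i * τ)| +
        |ε i * deriv (u i) (a i + ε i * τ)|) 𝓤 (𝓝 (|v τ - middleRoot lam α| + |deriv v τ|)) :=
      ((hv.pos_at τ).sub (((contDiff_middleRoot h).continuous.tendsto α).comp hb)).abs.add
        (hv.vel_at τ).abs
    rw [← middleRoot_eq h]
    refine ge_of_tendsto h1 ?_
    have hε2 : Tendsto (fun i => ε i ^ 2) 𝓤 (𝓝 (0 ^ 2)) := F.lim.pow 2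
    rw [zero_pow two_ne_zero] at hε2
    filter_upwards [F.pos, F.layer, hε2.eventually_lt_const he0] with i h2 h3 h4
    exact hav (ε i) (u i) h2 h4.le h3.isSolution h3.periodic h3.pos_pi _
  · intro x y hxy hx hy
    rcases lt_or_gt_of_ne hxy with hlt | hlt
    · exact F.window_critical hv ha hlt hx hy
    · exact F.window_critical hv ha hlt hy hx

/-- The limit is nonconstant because -√λ ≤ v 0 ≤ U₀(0) lies strictly between the two saddles at time
0. -/
theorem window_zero (h : lambda0 < lam) (F : LayerFamily 𝓤 lam m ε u t s) :
    ∃ v, IsWindow 𝓤 lam ε u (fun _ => 0) 0 v ∧ IsAdmissible lam 1 v ∧ (¬∀ τ, v τ = v 0) ∧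
      deriv v 0 = 0 ∧ v 0 = turningPoint lam 1 ∧ Tendsto v atTop (𝓝 (upperRoot lam 0)) := by
  obtain ⟨α, -, v, hv, hadm⟩ := F.exists_window h (a := fun _ => 0)
    (Eventually.of_forall fun _ => left_mem_Icc.2 Real.pi_pos.le)
  obtain rfl : α = 0 := tendsto_nhds_unique hv.base tendsto_const_nhds
  rw [Real.cos_zero] at hadm
  have hd := hv.deriv_zero_eq (F.layer.mono fun i hi => hi.deriv_zero)
  have h1 : -√lam ≤ v 0 := ge_of_tendsto hv.pos_zero (F.layer.mono fun i hi => hi.lower_zero.le)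
  have h2 : v 0 ≤ middleRoot lam 0 :=
    le_of_tendsto hv.pos_zero (F.layer.mono fun i hi => hi.upper_zero.le)
  have hne : ¬∀ τ, v τ = v 0 := by
    intro hc
    rcases hadm.const_cases h (by norm_num) hc with h3 | h3
    · have := middleRoot_lt_upperRoot h 0
      rw [upperRoot_eq h, Real.cos_zero] at this
      linarith
    · have := IsLayerSolution.lowerRoot_zero_lt h
      rw [lowerRoot_eq h, Real.cos_zero] at this
      linarith
  refine ⟨v, hv, hadm, hne, hd, hadm.critical_value_of_pos h (by norm_num) one_pos hne hd, ?_⟩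
  rw [upperRoot_eq h, Real.cos_zero]
  exact hadm.tendsto_top_of_pos h (by norm_num) one_pos hne

/-- Both 0 and s_j are critical points, and the limit at 0 has only one. This makes s_j large
compared with ε, which the energy argument needs. -/
lemma tendsto_s_div (h : lambda0 < lam) (F : LayerFamily 𝓤 lam m ε u t s) {j : ℕ} (h1 : 1 ≤ j)
    (h2 : j < m) : Tendsto (fun i => s i j / ε i) 𝓤 atTop := by
  obtain ⟨v, hv, hadm, hne, -⟩ := F.window_zero h
  have := hv.tendsto_gap F.solution F.lim (by rwa [Real.cos_zero]) hne (b := fun i => s i j)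
    (F.layer.mono fun i hi => hi.deriv_zero) (F.layer.mono fun i hi => hi.deriv_s h1 h2)
    (F.layer.mono fun i hi => hi.s_pos h1 h2)
  simpa using this

end LayerFamily

end Family

lemma IsV1.eq_turningPoint {lam : ℝ} (h : lambda0 < lam) {V : ℝ → ℝ} (hV : IsV1 lam V) :
    V 0 = turningPoint lam 1 := by
  obtain ⟨hsol, h1, -, hd, x, hx⟩ := hV
  rw [upperRoot_eq h, Real.cos_zero] at h1 hx
  refine hsol.critical_value_of_homoclinic h (by norm_num) one_pos h1 (fun hc => ?_) hd
  exact hx (tendsto_nhds_unique (tendsto_const_nhds.congr fun τ =>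
    (hc x).trans (hc τ).symm) h1)

/-! ### Growth rates near the upper root -/

/-- The range reaches past π/2 so that it still covers an excursion whose minimum lies slightly
beyond π/2. -/
lemma quarter_le_sin {x : ℝ} (h0 : 0 ≤ x) (h2 : x ≤ 2) : x / 4 ≤ Real.sin x := by
  have hpi := Real.pi_gt_three
  have hpi4 := Real.pi_le_four
  rcases le_or_gt x (Real.pi / 2) with h | h
  · refine le_trans ?_ (Real.mul_le_sin h0 h)
    rw [div_mul_eq_mul_div, le_div_iff₀ Real.pi_pos]
    nlinarith
  · have h3 := Real.mul_le_sin (x := Real.pi - x) (by linarith) (by linarith)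
    rw [Real.sin_pi_sub] at h3
    refine le_trans ?_ h3
    rw [div_mul_eq_mul_div, le_div_iff₀ Real.pi_pos]
    nlinarith

/-- A level strictly between the inflection point and the upper root. -/
noncomputable def midLevel (lam : ℝ) : ℝ := (upperRoot lam 0 + √(lam / 3)) / 2

section Level

variable {lam : ℝ}

lemma inflection_lt_midLevel (h : lambda0 < lam) : √(lam / 3) < midLevel lam := by
  unfold midLevel; linarith [inflection_lt_upperRoot h 0]

lemma midLevel_lt_upperRoot (h : lambda0 < lam) (x : ℝ) : midLevel lam < upperRoot lam x := by
  unfold midLevel; linarith [inflection_lt_upperRoot h 0, upperRoot_zero_le h x]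

lemma midLevel_pos (h : lambda0 < lam) : 0 < midLevel lam :=
  (inflection_pos h).trans (inflection_lt_midLevel h)

lemma middleRoot_lt_midLevel (h : lambda0 < lam) (x : ℝ) : middleRoot lam x < midLevel lam :=
  (abs_lt.1 (abs_middleRoot_lt h x)).2.trans (inflection_lt_midLevel h)

lemma neg_midLevel_lt_middleRoot (h : lambda0 < lam) (x : ℝ) :
    -midLevel lam < middleRoot lam x := by
  linarith [(abs_lt.1 (abs_middleRoot_lt h x)).1, inflection_lt_midLevel h]

lemma lowerRoot_lt_neg_midLevel (h : lambda0 < lam) (x : ℝ) : lowerRoot lam x < -midLevel lam := by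
  have h1 := midLevel_lt_upperRoot h (Real.pi - x)
  rw [upperRoot_pi_sub h] at h1
  linarith

/-- A lower bound for the difference quotient of the force above `midLevel`. -/
noncomputable def levelRate (lam : ℝ) : ℝ :=
  midLevel lam ^ 2 + midLevel lam * upperRoot lam 0 + upperRoot lam 0 ^ 2 - lam

lemma levelRate_pos (h : lambda0 < lam) : 0 < levelRate lam := by
  have h1 := inflection_lt_midLevel h
  have h2 := midLevel_lt_upperRoot h 0
  have h3 := inflection_sq h
  have h4 := inflection_pos h
  unfold levelRate
  nlinarith

lemma levelRate_le (h : lambda0 < lam) {x y : ℝ} (hy : midLevel lam ≤ y) :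
    levelRate lam ≤ y ^ 2 + y * upperRoot lam x + upperRoot lam x ^ 2 - lam := by
  have h1 := midLevel_pos h
  have h2 := midLevel_lt_upperRoot h 0
  have h3 := upperRoot_zero_le h x
  unfold levelRate
  nlinarith

end Level

/-- The time needed by a supersolution of `h'' = κ² h` to reach a given height. -/
lemma time_le_of_growth {h : ℝ → ℝ} {a b κ g H : ℝ} (hab : a ≤ b) (hκ : 0 < κ) (hg : 0 < g)
    (hh : ContDiff ℝ 2 h) (hconv : ∀ t ∈ Icc a b, κ ^ 2 * h t ≤ deriv (deriv h) t)
    (h0 : 0 ≤ h a) (hg0 : g ≤ deriv h a + κ * h a) (hH : h b ≤ H) (hH0 : 0 ≤ H) :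
    κ * (b - a) ≤ Real.log (1 + 2 * κ * H / g) := by
  have h1 := growth_le hκ hh hconv b (right_mem_Icc.2 hab)
  set X := Real.exp (κ * (b - a)) with hX
  have h2 : Real.exp (2 * κ * (b - a)) = X * X := by
    rw [hX, ← Real.exp_add]; congr 1; ring
  rw [h2] at h1
  have hX1 : 1 ≤ X := Real.one_le_exp (mul_nonneg hκ.le (by linarith))
  have h3 : g * ((X * X - 1) / (2 * κ)) ≤ H * X := by
    have e1 : g * ((X * X - 1) / (2 * κ)) ≤ (deriv h a + κ * h a) * ((X * X - 1) / (2 * κ)) :=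
      mul_le_mul_of_nonneg_right hg0 (div_nonneg (by nlinarith) (by positivity))
    have e2 : h b * X ≤ H * X := mul_le_mul_of_nonneg_right hH (by linarith)
    linarith
  have h4 : X * X - 1 ≤ 2 * κ * H / g * X := by
    rw [div_mul_eq_mul_div, le_div_iff₀ hg]
    rw [mul_div_assoc', div_le_iff₀ (by positivity)] at h3
    linarith
  -- From X² - 1 ≤ cX with X ≥ 1: if X > 1 + c, then X² - cX > X ≥ 1.
  have h5 : X ≤ 1 + 2 * κ * H / g := by
    have : 0 ≤ 2 * κ * H / g := by positivity
    by_contra! hcon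
    nlinarith
  rw [← Real.log_exp (κ * (b - a))]
  exact Real.log_le_log (Real.exp_pos _) h5

lemma log_one_add_div_le {C ε : ℝ} (hC : 0 ≤ C) (hε : 0 < ε) (hε1 : ε < 1) :
    Real.log (1 + C / ε) ≤ Real.log (1 + C) + |Real.log ε| := by
  rw [abs_of_neg (Real.log_neg hε hε1), ← sub_eq_add_neg, ← Real.log_div (by positivity) hε.ne']
  apply Real.log_le_log (by positivity)
  rw [add_div]
  gcongr
  rw [le_div_iff₀ hε]; linarith

lemma tendsto_mul_log_one_add_div (C : ℝ) (hC : 0 ≤ C) :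
    Tendsto (fun ε : ℝ => ε * Real.log (1 + C / ε)) (𝓝[>] 0) (𝓝 0) := by
  have h0 : Tendsto (fun ε : ℝ => ε) (𝓝[>] 0) (𝓝 0) := nhdsWithin_le_nhds
  have h1 : Tendsto (fun ε : ℝ => ε * (Real.log (1 + C) + |Real.log ε|)) (𝓝[>] 0) (𝓝 0) := by
    have h2 := (Real.continuous_mul_log.tendsto 0).mono_left
      (nhdsWithin_le_nhds (s := Ioi (0 : ℝ)))
    have h3 := (h0.mul_const (Real.log (1 + C))).add h2.abs
    simp only [zero_mul, abs_zero, add_zero] at h3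
    refine h3.congr' ?_
    filter_upwards [self_mem_nhdsWithin] with ε hε
    rw [abs_mul, abs_of_pos hε]; ring
  refine squeeze_zero' ?_ ?_ h1
  · filter_upwards [self_mem_nhdsWithin] with ε hε
    have hε : 0 < ε := hε
    exact mul_nonneg hε.le (Real.log_nonneg (by have : 0 ≤ C / ε := by positivity
                                                linarith))
  · filter_upwards [Ioo_mem_nhdsGT one_pos] with ε hε
    exact mul_le_mul_of_nonneg_left (log_one_add_div_le hC hε.1 hε.2) hε.1.le

/-! ### Departure time from the upper root. -/

section Departure

variable {lam : ℝ}

/-- Near the upper root, a solution with a critical point at distance at least `L ε` from the root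
falls below `midLevel` within time `O(ε |log ε|)`, in both time directions. -/
theorem exists_departure_bound (h : lambda0 < lam) : ∃ L ε0 k C : ℝ, 0 < L ∧ 0 < ε0 ∧ 0 < k ∧ 0 < C ∧
    ∀ (ε : ℝ) (u : ℝ → ℝ), 0 < ε → ε < ε0 → IsSolution lam ε u →
      Function.Periodic u (2 * Real.pi) → ∀ T, deriv u T = 0 → L * ε ≤ upperRoot lam T - u T →
        ∀ σ ℓ : ℝ, σ ^ 2 = 1 → 0 ≤ ℓ → (∀ z ∈ Icc 0 ℓ, midLevel lam ≤ u (T + σ * z)) →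
          k * ℓ ≤ ε * Real.log (1 + C / ε) := by
  obtain ⟨D, hD, hbd⟩ := exists_bound_derivs (contDiff_upperRoot h) (periodic_upperRoot h)
  have hk := levelRate_pos h
  have hr := rate_pos h
  set k2 := levelRate lam
  set k := √k2 with hkdef
  have hk0 : 0 < k := Real.sqrt_pos.2 hk
  have hksq : k ^ 2 = k2 := Real.sq_sqrt hk.le
  set b := upperRoot lam Real.pi
  have hb : 0 < b := (inflection_pos h).trans (inflection_lt_upperRoot h _)
  set C0 := D / (3 * upperRoot lam 0 ^ 2 - lam)
  have hC0 : 0 < C0 := by positivity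
  set D1 := 3 * b ^ 2 * C0 + D
  have hD1 : 0 < D1 := by positivity
  -- Growth is applied to Ū - u - D1ε²/k2. In L, the summand 1 absorbs the correction, which is at
  -- most ε for ε < k2/D1; the summand (D + 1)/k makes (k/ε) times the height at least D + 1,
  -- beating the slope |Ū'| ≤ D. The height never exceeds 2b, hence 4kb.
  refine ⟨1 + (D + 1) / k, k2 / D1, k, 4 * k * b, by positivity, by positivity, hk0, by positivity,
    ?_⟩
  intro ε u hε hε0 hu hp T hT hL σ ℓ hσ hℓ hlev
  have hub := hu.abs_le_upperRoot_pi h hε hp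
  have hAb : ∀ x, 0 < upperRoot lam x ∧ upperRoot lam x ≤ b := fun x =>
    ⟨(inflection_pos h).trans (inflection_lt_upperRoot h x), upperRoot_le_pi h x⟩
  obtain ⟨w1, w2, w3⟩ := hasDerivAt_sub_root hu.1 (contDiff_upperRoot h)
  obtain ⟨g1, g2, g3⟩ := deriv_affine w1 (-1) T σ
  set f : ℝ → ℝ := fun z => -1 * (u (T + σ * z) - upperRoot lam (T + σ * z)) with hf
  have hfd : ∀ z, HasDerivAt (fun z => f z - D1 * ε ^ 2 / k2) (deriv f z) z := fun z =>
    (g1.hasDerivAt_real z).sub_const _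
  have hfdd := g1.hasDerivAt_deriv_real
  obtain ⟨h1, h2, h3⟩ := contDiff_two_of_hasDerivAt hfd hfdd
    (g1.contDiff_one_deriv.continuous_deriv le_rfl)
  have hεD : D1 * ε ^ 2 / k2 ≤ ε := by
    rw [div_le_iff₀ hk]
    rw [lt_div_iff₀ hD1] at hε0
    nlinarith
  have hf0 : f 0 = upperRoot lam T - u T := by simp [hf]
  have hLk : (1 + (D + 1) / k) * ε = ε + (D + 1) / k * ε := by ring
  have hf0' : (D + 1) / k * ε ≤ f 0 - D1 * ε ^ 2 / k2 := by
    rw [hf0]; linarith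
  have key := time_le_of_growth (h := fun z => f z - D1 * ε ^ 2 / k2) (a := 0) (b := ℓ)
    (κ := k / ε) (g := 1) (H := 2 * b) hℓ (by positivity) one_pos h1 ?_ ?_ ?_ ?_ (by positivity)
  · rw [sub_zero, div_mul_eq_mul_div, div_le_iff₀ hε] at key
    refine key.trans (le_of_eq ?_)
    rw [mul_comm]; congr 3
    field_simp
    ring
  · intro z hz
    rw [h3, g3, hσ, div_pow, hksq, div_mul_eq_mul_div, div_le_iff₀ (by positivity)]
    have e1 := hu.sub_upperRoot h (T + σ * z)
    have e2 := hbd (T + σ * z)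
    have e3 := levelRate_le h (x := T + σ * z) (hlev z hz)
    have e4 := hu.le_upperRoot_add h hε hp (fun t => (hbd t).2.2) (T + σ * z)
    change k2 ≤ _ at e3
    change _ ≤ _ + C0 * ε ^ 2 at e4
    have e5 := hub (T + σ * z)
    have e6 := hAb (T + σ * z)
    set U := u (T + σ * z)
    set A := upperRoot lam (T + σ * z)
    have e7 : U ^ 2 + U * A + A ^ 2 - lam ≤ 3 * b ^ 2 := by
      have := lam_pos h
      have h5 := abs_le.1 e5
      change -b ≤ U ∧ U ≤ b at h5
      nlinarith
    set q := U ^ 2 + U * A + A ^ 2 - lam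
    have hfz : f z = -1 * (U - A) := rfl
    -- If u exceeds Ū, it does so by at most C0ε², so the wrong sign of A - U costs only 3b²C0ε²,
    -- included in D1.
    have e8 : k2 * (A - U) - 3 * b ^ 2 * (C0 * ε ^ 2) ≤ q * (A - U) := by
      rcases le_or_gt 0 (A - U) with h5 | h5
      · have := mul_le_mul_of_nonneg_right e3 h5
        have : 0 ≤ 3 * b ^ 2 * (C0 * ε ^ 2) := by positivity
        linarith
      · have a1 : q * (U - A) ≤ 3 * b ^ 2 * (U - A) := mul_le_mul_of_nonneg_right e7 (by linarith)
        have a2 : 3 * b ^ 2 * (U - A) ≤ 3 * b ^ 2 * (C0 * ε ^ 2) :=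
          mul_le_mul_of_nonneg_left (by linarith) (by positivity)
        have a3 : 0 ≤ k2 * (U - A) := mul_nonneg hk.le (by linarith)
        linarith
    have e9 : -D * ε ^ 2 ≤ ε ^ 2 * deriv (deriv (upperRoot lam)) (T + σ * z) := by
      nlinarith [(abs_le.1 e2.2.2).1, sq_nonneg ε]
    have e10 : k2 * (D1 * ε ^ 2 / k2) = D1 * ε ^ 2 := by field_simp
    have e11 : D1 * ε ^ 2 = 3 * b ^ 2 * (C0 * ε ^ 2) + D * ε ^ 2 := by ring
    have e12 : deriv (deriv fun t => u t - upperRoot lam t) (T + σ * z) * ε ^ 2 =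
      q * (U - A) - ε ^ 2 * deriv (deriv (upperRoot lam)) (T + σ * z) := by rw [mul_comm]; exact e1
    simp only [hfz]
    linarith
  · exact le_trans (by positivity) hf0'
  · rw [h2]
    have e1 : deriv f 0 = -1 * σ * (deriv u T - deriv (upperRoot lam) T) := by
      rw [g2, w2]; simp
    have e2 : -D ≤ deriv f 0 := by
      rw [e1, hT]
      have hσ' : σ = 1 ∨ σ = -1 := by
        rcases mul_eq_zero.1 (show (σ - 1) * (σ + 1) = 0 by linear_combination hσ) with h5 | h5
        · left; linarith
        · right; linarith
      have := abs_le.1 (hbd T).2.1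
      rcases hσ' with rfl | rfl <;> linarith
    have e3 : D + 1 ≤ k / ε * (f 0 - D1 * ε ^ 2 / k2) := by
      calc D + 1 = k / ε * ((D + 1) / k * ε) := by field_simp
        _ ≤ _ := mul_le_mul_of_nonneg_left hf0' (by positivity)
    linarith
  · have e1 := abs_le.1 (hub (T + σ * ℓ))
    have e2 := hAb (T + σ * ℓ)
    have e3 : 0 ≤ D1 * ε ^ 2 / k2 := by positivity
    have hfz : f ℓ = -1 * (u (T + σ * ℓ) - upperRoot lam (T + σ * ℓ)) := rfl
    simp only [hfz]
    change -b ≤ _ ∧ _ at e1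
    linarith [e1.1]

end Departure

/-! ### The energy relative to the upper root -/

section UpperEnergy

variable {lam ε : ℝ} {u : ℝ → ℝ}

noncomputable def upperEnergy (lam ε : ℝ) (u : ℝ → ℝ) (x : ℝ) : ℝ :=
  (ε * deriv u x) ^ 2 / 2 -
    (potential lam (Real.cos x) (u x) - potential lam (Real.cos x) (upperRoot lam x))

lemma hasDerivAt_potential (lam : ℝ) {g : ℝ → ℝ} {g' x : ℝ} (hg : HasDerivAt g g' x) :
    HasDerivAt (fun x => potential lam (Real.cos x) (g x))
      ((g x ^ 3 - lam * g x + Real.cos x) * g' - Real.sin x * g x) x := by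
  have h1 := (((hg.pow 4).div_const 4).sub (((hg.pow 2).const_mul lam).div_const 2)).add
    ((Real.hasDerivAt_cos x).mul hg)
  refine h1.congr_deriv ?_
  push_cast; ring

/-- Only the explicit time dependence of the potential survives. Thus the energy decreases on (0, π)
as long as u lies below Ū. -/
lemma hasDerivAt_upperEnergy (h : lambda0 < lam) (hu : IsSolution lam ε u) (x : ℝ) :
    HasDerivAt (upperEnergy lam ε u) ((u x - upperRoot lam x) * Real.sin x) x := by
  have h1 := (((hu.1.hasDerivAt_deriv_real x).const_mul ε).pow 2).div_const 2
  have h2 := hasDerivAt_potential lam (hu.1.hasDerivAt_real x)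
  have h3 := hasDerivAt_potential lam ((contDiff_upperRoot h).hasDerivAt_real x)
  refine (h1.sub (h2.sub h3)).congr_deriv ?_
  push_cast
  linear_combination deriv u x * hu.2 x + deriv (upperRoot lam) x * upperRoot_cubic h x

lemma potential_sub_upper (h : lambda0 < lam) (x y : ℝ) :
    potential lam (Real.cos x) y - potential lam (Real.cos x) (upperRoot lam x) =
      (y - upperRoot lam x) ^ 2 *
        ((y + upperRoot lam x) ^ 2 + 2 * lowerRoot lam x * middleRoot lam x) / 4 := by
  rw [upperRoot_eq h, potential_sub_top h (abs_cos_le x), lowerRoot_eq h, middleRoot_eq h]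
  obtain ⟨-, h2⟩ := topRoot_vieta h (abs_cos_le x)
  have hA := topRoot_pos h (abs_cos_le x)
  set A := topRoot lam (Real.cos x)
  set B := topRoot lam (-Real.cos x)
  have h3 : 2 * Real.cos x / A = 2 * B * (B - A) := by rw [h2]; field_simp
  rw [h3]; ring

/-- With A the upper, B the lower and M the middle root, u + A ≥ M + A = -B > 0. So the second
factor is at least B(B + 2M) = B(M - A) > 0. -/
lemma upperEnergy_nonpos (h : lambda0 < lam) {x : ℝ} (hx : deriv u x = 0)
    (h1 : middleRoot lam x ≤ u x) : upperEnergy lam ε u x ≤ 0 := by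
  unfold upperEnergy
  rw [hx, potential_sub_upper h]
  have h2 := lowerRoot_lt_middleRoot h x
  have h3 := middleRoot_lt_upperRoot h x
  have h4 := middleRoot_eq_neg_add h x
  have h5 := inflection_pos h
  have h6 := inflection_lt_upperRoot h x
  have h7 : lowerRoot lam x < 0 := (lowerRoot_lt_neg_midLevel h x).trans
    (by linarith [midLevel_pos h])
  set A := upperRoot lam x
  set B := lowerRoot lam x
  set M := middleRoot lam x
  have h8 : 0 ≤ (u x + A) ^ 2 + 2 * B * M := by
    have : -B ≤ u x + A := by linarith
    nlinarith
  have : 0 ≤ (u x - A) ^ 2 * ((u x + A) ^ 2 + 2 * B * M) := by positivity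
  nlinarith

/-- A descent below `midLevel` during a time of order `ε` pushes the next maximum away from
the upper root. -/
lemma energy_drop (h : lambda0 < lam) (hε : 0 < ε) (hu : IsSolution lam ε u)
    (hp : Function.Periodic u (2 * Real.pi)) {C a b c d : ℝ}
    (hC : ∀ x, u x ≤ upperRoot lam x + C * ε ^ 2) (hC0 : 0 ≤ C) (ha : 0 ≤ a) (hab : a ≤ b)
    (hbc : b ≤ c) (hcd : c ≤ d) (hd : d ≤ Real.pi) (hc2 : c ≤ 2) (hda : deriv u a = 0)
    (hma : middleRoot lam a ≤ u a) (hdd : deriv u d = 0)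
    (hlow : ∀ x ∈ Icc b c, u x ≤ midLevel lam) :
    (upperRoot lam 0 - midLevel lam) * (b / 4) * (c - b) - 2 * C * ε ^ 2 ≤
      (upperRoot lam d - u d) ^ 2 * (2 * upperRoot lam Real.pi ^ 2) := by
  -- The term Cε² cos x compensates for u possibly exceeding Ū by Cε², so that G is monotone on all
  -- of [0, π].
  set G : ℝ → ℝ := fun x => upperEnergy lam ε u x + C * ε ^ 2 * Real.cos x with hG
  have hGd : ∀ x, HasDerivAt G ((u x - upperRoot lam x - C * ε ^ 2) * Real.sin x) x := fun x =>
    ((hasDerivAt_upperEnergy h hu x).add ((Real.hasDerivAt_cos x).const_mul _)).congr_deriv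
      (by ring)
  have hanti : AntitoneOn G (Icc 0 Real.pi) := by
    apply antitoneOn_of_deriv_nonpos (convex_Icc _ _)
    · exact fun x _ => (hGd x).continuousAt.continuousWithinAt
    · exact fun x _ => (hGd x).differentiableAt.differentiableWithinAt
    · intro x hx
      rw [(hGd x).deriv]
      have hx := interior_subset hx
      exact mul_nonpos_of_nonpos_of_nonneg (by linarith [hC x])
        (Real.sin_nonneg_of_nonneg_of_le_pi hx.1 hx.2)
  have e1 : G b ≤ G a := hanti ⟨ha, by linarith⟩ ⟨by linarith, by linarith⟩ hab
  have e2 : G d ≤ G c := hanti ⟨by linarith, by linarith⟩ ⟨by linarith, hd⟩ hcd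
  have hgap : 0 < upperRoot lam 0 - midLevel lam := by linarith [midLevel_lt_upperRoot h 0]
  have e3 : G c - G b ≤ -((upperRoot lam 0 - midLevel lam) * (b / 4)) * (c - b) := by
    refine (convex_Icc b c).image_sub_le_mul_sub_of_deriv_le
      (fun x _ => (hGd x).continuousAt.continuousWithinAt)
      (fun x _ => (hGd x).differentiableAt.differentiableWithinAt) (fun x hx => ?_) b
      (left_mem_Icc.2 hbc) c (right_mem_Icc.2 hbc) hbc
    have hx := interior_subset hx
    rw [(hGd x).deriv]
    have a1 : b / 4 ≤ Real.sin x := by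
      have := quarter_le_sin (x := x) (by linarith [hx.1]) (by linarith [hx.2])
      linarith [hx.1]
    have a2 : upperRoot lam 0 - midLevel lam ≤ -(u x - upperRoot lam x - C * ε ^ 2) := by
      have : 0 ≤ C * ε ^ 2 := by positivity
      linarith [hlow x hx, upperRoot_zero_le h x]
    have := mul_le_mul a2 a1 (by linarith : 0 ≤ b / 4) (hgap.le.trans a2)
    linarith
  have e4 := upperEnergy_nonpos (ε := ε) h hda hma
  have e5 : G a ≤ C * ε ^ 2 := by
    have := mul_le_mul_of_nonneg_left (Real.cos_le_one a) (by positivity : 0 ≤ C * ε ^ 2)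
    simp only [hG]; linarith
  have e6 : upperEnergy lam ε u d - C * ε ^ 2 ≤ G d := by
    have := mul_le_mul_of_nonneg_left (Real.neg_one_le_cos d) (by positivity : 0 ≤ C * ε ^ 2)
    simp only [hG]; linarith
  have e7 : upperEnergy lam ε u d = -((u d - upperRoot lam d) ^ 2 *
      ((u d + upperRoot lam d) ^ 2 + 2 * lowerRoot lam d * middleRoot lam d) / 4) := by
    unfold upperEnergy
    rw [hdd, potential_sub_upper h]; ring
  have e8 : (u d + upperRoot lam d) ^ 2 + 2 * lowerRoot lam d * middleRoot lam d ≤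
      8 * upperRoot lam Real.pi ^ 2 := by
    have a1 := abs_le.1 (hu.abs_le_upperRoot_pi h hε hp d)
    have a2 := upperRoot_le_pi h d
    have a3 := (inflection_pos h).trans (inflection_lt_upperRoot h d)
    have a4 := upperRoot_le_pi h (Real.pi - d)
    rw [upperRoot_pi_sub h] at a4
    have a5 : lowerRoot lam d < 0 := (lowerRoot_lt_neg_midLevel h d).trans
      (by linarith [midLevel_pos h])
    have a6 := (abs_middleRoot_lt h d).le.trans (inflection_lt_upperRoot h Real.pi).le
    have a7 : lowerRoot lam d * middleRoot lam d ≤ upperRoot lam Real.pi ^ 2 := by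
      calc _ ≤ |lowerRoot lam d * middleRoot lam d| := le_abs_self _
        _ = |lowerRoot lam d| * |middleRoot lam d| := abs_mul _ _
        _ ≤ upperRoot lam Real.pi * upperRoot lam Real.pi :=
          mul_le_mul (by rw [abs_of_neg a5]; exact a4) a6 (abs_nonneg _) (a3.le.trans a2)
        _ = _ := by ring
    have a8 : (u d + upperRoot lam d) ^ 2 ≤ (2 * upperRoot lam Real.pi) ^ 2 :=
      sq_le_sq' (by linarith [a1.1]) (by linarith [a1.2])
    linarith [sq_nonneg (upperRoot lam Real.pi)]
  have e9 := mul_le_mul_of_nonneg_left e8 (sq_nonneg (u d - upperRoot lam d))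
  have e10 : (u d - upperRoot lam d) ^ 2 = (upperRoot lam d - u d) ^ 2 := by ring
  rw [e10] at e7 e9
  linarith

end UpperEnergy

/-! ### Location of the interior extrema -/

lemma exists_crossing_of_antitone {f : ℝ → ℝ} {a b ρ : ℝ} (hf : Continuous f) (hab : a ≤ b)
    (h1 : ρ ≤ f a) (h2 : f b ≤ ρ) : ∃ x ∈ Icc a b, f x = ρ :=
  intermediate_value_Icc' hab hf.continuousOn ⟨h2, h1⟩

lemma exists_crossing_of_monotone {f : ℝ → ℝ} {a b ρ : ℝ} (hf : Continuous f) (hab : a ≤ b)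
    (h1 : f a ≤ ρ) (h2 : ρ ≤ f b) : ∃ x ∈ Icc a b, f x = ρ :=
  intermediate_value_Icc hab hf.continuousOn ⟨h1, h2⟩

lemma IsAdmissible.nonconst_of_level {lam α : ℝ} {v : ℝ → ℝ} (h : lambda0 < lam)
    (hv : IsAdmissible lam (Real.cos α) v) {ρ : ℝ} (hρ1 : lowerRoot lam α < ρ)
    (hρ2 : ρ < upperRoot lam α) (h0 : v 0 = ρ) : ¬∀ τ, v τ = v 0 := by
  intro hc
  rw [lowerRoot_eq h] at hρ1
  rw [upperRoot_eq h] at hρ2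
  rcases hv.const_cases h (abs_cos_le α) hc with h1 | h1 <;> linarith

lemma lowerRoot_lt_midLevel {lam : ℝ} (h : lambda0 < lam) (x : ℝ) :
    lowerRoot lam x < midLevel lam :=
  (lowerRoot_lt_neg_midLevel h x).trans (by linarith [midLevel_pos h])

section Family

variable {ι : Type*} {𝓤 : Ultrafilter ι} {lam α : ℝ} {m : ℕ} {ε : ι → ℝ} {u : ι → ℝ → ℝ}
  {t s : ι → ℕ → ℝ} {a b : ι → ℝ} {v : ℝ → ℝ}

lemma IsWindow.eq_of_level (hv : IsWindow 𝓤 lam ε u a α v) {ρ : ℝ}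
    (h : ∀ᶠ i in 𝓤, u i (a i) = ρ) : v 0 = ρ :=
  tendsto_nhds_unique hv.pos_zero (tendsto_const_nhds.congr' (h.mono fun _ hi => hi.symm))

namespace LayerFamily

/-- The direction σ = -1 bounds how long before T the solution can stay above `midLevel`, and σ = 1
how long after. -/
lemma departure_tendsto_zero (h : lambda0 < lam) (F : LayerFamily 𝓤 lam m ε u t s) {T ℓ : ι → ℝ}
    {σ : ℝ} (hσ : σ ^ 2 = 1) (hT : ∀ᶠ i in 𝓤, deriv (u i) (T i) = 0)
    (hL : ∀ L > 0, ∀ᶠ i in 𝓤, L * ε i ≤ upperRoot lam (T i) - u i (T i))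
    (hℓ : ∀ᶠ i in 𝓤, 0 ≤ ℓ i)
    (hlev : ∀ᶠ i in 𝓤, ∀ z ∈ Icc 0 (ℓ i), midLevel lam ≤ u i (T i + σ * z)) :
    Tendsto ℓ 𝓤 (𝓝 0) := by
  obtain ⟨L, ε0, k, C, hL0, hε0, hk, hC, key⟩ := exists_departure_bound h
  have h1 : Tendsto ε 𝓤 (𝓝[>] 0) :=
    tendsto_nhdsWithin_iff.2 ⟨F.lim, F.pos⟩
  have h2 := ((tendsto_mul_log_one_add_div C hC.le).comp h1).div_const k
  rw [zero_div] at h2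
  refine tendsto_of_tendsto_of_tendsto_of_le_of_le' tendsto_const_nhds h2 hℓ ?_
  filter_upwards [F.pos, F.layer, F.lim.eventually_lt_const hε0, hT, hL L hL0, hℓ, hlev]
    with i e1 e2 e3 e4 e5 e6 e7
  rw [le_div_iff₀ hk, mul_comm]
  exact key (ε i) (u i) e1 e3 e2.isSolution e2.periodic (T i) e4 e5 σ (ℓ i) hσ e6 e7

/-- After an excursion below `midLevel` around a minimum not beyond `π / 2`, the next maximum is
far from the upper root on the scale `ε`. -/
theorem far_from_upper (h : lambda0 < lam) (F : LayerFamily 𝓤 lam m ε u t s) {j : ℕ} (h1 : 1 ≤ j)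
    (h2 : j < m) (hs : ∀ᶠ i in 𝓤, s i j ≤ 7 / 4) (L : ℝ) (hL : 0 < L) :
    ∀ᶠ i in 𝓤, L * ε i ≤ upperRoot lam (t i (j + 1)) - u i (t i (j + 1)) := by
  obtain ⟨D, hD, hbd⟩ := exists_bound_derivs (contDiff_upperRoot h) (periodic_upperRoot h)
  have hr := rate_pos h
  set C := D / (3 * upperRoot lam 0 ^ 2 - lam)
  have hC : 0 < C := by positivity
  set b := upperRoot lam Real.pi
  have hb : 0 < b := (inflection_pos h).trans (inflection_lt_upperRoot h _)
  set P := velocityBound lam b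
  have hP : 0 < P := velocityBound_pos (u := fun _ => 0) fun _ => by simpa using hb.le
  -- At a minimum u is below the inflection value, so the velocity bound P keeps it below `midLevel`
  -- for a fast time c0.
  set c0 := (midLevel lam - √(lam / 3)) / P
  have hc0 : 0 < c0 := div_pos (by linarith [inflection_lt_midLevel h]) hP
  set d := upperRoot lam 0 - midLevel lam
  have hd : 0 < d := by have := midLevel_lt_upperRoot h 0; simp only [d]; linarith
  have hc0P : P * c0 = midLevel lam - √(lam / 3) := by simp only [c0]; field_simp
  -- With s_j ≥ Nε, the drop d (s_j/4) c0 ε dominates 2b²(Lε)² plus the error 2Cε².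
  set N := 4 * (2 * b ^ 2 * L ^ 2 + 2 * C) / (d * c0) with hN
  filter_upwards [F.pos, F.layer, (F.tendsto_s_div h h1 h2).eventually_ge_atTop N, hs,
    F.lim.eventually_lt_const (show 0 < d / L by positivity),
    F.lim.eventually_lt_const (show 0 < 1 / (4 * c0) by positivity)] with i e1 e2 e3 e4 e5 e6
  have hub := e2.isSolution.abs_le_upperRoot_pi h e1 e2.periodic
  have hsb := (e2.s_bounds h e1 h1 h2).2
  have hM := (abs_lt.1 (abs_middleRoot_lt h (s i j))).2
  have hst := e2.s_lt_t h1 h2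
  have hlow : ∀ x ∈ Icc (s i j) (s i j + ε i * c0), u i x ≤ midLevel lam := by
    intro x hx
    have a1 := abs_position_sub_le e1 e2.isSolution hub (s i j) ((x - s i j) / ε i)
    rw [mul_div_cancel₀ _ e1.ne', add_sub_cancel, abs_div, abs_of_pos e1,
      abs_of_nonneg (show 0 ≤ x - s i j by linarith [hx.1])] at a1
    have a2 : (x - s i j) / ε i ≤ c0 := by rw [div_le_iff₀ e1]; linarith [hx.2]
    have a3 := mul_le_mul_of_nonneg_left a2 hP.le
    have a4 := (le_abs_self _).trans (a1.trans a3)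
    rw [hc0P] at a4
    linarith
  rcases le_or_gt (s i j + ε i * c0) (t i (j + 1)) with hcase | hcase
  · have a1 : s i j + ε i * c0 ≤ 2 := by
      rw [lt_div_iff₀ (by positivity)] at e6
      linarith
    have a2 := energy_drop h e1 e2.isSolution e2.periodic (C := C)
      (e2.isSolution.le_upperRoot_add h e1 e2.periodic fun x => (hbd x).2.2) hC.le
      (e2.t_pos h1 h2.le).le (e2.t_lt_s h1 h2).le
      (by have : 0 ≤ ε i * c0 := by positivity
          linarith) hcase (e2.t_mem (by omega) h2).1.2 a1 (e2.deriv_t h1 h2.le)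
      (e2.middleRoot_le_t h e1 h1 h2.le) (e2.deriv_t (by omega) h2) hlow
    change d * (s i j / 4) * _ - _ ≤ _ * (2 * b ^ 2) at a2
    have a3 := e2.t_le_upperRoot h e1 (by omega : 1 ≤ j + 1) h2
    rw [le_div_iff₀ e1, hN, div_mul_eq_mul_div, div_le_iff₀ (by positivity)] at e3
    have a4 := mul_le_mul_of_nonneg_right e3 e1.le
    have a5 : (L * ε i) ^ 2 * (2 * b ^ 2) ≤
        (upperRoot lam (t i (j + 1)) - u i (t i (j + 1))) ^ 2 * (2 * b ^ 2) := by linarith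
    have a6 := le_of_mul_le_mul_right a5 (by positivity)
    exact (pow_le_pow_iff_left₀ (by positivity) (by linarith) two_ne_zero).1 a6
  -- The maximum comes before the excursion is over, so it is still below `midLevel` and at distance
  -- at least d from Ū.
  · have a1 := hlow (t i (j + 1)) ⟨hst.le, hcase.le⟩
    have a2 := upperRoot_zero_le h (t i (j + 1))
    rw [lt_div_iff₀ hL] at e5
    have : d ≤ upperRoot lam (t i (j + 1)) - u i (t i (j + 1)) := by simp only [d]; linarith
    linarith

/-- Before `π / 2`, a descent through `midLevel` is followed immediately by a minimum. -/
lemma tendsto_s_of_descent (h : lambda0 < lam) (F : LayerFamily 𝓤 lam m ε u t s) {j : ℕ}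
    (h1 : 1 ≤ j) (h2 : j < m) {x : ι → ℝ}
    (hx : ∀ᶠ i in 𝓤, x i ∈ Icc (t i j) (s i j) ∧ u i (x i) = midLevel lam)
    (hxα : Tendsto x 𝓤 (𝓝 α)) (hα : α < Real.pi / 2) :
    Tendsto (fun i => s i j) 𝓤 (𝓝 α) := by
  have hmem : ∀ᶠ i in 𝓤, x i ∈ Icc 0 Real.pi := by
    filter_upwards [F.layer, hx] with i e1 e2
    exact ⟨(e1.t_pos h1 h2.le).le.trans e2.1.1, e2.1.2.trans (e1.s_lt_pi h1 h2).le⟩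
  obtain ⟨α', hα', v, hv, hadm⟩ := F.exists_window h hmem
  obtain rfl : α' = α := tendsto_nhds_unique hv.base hxα
  have hcos : 0 < Real.cos α' := Real.cos_pos_of_mem_Ioo ⟨by linarith [hα'.1, Real.pi_pos], hα⟩
  have hv0 := hv.eq_of_level (hx.mono fun i hi => hi.2)
  have hne := hadm.nonconst_of_level h (lowerRoot_lt_midLevel h _) (midLevel_lt_upperRoot h _) hv0
  have hlim := hadm.tendsto_top_of_pos h (abs_cos_le _) hcos hne
  rw [← upperRoot_eq h] at hlim
  -- If s_j were infinitely far in fast time, the limit would be nonincreasing from `midLevel` on,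
  -- yet it must tend to Ū(α).
  rcases tendsto_atTop_or_exists_tendsto (𝓤 := 𝓤) (g := fun i => (s i j - x i) / ε i) (by
    filter_upwards [F.pos, hx] with i e1 e2
    exact div_nonneg (by linarith [e2.1.2]) e1.le) with hgap | ⟨y, -, hy⟩
  · exfalso
    have hle : ∀ σ, 0 ≤ σ → v σ ≤ midLevel lam := fun σ hσ => by
      rw [← hv0]
      refine hv.le_of_antitoneOn F.pos (l := fun i => t i j) (r := fun i => s i j)
        (F.layer.mono fun i hi => (hi.strictAntiOn h1 h2).antitoneOn) hσ ?_
        (eventually_add_le F.pos hgap σ)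
      filter_upwards [hx] with i e1
      simpa using e1.1.1
    have := le_of_tendsto hlim ((eventually_ge_atTop 0).mono fun σ hσ => hle σ hσ)
    linarith [midLevel_lt_upperRoot h α']
  · refine (tendsto_add_mul F.lim hxα hy).congr' ?_
    filter_upwards [F.pos] with i e1
    rw [mul_div_cancel₀ _ e1.ne', add_sub_cancel]

/-- A constant limit would be the lower root, reached after a descent through -`midLevel` that is
infinitely far in fast time. The limit around that crossing stays below -`midLevel` afterwards,
although at a time before π/2 it must tend to the upper root. -/
lemma nonconst_of_s_tendsto (h : lambda0 < lam) (F : LayerFamily 𝓤 lam m ε u t s) {j : ℕ}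
    (h1 : 1 ≤ j) (h2 : j < m) (hv : IsWindow 𝓤 lam ε u (fun i => s i j) α v)
    (hadm : IsAdmissible lam (Real.cos α) v) (hα : α < Real.pi / 2) : ¬∀ τ, v τ = v 0 := by
  intro hc
  have hv0 : v 0 = lowerRoot lam α := by
    have e1 : v 0 ≤ middleRoot lam α := by
      refine le_of_tendsto_of_tendsto hv.pos_zero
        (((contDiff_middleRoot h).continuous.tendsto α).comp hv.base) ?_
      filter_upwards [F.pos, F.layer] with i e1 e2 using (e2.s_bounds h e1 h1 h2).2
    rcases hadm.const_cases h (abs_cos_le α) hc with h3 | h3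
    · rw [← upperRoot_eq h] at h3
      linarith [middleRoot_lt_upperRoot h α]
    · rw [h3, lowerRoot_eq h]
  have hex : ∀ᶠ i in 𝓤, ∃ x, x ∈ Icc (t i j) (s i j) ∧ u i x = -midLevel lam := by
    filter_upwards [F.pos, F.layer, hv.pos_zero.eventually_lt_const
      (by rw [hv0]; exact lowerRoot_lt_neg_midLevel h α)] with i e1 e2 e3
    exact exists_crossing_of_antitone e2.isSolution.1.continuous (e2.t_lt_s h1 h2).le
      ((neg_midLevel_lt_middleRoot h _).le.trans (e2.middleRoot_le_t h e1 h1 h2.le)) e3.le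
  obtain ⟨x, hx⟩ := hex.choice
  have hgap : Tendsto (fun i => (s i j - x i) / ε i) 𝓤 atTop := by
    refine (hv.tendsto_gap_of_const F.pos hc (ρ := -midLevel lam) ?_
      (hx.mono fun i hi => hi.2)).congr' ?_
    · rw [hv0]; exact (lowerRoot_lt_neg_midLevel h α).ne'
    · filter_upwards [hx] with i e1
      rw [abs_sub_comm, abs_of_nonneg (by linarith [e1.1.2])]
  have hmem : ∀ᶠ i in 𝓤, x i ∈ Icc 0 Real.pi := by
    filter_upwards [F.layer, hx] with i e1 e2
    exact ⟨(e1.t_pos h1 h2.le).le.trans e2.1.1, e2.1.2.trans (e1.s_lt_pi h1 h2).le⟩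
  obtain ⟨β, hβ, w, hw, hwadm⟩ := F.exists_window h hmem
  have hβα : β ≤ α := le_of_tendsto_of_tendsto hw.base hv.base (hx.mono fun i hi => hi.1.2)
  have hcos : 0 < Real.cos β :=
    Real.cos_pos_of_mem_Ioo ⟨by linarith [hβ.1, Real.pi_pos], by linarith⟩
  have hw0 := hw.eq_of_level (hx.mono fun i hi => hi.2)
  have hne := hwadm.nonconst_of_level h (lowerRoot_lt_neg_midLevel h _)
    (by linarith [midLevel_lt_upperRoot h β, midLevel_pos h]) hw0
  have hlim := hwadm.tendsto_top_of_pos h (abs_cos_le _) hcos hne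
  have hle : ∀ σ, 0 ≤ σ → w σ ≤ -midLevel lam := fun σ hσ => by
    rw [← hw0]
    refine hw.le_of_antitoneOn F.pos (l := fun i => t i j) (r := fun i => s i j)
      (F.layer.mono fun i hi => (hi.strictAntiOn h1 h2).antitoneOn) hσ ?_
      (eventually_add_le F.pos hgap σ)
    filter_upwards [hx] with i e1
    simpa using e1.1.1
  have := le_of_tendsto hlim ((eventually_ge_atTop 0).mono fun σ hσ => hle σ hσ)
  linarith [midLevel_pos h, topRoot_pos h (abs_cos_le β)]

/-- A minimum before `π / 2` forces another one at the same limit. -/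
lemma next_minimum (h : lambda0 < lam) (F : LayerFamily 𝓤 lam m ε u t s) {j : ℕ}
    (h1 : 1 ≤ j) (h2 : j < m) (hs : Tendsto (fun i => s i j) 𝓤 (𝓝 α)) (hα : α < Real.pi / 2) :
    j + 1 < m ∧ Tendsto (fun i => s i (j + 1)) 𝓤 (𝓝 α) := by
  have hmem : ∀ᶠ i in 𝓤, s i j ∈ Icc 0 Real.pi :=
    F.layer.mono fun i hi => ⟨(hi.s_pos h1 h2).le, (hi.s_lt_pi h1 h2).le⟩
  obtain ⟨α', hα', v, hv, hadm⟩ := F.exists_window h hmem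
  obtain rfl : α' = α := tendsto_nhds_unique hv.base hs
  have hcos : 0 < Real.cos α' := Real.cos_pos_of_mem_Ioo ⟨by linarith [hα'.1, Real.pi_pos], hα⟩
  have hne := F.nonconst_of_s_tendsto h h1 h2 hv hadm hα
  have hlim := hadm.tendsto_top_of_pos h (abs_cos_le _) hcos hne
  rw [← upperRoot_eq h] at hlim
  obtain ⟨τ, hτ, hτ0⟩ := ((hlim.eventually_const_lt (midLevel_lt_upperRoot h α')).and
    (eventually_ge_atTop 0)).exists
  have hgap := hv.tendsto_gap F.solution F.lim hadm hne (b := fun i => t i (j + 1))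
    (F.layer.mono fun i hi => hi.deriv_s h1 h2)
    (F.layer.mono fun i hi => hi.deriv_t (by omega) h2)
    (F.layer.mono fun i hi => hi.s_lt_t h1 h2)
  have hy : ∀ᶠ i in 𝓤, s i j + ε i * τ ≤ t i (j + 1) := eventually_add_le F.pos hgap τ
  have huy : ∀ᶠ i in 𝓤, midLevel lam < u i (s i j + ε i * τ) :=
    (hv.pos_at τ).eventually_const_lt hτ
  have hyα : Tendsto (fun i => s i j + ε i * τ) 𝓤 (𝓝 α') :=
    tendsto_add_mul F.lim hs tendsto_const_nhds
  have hs74 : ∀ᶠ i in 𝓤, s i j ≤ 7 / 4 :=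
    (hs.eventually_lt_const (by linarith [Real.pi_lt_d2] : α' < 7 / 4)).mono fun i hi => hi.le
  have hfar := F.far_from_upper h h1 h2 hs74
  have hT : ∀ᶠ i in 𝓤, deriv (u i) (t i (j + 1)) = 0 :=
    F.layer.mono fun i hi => hi.deriv_t (by omega) h2
  have hlev : ∀ᶠ i in 𝓤, ∀ x ∈ Icc (s i j + ε i * τ) (t i (j + 1)), midLevel lam < u i x := by
    filter_upwards [F.pos, F.layer, hy, huy] with i e1 e2 e3 e4
    intro x hx
    have e5 : 0 ≤ ε i * τ := mul_nonneg e1.le hτ0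
    exact e4.trans_le ((e2.strictMonoOn h1 h2).monotoneOn ⟨by linarith, e3⟩
      ⟨by linarith [hx.1], hx.2⟩ hx.1)
  -- Backward departure brings t_(j+1) to the same limit as s_j; forward departure below then brings
  -- the next descent there too.
  have hℓ := F.departure_tendsto_zero h (T := fun i => t i (j + 1))
    (ℓ := fun i => t i (j + 1) - (s i j + ε i * τ)) (σ := -1) (by norm_num) hT hfar
    (hy.mono fun i hi => by linarith) (by
      filter_upwards [hlev] with i e1 z hz
      exact (e1 _ ⟨by linarith [hz.2], by linarith [hz.1]⟩).le)
  have htα : Tendsto (fun i => t i (j + 1)) 𝓤 (𝓝 α') := by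
    have := hyα.add hℓ
    simpa using this
  have hjm : j + 1 < m := by
    refine lt_of_le_of_ne h2 fun he => ?_
    have : α' = Real.pi := tendsto_nhds_unique htα (tendsto_const_nhds.congr'
      (F.layer.mono fun i hi => by simp only [he]; exact hi.last_eq.symm))
    linarith [Real.pi_pos]
  refine ⟨hjm, ?_⟩
  have hex : ∀ᶠ i in 𝓤, ∃ x, x ∈ Icc (t i (j + 1)) (s i (j + 1)) ∧ u i x = midLevel lam := by
    filter_upwards [F.pos, F.layer, hy, hlev] with i e1 e2 e3 e4
    exact exists_crossing_of_antitone e2.isSolution.1.continuous (e2.t_lt_s (by omega) hjm).le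
      (e4 _ ⟨e3, le_rfl⟩).le ((e2.s_bounds h e1 (by omega) hjm).2.trans
        (middleRoot_lt_midLevel h _).le)
  obtain ⟨x, hx⟩ := hex.choice
  have hℓ' := F.departure_tendsto_zero h (T := fun i => t i (j + 1))
    (ℓ := fun i => x i - t i (j + 1)) (σ := 1) (by norm_num) hT hfar
    (hx.mono fun i hi => by linarith [hi.1.1]) (by
      filter_upwards [F.layer, hx] with i e1 e2 z hz
      rw [← e2.2]
      exact (e1.strictAntiOn (by omega) hjm).antitoneOn
        ⟨by linarith [hz.1], by linarith [hz.2, e2.1.2]⟩ e2.1 (by linarith [hz.2]))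
  have hxα : Tendsto x 𝓤 (𝓝 α') := by
    have := htα.add hℓ'
    simpa using this
  exact F.tendsto_s_of_descent h (by omega) hjm hx hxα hα

/-- Each minimum before π/2 produces another with the same limit, but only finitely many indices are
available; the induction runs over m - j. -/
theorem pi_div_two_le_of_s (h : lambda0 < lam) (F : LayerFamily 𝓤 lam m ε u t s) {j : ℕ}
    (h1 : 1 ≤ j) (h2 : j < m) (hs : Tendsto (fun i => s i j) 𝓤 (𝓝 α)) : Real.pi / 2 ≤ α := by
  by_contra! hα
  obtain ⟨k, hk⟩ : ∃ k, j + k = m := ⟨m - j, by omega⟩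
  induction k generalizing j with
  | zero => omega
  | succ k ih =>
    obtain ⟨e1, e2⟩ := F.next_minimum h h1 h2 hs hα
    exact ih (by omega) e1 e2 (by omega)

/-- If there is an interior minimum, the solution does not stay near the upper root at `π`. -/
theorem pi_lt_sqrt (h : lambda0 < lam) (F : LayerFamily 𝓤 lam m ε u t s) (hm : 2 ≤ m) :
    ∀ᶠ i in 𝓤, u i Real.pi < √lam := by
  by_contra hcon
  rw [← Ultrafilter.eventually_not] at hcon
  have hge : ∀ᶠ i in 𝓤, √lam ≤ u i Real.pi := hcon.mono fun i hi => not_lt.1 hi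
  have h1 : 1 ≤ m - 1 := by omega
  have h2 : m - 1 < m := by omega
  have hm1 : m - 1 + 1 = m := by omega
  obtain ⟨α, -, v, hv, hadm⟩ := F.exists_window h (a := fun _ => Real.pi)
    (Eventually.of_forall fun _ => right_mem_Icc.2 Real.pi_pos.le)
  obtain rfl : α = Real.pi := tendsto_nhds_unique hv.base tendsto_const_nhds
  have hd := hv.deriv_zero_eq (F.layer.mono fun i hi => hi.deriv_pi)
  have hv0 : √lam ≤ v 0 := ge_of_tendsto hv.pos_zero hge
  have hsq : midLevel lam < √lam := by
    rw [← upperRoot_pi_div_two h]; exact midLevel_lt_upperRoot h _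
  have hc : ∀ τ, v τ = v 0 := by
    by_contra hne
    have e1 := hadm.critical_value_of_neg h (abs_cos_le _)
      (by rw [Real.cos_pi]; norm_num) hne hd
    rw [Real.cos_pi, neg_neg] at e1
    have e2 : topRoot lam 1 < √lam := by
      rw [← upperRoot_pi_div_two h, upperRoot_eq h, Real.cos_pi_div_two]
      exact topRoot_strictAnti h (by norm_num) (by norm_num) one_pos
    have e3 := Real.sqrt_nonneg (2 * 1 / topRoot lam 1)
    unfold turningPoint at e1
    linarith
  have hex : ∀ᶠ i in 𝓤, ∃ y, y ∈ Icc (s i (m - 1)) Real.pi ∧ u i y = midLevel lam := by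
    filter_upwards [F.pos, F.layer, hge] with i e1 e2 e3
    exact exists_crossing_of_monotone e2.isSolution.1.continuous (e2.s_lt_pi h1 h2).le
      ((e2.s_bounds h e1 h1 h2).2.trans (middleRoot_lt_midLevel h _).le) (hsq.le.trans e3)
  obtain ⟨y, hy⟩ := hex.choice
  have hgap : Tendsto (fun i => (Real.pi - y i) / ε i) 𝓤 atTop := by
    refine (hv.tendsto_gap_of_const F.pos hc (ρ := midLevel lam) (by linarith)
      (hy.mono fun i hi => hi.2)).congr' ?_
    filter_upwards [hy] with i e1
    rw [abs_sub_comm, abs_of_nonneg (by linarith [e1.1.2])]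
  have hmem : ∀ᶠ i in 𝓤, y i ∈ Icc 0 Real.pi := by
    filter_upwards [F.layer, hy] with i e1 e2
    exact ⟨(e1.s_pos h1 h2).le.trans e2.1.1, e2.1.2⟩
  obtain ⟨β, hβ, w, hw, hwadm⟩ := F.exists_window h hmem
  have hw0 := hw.eq_of_level (hy.mono fun i hi => hi.2)
  have hne := hwadm.nonconst_of_level h (lowerRoot_lt_midLevel h _) (midLevel_lt_upperRoot h _) hw0
  have hge' : ∀ σ, 0 ≤ σ → midLevel lam ≤ w σ := fun σ hσ => by
    rw [← hw0]
    refine hw.le_of_monotoneOn F.pos (l := fun i => s i (m - 1)) (r := fun i => Real.pi)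
      ?_ hσ ?_ (eventually_add_le F.pos hgap σ)
    · filter_upwards [F.layer] with i hi
      have := (hi.strictMonoOn h1 h2).monotoneOn
      rwa [hm1, hi.last_eq] at this
    · filter_upwards [hy] with i e1
      simpa using e1.1.1
  -- After π/2 a nonconstant limit falls to the lower root, which is incompatible with staying above
  -- `midLevel`. Then the last minimum is also early, and backward departure from π would put the
  -- crossing at π.
  have hβ2 : β ≤ Real.pi / 2 := by
    by_contra! hβ2
    have hcos : Real.cos β < 0 :=
      Real.cos_neg_of_pi_div_two_lt_of_lt hβ2 (by linarith [hβ.2, Real.pi_pos])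
    have hlim := hwadm.tendsto_bot_of_neg h (abs_cos_le _) hcos hne
    have := ge_of_tendsto hlim ((eventually_ge_atTop 0).mono fun σ hσ => hge' σ hσ)
    linarith [midLevel_pos h, topRoot_pos h (abs_neg_le (abs_cos_le β))]
  have hs74 : ∀ᶠ i in 𝓤, s i (m - 1) ≤ 7 / 4 := by
    filter_upwards [hy, hw.base.eventually_lt_const
      (by linarith [Real.pi_lt_d2] : β < 7 / 4)] with i e1 e2
    exact e1.1.1.trans e2.le
  have hfar := F.far_from_upper h h1 h2 hs74
  rw [hm1] at hfar
  have hℓ := F.departure_tendsto_zero h (T := fun i => t i m) (ℓ := fun i => Real.pi - y i)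
    (σ := -1) (by norm_num) (F.layer.mono fun i hi => hi.deriv_t (by omega) le_rfl) hfar
    (hy.mono fun i hi => by linarith [hi.1.2]) (by
      filter_upwards [F.layer, hy] with i e1 e2 z hz
      rw [← e2.2, e1.last_eq]
      have := (e1.strictMonoOn h1 h2).monotoneOn
      rw [hm1, e1.last_eq] at this
      exact this e2.1 ⟨by linarith [hz.2, e2.1.1], by linarith [hz.1]⟩ (by linarith [hz.2]))
  have : Real.pi - β = 0 := tendsto_nhds_unique (tendsto_const_nhds.sub hw.base) hℓ
  linarith [Real.pi_pos]

/-- The sign of the turning value gives u(0) < 0 for small ε, and `pi_lt_sqrt` gives the condition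
at π. -/
theorem reflect (h : lambda0 < lam) (hturn : turningPoint lam 1 < 0)
    (F : LayerFamily 𝓤 lam m ε u t s) (hm : 2 ≤ m) :
    LayerFamily 𝓤 lam m ε (fun i => ForcedDuffing.reflect (u i))
      (fun i => IsLayerSolution.reflectMax m (s i)) (fun i => IsLayerSolution.reflectMin m (t i)) := by
  refine ⟨F.pos, F.lim, ?_⟩
  obtain ⟨v, hv, -, -, -, hv0, -⟩ := F.window_zero h
  rw [← hv0] at hturn
  filter_upwards [F.pos, F.layer, F.pi_lt_sqrt h hm, hv.pos_zero.eventually_lt_const hturn]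
    with i e1 e2 e3 e4
  exact e2.reflect h e1 hm e4 e3

/-- An interior maximum of u is a minimum of the reflected solution, so this is the bound for minima
seen in the mirror. -/
theorem t_le_pi_div_two (h : lambda0 < lam) (hturn : turningPoint lam 1 < 0)
    (F : LayerFamily 𝓤 lam m ε u t s) {j : ℕ} (h1 : 1 ≤ j) (h2 : j < m)
    (ht : Tendsto (fun i => t i j) 𝓤 (𝓝 α)) : α ≤ Real.pi / 2 := by
  have h3 := (F.reflect h hturn (by omega)).pi_div_two_le_of_s h (j := m - j) (α := Real.pi - α)
    (by omega) (by omega) (by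
      have e : ∀ i, IsLayerSolution.reflectMin m (t i) (m - j) = Real.pi - t i j := fun i => by
        simp only [IsLayerSolution.reflectMin, show m - (m - j) = j by omega]
      simp_rw [e]
      exact tendsto_const_nhds.sub ht)
  linarith

/-- If t_1 → α' < π/2, then u(t_1) → Ū(α'), and u cannot descend through `midLevel` before π/2,
since s_1 would follow. At a time θ in between, the decreasing u is at most Ū(α') < Ū(θ), so its
limit is nonconstant and would have to rise to Ū(θ). -/
theorem pi_div_two_le_of_t (h : lambda0 < lam) (F : LayerFamily 𝓤 lam m ε u t s) (hm : 2 ≤ m)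
    (ht : Tendsto (fun i => t i 1) 𝓤 (𝓝 α)) : Real.pi / 2 ≤ α := by
  by_contra! hα
  have h1 : 1 ≤ 1 := le_rfl
  have h2 : 1 < m := by omega
  have hmem : ∀ᶠ i in 𝓤, t i 1 ∈ Icc 0 Real.pi :=
    F.layer.mono fun i hi => Ioc_subset_Icc_self (hi.t_mem h1 h2.le).1
  obtain ⟨α', hα', v, hv, hadm⟩ := F.exists_window h hmem
  obtain rfl : α' = α := tendsto_nhds_unique hv.base ht
  have hcos : 0 < Real.cos α' := Real.cos_pos_of_mem_Ioo ⟨by linarith [hα'.1, Real.pi_pos], hα⟩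
  have hd := hv.deriv_zero_eq (F.layer.mono fun i hi => hi.deriv_t h1 h2.le)
  have hmid : middleRoot lam α' ≤ v 0 := by
    refine le_of_tendsto_of_tendsto
      (((contDiff_middleRoot h).continuous.tendsto α').comp hv.base) hv.pos_zero ?_
    filter_upwards [F.pos, F.layer] with i e1 e2 using e2.middleRoot_le_t h e1 h1 h2.le
  have hc : ∀ τ, v τ = v 0 := by
    by_contra hne
    have e1 := hadm.critical_value_of_pos h (abs_cos_le _) hcos hne hd
    have e2 : turningPoint lam (Real.cos α') < middleRoot lam α' := by
      obtain ⟨-, a2⟩ := topRoot_vieta h (abs_cos_le α')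
      have a3 := topRoot_pos h (abs_cos_le α')
      have a4 := topRoot_pos h (abs_neg_le (abs_cos_le α'))
      have a5 := topRoot_neg_lt_two_mul h (abs_cos_le α')
      rw [middleRoot_eq h]
      unfold turningPoint
      set A := topRoot lam (Real.cos α')
      set B := topRoot lam (-Real.cos α')
      have a6 : 2 * Real.cos α' / A = 2 * B * (B - A) := by rw [a2]; field_simp
      have a7 : √(2 * B * (B - A)) < B := by
        rw [Real.sqrt_lt' a4]; nlinarith
      rw [a6]; linarith
    linarith
  have hv0 : v 0 = upperRoot lam α' := by
    rcases hadm.const_cases h (abs_cos_le α') hc with h3 | h3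
    · rw [h3, upperRoot_eq h]
    · rw [← lowerRoot_eq h] at h3
      linarith [lowerRoot_lt_middleRoot h α']
  have hex : ∀ᶠ i in 𝓤, ∃ x, x ∈ Icc (t i 1) (s i 1) ∧ u i x = midLevel lam := by
    filter_upwards [F.pos, F.layer, hv.pos_zero.eventually_const_lt
      (by rw [hv0]; exact midLevel_lt_upperRoot h α')] with i e1 e2 e3
    exact exists_crossing_of_antitone e2.isSolution.1.continuous (e2.t_lt_s h1 h2).le e3.le
      ((e2.s_bounds h e1 h1 h2).2.trans (middleRoot_lt_midLevel h _).le)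
  obtain ⟨x, hx⟩ := hex.choice
  have hxmem : ∀ᶠ i in 𝓤, x i ∈ Icc 0 Real.pi := by
    filter_upwards [F.layer, hx] with i e1 e2
    exact ⟨(e1.t_pos h1 h2.le).le.trans e2.1.1, e2.1.2.trans (e1.s_lt_pi h1 h2).le⟩
  obtain ⟨β, hβ, hxβ⟩ := exists_tendsto_of_bounded hxmem
  have hβ2 : Real.pi / 2 ≤ β := by
    by_contra! hβ2
    have := F.pi_div_two_le_of_s h h1 h2 (F.tendsto_s_of_descent h h1 h2 hx hxβ hβ2)
    linarith
  set θ := (α' + Real.pi / 2) / 2 with hθ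
  have hθ1 : α' < θ := by rw [hθ]; linarith
  have hθ2 : θ < Real.pi / 2 := by rw [hθ]; linarith
  have hθmem : θ ∈ Icc 0 Real.pi := ⟨by linarith [hα'.1], by linarith [Real.pi_pos]⟩
  obtain ⟨θ', -, w, hw, hwadm⟩ := F.exists_window h (a := fun _ => θ)
    (Eventually.of_forall fun _ => hθmem)
  obtain rfl : θ' = θ := tendsto_nhds_unique hw.base tendsto_const_nhds
  have hcos' : 0 < Real.cos θ :=
    Real.cos_pos_of_mem_Ioo ⟨by linarith [hα'.1, Real.pi_pos], hθ2⟩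
  have hb : ∀ τ : ℝ, Tendsto (fun i => θ + ε i * τ) 𝓤 (𝓝 θ) := fun τ =>
    tendsto_add_mul F.lim tendsto_const_nhds tendsto_const_nhds
  have hin : ∀ τ : ℝ, ∀ᶠ i in 𝓤, t i 1 ≤ θ + ε i * τ ∧ θ + ε i * τ ≤ x i := fun τ => by
    filter_upwards [ht.eventually_lt (hb τ) hθ1, (hb τ).eventually_lt hxβ (by linarith)]
      with i e1 e2 using ⟨e1.le, e2.le⟩
  have hanti : ∀ τ σ, τ ≤ σ → w σ ≤ w τ := fun τ σ hτσ => by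
    refine hw.le_of_antitoneOn F.pos (l := fun i => t i 1) (r := fun i => s i 1)
      (F.layer.mono fun i hi => (hi.strictAntiOn h1 h2).antitoneOn) hτσ
      ((hin τ).mono fun i hi => hi.1) ?_
    filter_upwards [hin σ, hx] with i e1 e2 using e1.2.trans e2.1.2
  have hw1 : midLevel lam ≤ w 0 := by
    refine ge_of_tendsto (hw.pos_at 0) ?_
    filter_upwards [F.layer, hin 0, hx] with i e1 e2 e3
    rw [← e3.2]
    exact (e1.strictAntiOn h1 h2).antitoneOn ⟨e2.1, e2.2.trans e3.1.2⟩ e3.1 e2.2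
  have hw2 : w 0 ≤ upperRoot lam α' := by
    refine le_of_tendsto_of_tendsto (hw.pos_at 0)
      (((contDiff_upperRoot h).continuous.tendsto α').comp ht) ?_
    filter_upwards [F.pos, F.layer, hin 0, hx] with i e0 e1 e2 e3
    exact ((e1.strictAntiOn h1 h2).antitoneOn (left_mem_Icc.2 (e1.t_lt_s h1 h2).le)
      ⟨e2.1, e2.2.trans e3.1.2⟩ e2.1).trans (e1.t_le_upperRoot h e0 h1 h2.le)
  have hw3 : upperRoot lam α' < upperRoot lam θ := upperRoot_strictMono h hα' hθmem hθ1
  have hne := hwadm.nonconst_of_level h (ρ := w 0)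
    ((lowerRoot_lt_midLevel h _).trans_le hw1) (hw2.trans_lt hw3) rfl
  have hlim := hwadm.tendsto_top_of_pos h (abs_cos_le _) hcos' hne
  rw [← upperRoot_eq h] at hlim
  have := le_of_tendsto hlim ((eventually_ge_atTop 0).mono fun σ hσ => hanti 0 σ hσ)
  linarith

theorem tendsto_t (h : lambda0 < lam) (hturn : turningPoint lam 1 < 0)
    (F : LayerFamily 𝓤 lam m ε u t s) {j : ℕ} (h1 : 1 ≤ j) (h2 : j < m) :
    Tendsto (fun i => t i j) 𝓤 (𝓝 (Real.pi / 2)) := by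
  have hlim : ∀ k, 1 ≤ k → k < m → ∃ α, Tendsto (fun i => t i k) 𝓤 (𝓝 α) := fun k hk hkm => by
    obtain ⟨α, -, hα⟩ := exists_tendsto_of_bounded (𝓤 := 𝓤) (g := fun i => t i k) (a := 0)
      (b := Real.pi) (F.layer.mono fun i hi => Ioc_subset_Icc_self (hi.t_mem hk hkm.le).1)
    exact ⟨α, hα⟩
  obtain ⟨α, hα⟩ := hlim j h1 h2
  obtain ⟨β, hβ⟩ := hlim 1 le_rfl (by omega)
  have e1 := F.t_le_pi_div_two h hturn h1 h2 hα
  have e2 := F.pi_div_two_le_of_t h (by omega) hβ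
  have e3 : β ≤ α :=
    le_of_tendsto_of_tendsto hβ hα (F.layer.mono fun i hi => hi.t_le_t le_rfl h1 h2.le)
  rwa [show Real.pi / 2 = α by linarith]

/-- At π/2 nonconstant limits have no critical point, so the limit at t_j is constant, and u(t_j) ≥
U₀(t_j) selects the upper root. -/
theorem tendsto_u_t (h : lambda0 < lam) (hturn : turningPoint lam 1 < 0)
    (F : LayerFamily 𝓤 lam m ε u t s) {j : ℕ} (h1 : 1 ≤ j) (h2 : j < m) :
    Tendsto (fun i => u i (t i j)) 𝓤 (𝓝 (upperRoot lam (Real.pi / 2))) := by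
  obtain ⟨α, -, v, hv, hadm⟩ := F.exists_window h (a := fun i => t i j)
    (F.layer.mono fun i hi => Ioc_subset_Icc_self (hi.t_mem h1 h2.le).1)
  obtain rfl : α = Real.pi / 2 := tendsto_nhds_unique hv.base (F.tendsto_t h hturn h1 h2)
  have hd := hv.deriv_zero_eq (F.layer.mono fun i hi => hi.deriv_t h1 h2.le)
  have hmid : middleRoot lam (Real.pi / 2) ≤ v 0 := by
    refine le_of_tendsto_of_tendsto
      (((contDiff_middleRoot h).continuous.tendsto _).comp hv.base) hv.pos_zero ?_
    filter_upwards [F.pos, F.layer] with i e1 e2 using e2.middleRoot_le_t h e1 h1 h2.le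
  have hc : ∀ τ, v τ = v 0 := by
    by_contra hne
    rw [Real.cos_pi_div_two] at hadm
    exact hadm.not_critical_of_zero h hne 0 hd
  convert hv.pos_zero using 2
  rcases hadm.const_cases h (abs_cos_le _) hc with h3 | h3
  · rw [h3, upperRoot_eq h]
  · rw [← lowerRoot_eq h] at h3
    linarith [lowerRoot_lt_middleRoot h (Real.pi / 2)]

lemma reflectMax_apply {m j : ℕ} (h1 : 1 ≤ j) (h2 : j < m) (s : ℕ → ℝ) :
    IsLayerSolution.reflectMax m s (m - j) = Real.pi - s j := by
  simp only [IsLayerSolution.reflectMax, show m - (m - j) = j by omega,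
    show m - j ≠ m by omega, if_false]

theorem tendsto_s (h : lambda0 < lam) (hturn : turningPoint lam 1 < 0)
    (F : LayerFamily 𝓤 lam m ε u t s) {j : ℕ} (h1 : 1 ≤ j) (h2 : j < m) :
    Tendsto (fun i => s i j) 𝓤 (𝓝 (Real.pi / 2)) := by
  have := (F.reflect h hturn (by omega)).tendsto_t h hturn (j := m - j) (by omega) (by omega)
  simp_rw [reflectMax_apply h1 h2] at this
  have h3 := (tendsto_const_nhds (x := Real.pi)).sub this
  simp only [sub_sub_cancel] at h3
  rwa [show Real.pi - Real.pi / 2 = Real.pi / 2 by ring] at h3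

theorem tendsto_u_s (h : lambda0 < lam) (hturn : turningPoint lam 1 < 0)
    (F : LayerFamily 𝓤 lam m ε u t s) {j : ℕ} (h1 : 1 ≤ j) (h2 : j < m) :
    Tendsto (fun i => u i (s i j)) 𝓤 (𝓝 (lowerRoot lam (Real.pi / 2))) := by
  have := (F.reflect h hturn (by omega)).tendsto_u_t h hturn (j := m - j) (by omega) (by omega)
  simp_rw [reflectMax_apply h1 h2] at this
  have h3 := this.neg
  simp only [ForcedDuffing.reflect, neg_neg, sub_sub_cancel] at h3
  rwa [← lowerRoot_pi_sub h, show Real.pi - Real.pi / 2 = Real.pi / 2 by ring] at h3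

end LayerFamily

end Family

/-! ### Solutions above the inflection point follow the upper root -/

/-- A lower bound for the difference quotient of the force above the inflection point. -/
noncomputable def convexRate (lam : ℝ) : ℝ :=
  √(lam / 3) ^ 2 + √(lam / 3) * upperRoot lam 0 + upperRoot lam 0 ^ 2 - lam

section Convex

variable {lam ε : ℝ} {u : ℝ → ℝ}

lemma convexRate_pos (h : lambda0 < lam) : 0 < convexRate lam := by
  have h2 := inflection_lt_upperRoot h 0
  have h3 := inflection_sq h
  have h4 := inflection_pos h
  unfold convexRate
  nlinarith

lemma convexRate_le (h : lambda0 < lam) {x y : ℝ} (hy : √(lam / 3) ≤ y) :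
    convexRate lam ≤ y ^ 2 + y * upperRoot lam x + upperRoot lam x ^ 2 - lam := by
  have h1 := inflection_pos h
  have h2 := inflection_lt_upperRoot h 0
  have h3 := upperRoot_zero_le h x
  unfold convexRate
  nlinarith

/-- The exponential barrier is applied to u - Ū and to its negative, both subsolutions with rate
√(`convexRate`)/ε where u is above the inflection value. -/
theorem IsSolution.abs_sub_upperRoot_le (h : lambda0 < lam) (hε : 0 < ε) (hu : IsSolution lam ε u)
    {D B a b : ℝ} (hD : ∀ t, |deriv (deriv (upperRoot lam)) t| ≤ D)
    (ha : |u a - upperRoot lam a| ≤ B) (hb : |u b - upperRoot lam b| ≤ B)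
    (hab : ∀ t ∈ Icc a b, √(lam / 3) ≤ u t) :
    ∀ t ∈ Icc a b, |u t - upperRoot lam t| ≤ D / convexRate lam * ε ^ 2 +
      B * (Real.exp (-(√(convexRate lam) / ε * (t - a))) +
        Real.exp (-(√(convexRate lam) / ε * (b - t)))) := by
  intro t ht
  have hk := convexRate_pos h
  set k := convexRate lam
  have hD0 : 0 ≤ D := (abs_nonneg _).trans (hD 0)
  have hB0 : 0 ≤ B := (abs_nonneg _).trans ha
  have hκ : 0 < √k / ε := div_pos (Real.sqrt_pos.2 hk) hε
  have hκ2 : (√k / ε) ^ 2 = k / ε ^ 2 := by rw [div_pow, Real.sq_sqrt hk.le]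
  obtain ⟨w1, w2, w3⟩ := hasDerivAt_sub_root hu.1 (contDiff_upperRoot h)
  have key : ∀ σ : ℝ, σ ^ 2 = 1 → σ * (u t - upperRoot lam t) ≤ D / k * ε ^ 2 +
      B * (Real.exp (-(√k / ε * (t - a))) + Real.exp (-(√k / ε * (b - t)))) := by
    intro σ hσ
    have hσ1 : |σ| = 1 := by rw [← sq_eq_sq₀ (abs_nonneg _) zero_le_one, sq_abs, hσ, one_pow]
    obtain ⟨g1, -, g3⟩ := deriv_affine w1 σ 0 1
    simp only [zero_add, one_mul, one_pow, mul_one] at g1 g3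
    have hend : ∀ x, |u x - upperRoot lam x| ≤ B → σ * (u x - upperRoot lam x) ≤ B := fun x hx => by
      refine (le_abs_self _).trans ?_
      rwa [abs_mul, hσ1, one_mul]
    have := le_barrier hκ hD0 hB0 g1 (hend a ha) (hend b hb) (fun x hx hpos => by
      have e1 := hu.sub_upperRoot h x
      have e2 := convexRate_le h (x := x) (hab x ⟨hx.1.le, hx.2.le⟩)
      have e3 := mul_le_mul_of_nonneg_right e2 hpos.le
      have e4 : σ * deriv (deriv (upperRoot lam)) x ≤ D := by
        refine (le_abs_self _).trans ?_
        rw [abs_mul, hσ1, one_mul]; exact hD x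
      rw [g3, hκ2, div_mul_eq_mul_div, sub_le_iff_le_add, div_le_iff₀ (by positivity)]
      have e5 := mul_le_mul_of_nonneg_right e4 (sq_nonneg ε)
      change k * _ ≤ _ at e3
      linear_combination e3 + e5 - σ * e1) t ht
    rw [hκ2, div_div_eq_mul_div] at this
    convert this using 2
    · ring
    · simp only [neg_mul]
  rw [abs_le']
  constructor
  · simpa using key 1 (by norm_num)
  · simpa using key (-1) (by norm_num)

/-- A bound of order `ε²` for the deviation implies one of order `ε` for its derivative. -/
theorem IsSolution.abs_deriv_sub_upperRoot_le (h : lambda0 < lam) (hε : 0 < ε)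
    (hu : IsSolution lam ε u) {b C D x : ℝ} (hD : ∀ t, |deriv (deriv (upperRoot lam)) t| ≤ D)
    (hb : upperRoot lam Real.pi ≤ b)
    (hw : ∀ t, |t - x| ≤ ε → |u t| ≤ b ∧ |u t - upperRoot lam t| ≤ C * ε ^ 2) :
    |deriv u x - deriv (upperRoot lam) x| ≤ (2 * C + (3 * b ^ 2 + lam) * C + D) * ε := by
  obtain ⟨w1, w2, w3⟩ := hasDerivAt_sub_root hu.1 (contDiff_upperRoot h)
  set w : ℝ → ℝ := fun t => u t - upperRoot lam t with hwdef
  rw [← w2]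
  obtain ⟨ξ, hξ, he⟩ := exists_slope_mul w1.hasDerivAt_real x ε
  obtain ⟨ζ, hζ, he'⟩ := exists_slope_mul w1.hasDerivAt_deriv_real x (ξ - x)
  rw [abs_of_pos hε] at hξ
  rw [add_sub_cancel] at he'
  have hlam := lam_pos h
  have e1 : |deriv w ξ| ≤ 2 * C * ε := by
    have a1 := (hw (x + ε) (by rw [add_sub_cancel_left, abs_of_pos hε])).2
    have a2 := (hw x (by simpa using hε.le)).2
    have a3 : |ε * deriv w ξ| ≤ 2 * C * ε ^ 2 := by
      rw [← he]
      refine (abs_sub _ _).trans ?_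
      linarith
    rw [abs_mul, abs_of_pos hε] at a3
    refine le_of_mul_le_mul_left (a3.trans (le_of_eq (by ring))) hε
  have e2 : |deriv (deriv w) ζ| ≤ (3 * b ^ 2 + lam) * C + D := by
    obtain ⟨a1, a2⟩ := hw ζ (hζ.trans hξ)
    have a3 := hu.sub_upperRoot h ζ
    have a4 : |upperRoot lam ζ| ≤ b := by
      rw [abs_of_pos ((inflection_pos h).trans (inflection_lt_upperRoot h _))]
      exact (upperRoot_le_pi h ζ).trans hb
    have a5 : |u ζ ^ 2 + u ζ * upperRoot lam ζ + upperRoot lam ζ ^ 2 - lam| ≤ 3 * b ^ 2 + lam := by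
      obtain ⟨b1, b2⟩ := abs_le.1 a1
      obtain ⟨b3, b4⟩ := abs_le.1 a4
      rw [abs_le]
      constructor
      · nlinarith [sq_nonneg (u ζ + upperRoot lam ζ)]
      · nlinarith
    have a6 : |ε ^ 2 * deriv (deriv w) ζ| ≤ (3 * b ^ 2 + lam) * (C * ε ^ 2) + ε ^ 2 * D := by
      rw [hwdef, a3]
      refine (abs_sub _ _).trans (add_le_add ?_ ?_)
      · rw [abs_mul]
        exact mul_le_mul a5 a2 (abs_nonneg _) (by positivity)
      · rw [abs_mul, abs_of_nonneg (sq_nonneg ε)]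
        exact mul_le_mul_of_nonneg_left (hD ζ) (sq_nonneg ε)
    rw [abs_mul, abs_of_nonneg (sq_nonneg ε)] at a6
    exact le_of_mul_le_mul_left (a6.trans (le_of_eq (by ring))) (by positivity : 0 < ε ^ 2)
  have e3 : |deriv w ξ - deriv w x| ≤ ε * ((3 * b ^ 2 + lam) * C + D) := by
    rw [he', abs_mul]
    exact mul_le_mul hξ e2 (abs_nonneg _) hε.le
  have e4 : deriv w x = deriv w ξ - (deriv w ξ - deriv w x) := by ring
  rw [e4]
  refine (abs_sub _ _).trans ?_
  linarith

end Convex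

lemma eventually_exp_neg_div_le {c : ℝ} (hc : 0 < c) :
    ∀ᶠ ε in 𝓝[>] (0 : ℝ), Real.exp (-(c / ε)) ≤ ε ^ 2 := by
  have h1 : Tendsto (fun ε : ℝ => c / ε) (𝓝[>] 0) atTop := by
    simp_rw [div_eq_mul_inv]
    exact tendsto_inv_nhdsGT_zero.const_mul_atTop hc
  have h2 := (Real.tendsto_pow_mul_exp_neg_atTop_nhds_zero 2).comp h1
  filter_upwards [h2.eventually_le_const (show 0 < c ^ 2 by positivity), self_mem_nhdsWithin]
    with ε e1 e2
  simp only [Function.comp_apply, div_pow] at e1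
  have hε : (0 : ℝ) < ε := e2
  rw [div_mul_eq_mul_div, div_le_iff₀ (by positivity)] at e1
  exact le_of_mul_le_mul_left e1 (by positivity : 0 < c ^ 2)

/-- Solutions above the inflection point are `O(ε²)`-close to the upper root in the interior. -/
theorem exists_upperRoot_estimate {lam : ℝ} (h : lambda0 < lam) :
    ∃ M > 0, ∀ μ > 0, ∃ ε₀ > 0, ∀ ε ∈ Ioo 0 ε₀, ∀ u, IsSolution lam ε u →
      (∀ t, |u t| ≤ upperRoot lam Real.pi) → ∀ a b, (∀ x ∈ Icc a b, √(lam / 3) ≤ u x) →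
        ∀ x ∈ Icc (a + μ) (b - μ), |u x - upperRoot lam x| +
          ε * |deriv u x - deriv (upperRoot lam) x| ≤ M * ε ^ 2 := by
  obtain ⟨D, hD, hbd⟩ := exists_bound_derivs (contDiff_upperRoot h) (periodic_upperRoot h)
  have hk := convexRate_pos h
  have hlam := lam_pos h
  set b0 := upperRoot lam Real.pi with hb0
  have hb : 0 < b0 := (inflection_pos h).trans (inflection_lt_upperRoot h _)
  -- The boundary deviation is at most 2b0 and each of the two exponentials is at most ε², whence
  -- 4b0.
  set C := D / convexRate lam + 4 * b0 with hC
  have hC0 : 0 < C := by positivity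
  refine ⟨C + (2 * C + (3 * b0 ^ 2 + lam) * C + D), by positivity, fun μ hμ => ?_⟩
  obtain ⟨ε₀, hε₀, hex⟩ := mem_nhdsGT_iff_exists_Ioo_subset.1
    (eventually_exp_neg_div_le (show 0 < √(convexRate lam) * (μ / 2) by
      have := Real.sqrt_pos.2 hk; positivity))
  -- With ε < μ/2, the points within ε of x, needed for the derivative bound, are still at distance
  -- μ/2 from the ends.
  refine ⟨min ε₀ (μ / 2), lt_min hε₀ (by positivity), fun ε hε u hu hub a b hab x hx => ?_⟩
  obtain ⟨hε1, hε2⟩ := hε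
  rw [lt_min_iff] at hε2
  have hexp := hex ⟨hε1, hε2.1⟩
  simp only [mem_ofPred_eq] at hexp
  have hend : ∀ t, |u t - upperRoot lam t| ≤ 2 * b0 := fun t => by
    refine (abs_sub _ _).trans ?_
    have := upperRoot_le_pi h t
    rw [abs_of_pos ((inflection_pos h).trans (inflection_lt_upperRoot h t))]
    linarith [hub t]
  have hdec : ∀ d, μ / 2 ≤ d → Real.exp (-(√(convexRate lam) / ε * d)) ≤ ε ^ 2 := fun d hd => by
    refine le_trans (Real.exp_le_exp.2 (neg_le_neg ?_)) hexp
    rw [div_mul_eq_mul_div]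
    gcongr
  have hnear : ∀ t, |t - x| ≤ ε → |u t - upperRoot lam t| ≤ C * ε ^ 2 := fun t ht => by
    obtain ⟨h1, h2⟩ := abs_le.1 ht
    have h3 := hu.abs_sub_upperRoot_le h hε1 (fun t => (hbd t).2.2) (hend a) (hend b) hab t
      ⟨by linarith [hx.1], by linarith [hx.2]⟩
    have h4 := hdec (t - a) (by linarith [hx.1])
    have h5 := hdec (b - t) (by linarith [hx.2])
    refine h3.trans ?_
    have h6 := mul_le_mul_of_nonneg_left (add_le_add h4 h5) (by positivity : 0 ≤ 2 * b0)
    rw [hC]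
    linarith
  have h1 := hu.abs_deriv_sub_upperRoot_le h hε1 (fun t => (hbd t).2.2) hb0.symm.le
    (fun t ht => ⟨hub t, hnear t ht⟩)
  have h2 := hnear x (by simpa using hε1.le)
  have h3 := mul_le_mul_of_nonneg_left h1 hε1.le
  linarith

/-- A statement about layer solutions that holds along all families with `ε → 0⁺` holds for all
small `ε`. -/
theorem exists_threshold {lam : ℝ} {m : ℕ} {P : ℝ → (ℝ → ℝ) → (ℕ → ℝ) → (ℕ → ℝ) → Prop}
    (H : ∀ (𝓤 : Ultrafilter ℕ) (ε : ℕ → ℝ) (u : ℕ → ℝ → ℝ) (t s : ℕ → ℕ → ℝ),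
      LayerFamily 𝓤 lam m ε u t s → ∀ᶠ i in 𝓤, P (ε i) (u i) (t i) (s i)) :
    ∃ ε₁ > (0 : ℝ), ∀ ε ∈ Ioo 0 ε₁, ∀ (u : ℝ → ℝ) (t s : ℕ → ℝ),
      IsLayerSolution lam ε m u t s → P ε u t s := by
  by_contra! hcon
  choose ε hε u t s hL hP using fun n : ℕ => hcon (1 / ((n : ℝ) + 1)) (by positivity)
  have hlim : Tendsto ε (hyperfilter ℕ) (𝓝 0) := by
    have h1 : Tendsto ε atTop (𝓝 0) :=
      squeeze_zero (fun n => (hε n).1.le) (fun n => (hε n).2.le)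
        tendsto_one_div_add_atTop_nhds_zero_nat
    exact h1.mono_left Nat.hyperfilter_le_atTop
  obtain ⟨i, hi⟩ := (H (hyperfilter ℕ) ε u t s ⟨Eventually.of_forall fun n => (hε n).1, hlim,
    Eventually.of_forall hL⟩).exists
  exact hP i hi

/-- Choose a counterexample for each index whenever one exists. This makes estimates uniform in an
auxiliary parameter by testing them along arbitrary choices. -/
lemma eventually_forall_of_choice {ι β : Type*} [Nonempty β] {l : Filter ι} {P : ι → β → Prop}
    (H : ∀ y : ι → β, ∀ᶠ i in l, P i (y i)) : ∀ᶠ i in l, ∀ y, P i y := by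
  classical
  have h1 : ∀ i, ∃ y, (∃ z, ¬P i z) → ¬P i y := fun i => by
    by_cases hz : ∃ z, ¬P i z
    · exact ⟨hz.choose, fun _ => hz.choose_spec⟩
    · exact ⟨Classical.arbitrary β, fun hz' => absurd hz' hz⟩
  choose y hy using h1
  filter_upwards [H y] with i hi z
  by_contra hz
  exact hy i ⟨z, hz⟩ hi

/-! ### Uniform convergence of profiles and the region near the upper root. -/

section Family

variable {ι : Type*} {𝓤 : Ultrafilter ι} {lam α : ℝ} {m : ℕ} {ε : ι → ℝ} {u : ι → ℝ → ℝ}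
  {t s : ι → ℕ → ℝ} {a : ι → ℝ} {v : ℝ → ℝ}

/-- Uniformity on [A, B] is tested along a choice θ i, which has a limit by compactness; choices
outside [A, B] satisfy the claim vacuously. -/
theorem IsWindow.eventually_profileGap_lt (hv : IsWindow 𝓤 lam ε u a α v) (A B : ℝ) {η : ℝ}
    (hη : 0 < η) : ∀ᶠ i in 𝓤, ∀ τ ∈ Icc A B, profileGap (ε i) (u i) v (a i) τ < η := by
  refine eventually_forall_of_choice fun θ => ?_
  by_cases hθ : ∀ᶠ i in 𝓤, θ i ∈ Icc A B
  · obtain ⟨τ, -, hτ⟩ := exists_tendsto_of_bounded hθ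
    have h1 := ((hv.pos hτ).sub ((hv.sol.1.continuous.tendsto τ).comp hτ)).abs.add
      ((hv.vel hτ).sub ((hv.sol.1.contDiff_one_deriv.continuous.tendsto τ).comp hτ)).abs
    simp only [sub_self, abs_zero, add_zero] at h1
    filter_upwards [h1.eventually_lt_const hη] with i hi _ using hi
  · rw [← Ultrafilter.eventually_not] at hθ
    filter_upwards [hθ] with i hi h1 using absurd h1 hi

namespace LayerFamily

/-- Near 0 the solution rises past the inflection value within O(ε), and it increases up to t_1,
which tends to π/2 or equals π when m = 1. -/
theorem inflection_le (h : lambda0 < lam) (hturn : turningPoint lam 1 < 0)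
    (F : LayerFamily 𝓤 lam m ε u t s) (hm : 1 ≤ m) {μ : ℝ} (hμ : 0 < μ) :
    ∀ᶠ i in 𝓤, ∀ x ∈ Icc μ (Real.pi / 2 - μ), √(lam / 3) ≤ u i x := by
  obtain ⟨v, hv, -, -, -, -, hlim⟩ := F.window_zero h
  obtain ⟨τ, hτ, hτ0⟩ := ((hlim.eventually_const_lt (inflection_lt_upperRoot h 0)).and
    (eventually_ge_atTop 0)).exists
  have ht : ∀ᶠ i in 𝓤, Real.pi / 2 - μ ≤ t i 1 := by
    rcases hm.eq_or_lt with rfl | hm'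
    · filter_upwards [F.layer] with i hi
      rw [hi.last_eq]; linarith [Real.pi_pos]
    · exact ((F.tendsto_t h hturn le_rfl hm').eventually_const_lt
        (by linarith : Real.pi / 2 - μ < Real.pi / 2)).mono fun i hi => hi.le
  have hb := tendsto_add_mul F.lim hv.base (tendsto_const_nhds (x := τ) (f := (𝓤 : Filter ι)))
  filter_upwards [F.pos, F.layer, ht, (hv.pos_at τ).eventually_const_lt hτ,
    hb.eventually_lt_const hμ] with i e1 e2 e3 e4 e5 x hx
  refine e4.le.trans ((e2.strictMonoOn_first hm).monotoneOn ⟨?_, ?_⟩ ⟨?_, ?_⟩ ?_)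
  · have := mul_nonneg e1.le hτ0; linarith
  · linarith [hx.1, hx.2]
  · linarith [hx.1]
  · linarith [hx.2]
  · linarith [hx.1]

end LayerFamily

end Family

/-- The constant is fixed before m and μ, so it depends on λ only. The estimate on the right half is
the reflected one. -/
theorem exists_root_estimate {lam : ℝ} (h : lambda0 < lam) (hturn : turningPoint lam 1 < 0) :
    ∃ M > (0 : ℝ), ∀ m : ℕ, 1 ≤ m → ∀ μ > (0 : ℝ), ∃ ε₁ > (0 : ℝ), ∀ ε ∈ Ioo 0 ε₁,
      ∀ (u : ℝ → ℝ) (t s : ℕ → ℝ), IsLayerSolution lam ε m u t s →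
        (∀ x ∈ Icc μ (Real.pi / 2 - μ),
          |u x - upperRoot lam x| + ε * |deriv u x - deriv (upperRoot lam) x| ≤ M * ε ^ 2) ∧
        (2 ≤ m → ∀ x ∈ Icc (Real.pi / 2 + μ) (Real.pi - μ),
          |u x - lowerRoot lam x| + ε * |deriv u x - deriv (lowerRoot lam) x| ≤ M * ε ^ 2) := by
  obtain ⟨M, hM, hest⟩ := exists_upperRoot_estimate h
  refine ⟨M, hM, fun m hm μ hμ => exists_threshold fun 𝓤 ε u t s F => ?_⟩
  obtain ⟨ε₀, hε₀, hest⟩ := hest (μ / 2) (by positivity)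
  have half : ∀ {u : ℕ → ℝ → ℝ} {t s : ℕ → ℕ → ℝ}, LayerFamily 𝓤 lam m ε u t s →
      ∀ᶠ i in 𝓤, ∀ x ∈ Icc μ (Real.pi / 2 - μ), |u i x - upperRoot lam x| +
        ε i * |deriv (u i) x - deriv (upperRoot lam) x| ≤ M * ε i ^ 2 := by
    intro u t s F
    filter_upwards [F.pos, F.layer, F.lim.eventually_lt_const hε₀,
      F.inflection_le h hturn hm (half_pos hμ)] with i e1 e2 e3 e4 x hx
    exact hest (ε i) ⟨e1, e3⟩ (u i) e2.isSolution
      (e2.isSolution.abs_le_upperRoot_pi h e1 e2.periodic) _ _ e4 x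
      ⟨by linarith [hx.1], by linarith [hx.2]⟩
  refine (half F).and ?_
  by_cases hm2 : 2 ≤ m
  · filter_upwards [half (F.reflect h hturn hm2)] with i hi _ x hx
    have h1 := hi (Real.pi - x) ⟨by linarith [hx.2], by linarith [hx.1]⟩
    have h2 : upperRoot lam = reflect (lowerRoot lam) := funext fun y => by
      rw [reflect, lowerRoot_pi_sub h, neg_neg]
    rw [h2, deriv_reflect, deriv_reflect, sub_sub_cancel] at h1
    simp only [reflect, sub_sub_cancel] at h1
    rwa [← abs_neg (u i x - _), neg_sub']
  · exact Eventually.of_forall fun i hi => absurd hi hm2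

/-! ### Behaviour near the end points and location of the interior extrema -/

lemma profileGap_reflect (ε : ℝ) (u V : ℝ → ℝ) (a τ : ℝ) :
    profileGap ε (reflect u) (fun r => -V (-r)) (Real.pi - a) τ = profileGap ε u V a (-τ) := by
  have h1 : Real.pi - (Real.pi - a + ε * τ) = a + ε * -τ := by ring
  have h2 : deriv (fun r => -V (-r)) τ = deriv V (-τ) := by
    rw [deriv.fun_neg, deriv_comp_neg, neg_neg]
  unfold profileGap
  rw [deriv_reflect, h2, reflect, h1, ← abs_neg, neg_sub_neg, neg_sub]

lemma abs_sub_le_profileGap (ε : ℝ) (u V : ℝ → ℝ) (a : ℝ) : |u a - V 0| ≤ profileGap ε u V a 0 := by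
  unfold profileGap
  rw [mul_zero, add_zero]
  exact le_add_of_nonneg_right (abs_nonneg _)

lemma IsVneg1.isV1 {lam : ℝ} (h : lambda0 < lam) {V : ℝ → ℝ} (hV : IsVneg1 lam V) :
    IsV1 lam fun r => -V (-r) := by
  obtain ⟨hsol, h1, h2, hd, x, hx⟩ := hV
  have hroot : upperRoot lam 0 = -lowerRoot lam Real.pi := by
    rw [← upperRoot_pi_sub h, sub_self]
  rw [IsV1, hroot]
  refine ⟨?_, (h2.comp tendsto_neg_atTop_atBot).neg, (h1.comp tendsto_neg_atBot_atTop).neg, ?_,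
    -x, ?_⟩
  · simpa using hsol.affine (σ := -1) (b := -1) (by norm_num) (by norm_num) 0
  · rw [deriv.fun_neg, deriv_comp_neg, neg_neg, neg_zero, hd]
  · simp only [neg_neg]
    exact fun hc => hx (neg_injective hc)

section Family

variable {ι : Type*} {𝓤 : Ultrafilter ι} {lam : ℝ} {m : ℕ} {ε : ι → ℝ} {u : ι → ℝ → ℝ}
  {t s : ι → ℕ → ℝ}

/-- The limit and V₁ have the same turning value and zero velocity at 0, hence coincide. -/
theorem LayerFamily.profile_zero (h : lambda0 < lam) (F : LayerFamily 𝓤 lam m ε u t s) {V : ℝ → ℝ}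
    (hV : IsV1 lam V) (T : ℝ) {η : ℝ} (hη : 0 < η) :
    ∀ᶠ i in 𝓤, ∀ τ ∈ Icc 0 T, profileGap (ε i) (u i) V 0 τ < η := by
  obtain ⟨v, hv, hadm, -, hd, hv0, -⟩ := F.window_zero h
  obtain rfl : v = V := hadm.sol.eq_of_initial hV.1 (hv0.trans (hV.eq_turningPoint h).symm)
    (hd.trans hV.2.2.2.1.symm)
  exact hv.eventually_profileGap_lt 0 T hη

end Family

theorem exists_profile_ends {lam : ℝ} (h : lambda0 < lam) (hturn : turningPoint lam 1 < 0)
    {V₁ Vneg₁ : ℝ → ℝ} (hV₁ : IsV1 lam V₁) (hVneg₁ : IsVneg1 lam Vneg₁) (m : ℕ) {T : ℝ}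
    (hT : 0 < T) {η : ℝ} (hη : 0 < η) : ∃ ε₁ > (0 : ℝ), ∀ ε ∈ Ioo 0 ε₁,
      ∀ (u : ℝ → ℝ) (t s : ℕ → ℝ), IsLayerSolution lam ε m u t s →
        |u 0 - V₁ 0| < η ∧ (∀ τ ∈ Icc 0 T, profileGap ε u V₁ 0 τ < η) ∧
        (2 ≤ m → |u Real.pi - Vneg₁ 0| < η ∧
          ∀ τ ∈ Icc (-T) 0, profileGap ε u Vneg₁ Real.pi τ < η) := by
  refine exists_threshold fun 𝓤 ε u t s F => ?_
  have h1 := F.profile_zero h hV₁ T hη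
  have h2 : ∀ᶠ i in 𝓤, 2 ≤ m → ∀ τ ∈ Icc (-T) 0, profileGap (ε i) (u i) Vneg₁ Real.pi τ < η := by
    by_cases hm : 2 ≤ m
    · filter_upwards [(F.reflect h hturn hm).profile_zero h (hVneg₁.isV1 h) T hη] with i hi _ τ hτ
      have := hi (-τ) ⟨by linarith [hτ.2], by linarith [hτ.1]⟩
      rwa [← sub_self Real.pi, profileGap_reflect, neg_neg] at this
    · exact Eventually.of_forall fun i hi => absurd hi hm
  filter_upwards [h1, h2] with i e1 e2
  refine ⟨(abs_sub_le_profileGap _ _ _ _).trans_lt (e1 0 ⟨le_rfl, hT.le⟩), e1, fun hm => ?_⟩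
  exact ⟨(abs_sub_le_profileGap _ _ _ _).trans_lt (e2 hm 0 ⟨by linarith, le_rfl⟩), e2 hm⟩

lemma eventually_forall_index {ι : Type*} {l : Filter ι} {P : ι → ℕ → Prop} {m : ℕ}
    (H : ∀ j < m, ∀ᶠ i in l, P i j) : ∀ᶠ i in l, ∀ j < m, P i j := by
  have := (eventually_all_finset (Finset.range m)).2 fun j hj => H j (Finset.mem_range.1 hj)
  filter_upwards [this] with i hi j hj using hi j (Finset.mem_range.2 hj)

theorem exists_extrema_near {lam : ℝ} (h : lambda0 < lam) (hturn : turningPoint lam 1 < 0) (m : ℕ)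
    {η : ℝ} (hη : 0 < η) : ∃ ε₁ > (0 : ℝ), ∀ ε ∈ Ioo 0 ε₁,
      ∀ (u : ℝ → ℝ) (t s : ℕ → ℝ), IsLayerSolution lam ε m u t s →
        ∀ j : ℕ, 1 ≤ j → j + 1 ≤ m →
          |t j - Real.pi / 2| < η ∧ |s j - Real.pi / 2| < η ∧
          |u (t j) - upperRoot lam (Real.pi / 2)| < η ∧
          |u (s j) - lowerRoot lam (Real.pi / 2)| < η := by
  refine exists_threshold fun 𝓤 ε u t s F => ?_
  have key : ∀ᶠ i in 𝓤, ∀ j < m, 1 ≤ j → |t i j - Real.pi / 2| < η ∧ |s i j - Real.pi / 2| < η ∧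
      |u i (t i j) - upperRoot lam (Real.pi / 2)| < η ∧
      |u i (s i j) - lowerRoot lam (Real.pi / 2)| < η := by
    refine eventually_forall_index fun j hj => ?_
    by_cases h1 : 1 ≤ j
    · filter_upwards [(tendsto_abs_sub_zero (F.tendsto_t h hturn h1 hj)).eventually_lt_const hη,
        (tendsto_abs_sub_zero (F.tendsto_s h hturn h1 hj)).eventually_lt_const hη,
        (tendsto_abs_sub_zero (F.tendsto_u_t h hturn h1 hj)).eventually_lt_const hη,
        (tendsto_abs_sub_zero (F.tendsto_u_s h hturn h1 hj)).eventually_lt_const hη]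
        with i e1 e2 e3 e4 _ using ⟨e1, e2, e3, e4⟩
    · exact Eventually.of_forall fun i hi => absurd hi h1
  filter_upwards [key] with i hi j h1 h2 using hi j h2 h1

/-! ### The outer solutions `u₅` and `u₁` -/

section Outer

variable {lam ε : ℝ} {u v : ℝ → ℝ}

lemma inflection_lt_of_sq {x : ℝ} (hx : 0 < x ∧ 0 < 3 * x ^ 2 - lam) :
    √(lam / 3) < x := by
  rw [Real.sqrt_lt' hx.1]
  linarith [hx.2]

lemma IsSolution.sub_solution (hu : IsSolution lam ε u) (hv : IsSolution lam ε v) (x : ℝ) :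
    ε ^ 2 * deriv (deriv fun t => v t - u t) x =
      (v x ^ 2 + v x * u x + u x ^ 2 - lam) * (v x - u x) := by
  rw [(hasDerivAt_sub_root hv.1 hu.1).2.2, mul_sub, hu.2, hv.2]
  ring

lemma IsU1.reflect (hv : IsU1 lam ε v) : IsU5 lam ε (reflect v) := by
  obtain ⟨h1, ⟨B, hB⟩, h2⟩ := hv
  refine ⟨h1.reflect, ⟨B, fun x => ?_⟩, fun x => ?_⟩
  · simp only [ForcedDuffing.reflect, abs_neg]; exact hB _
  · have := h2 (Real.pi - x)
    simp only [ForcedDuffing.reflect, neg_sq]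
    exact ⟨by linarith [this.1], this.2⟩

/-- The difference u - v is bounded and strictly convex wherever it is positive, since there both
functions exceed √(λ/3). -/
theorem IsU5.le (h : lambda0 < lam) (hv : IsU5 lam ε v) (hu : IsSolution lam ε u)
    {B : ℝ} (hB : ∀ x, |u x| ≤ B) (x : ℝ) : u x ≤ v x := by
  have h1 := nonpos_of_bounded (hasDerivAt_sub_root hu.1 hv.1.1).1 (B := B) (fun x => by
    linarith [(abs_le.1 (hB x)).2, (hv.2.2 x).1]) (fun x hx => by
    have e1 := hv.1.sub_solution hu x
    have e2 := inflection_lt_of_sq (hv.2.2 x)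
    have e3 := inflection_pos h
    have e4 := inflection_sq h
    have e5 : 0 < u x ^ 2 + u x * v x + v x ^ 2 - lam := by nlinarith
    have e6 := mul_pos e5 hx
    rw [← e1] at e6
    exact pos_of_mul_pos_right e6 (sq_nonneg ε)) x
  linarith

/-- The barrier is used on [x - R, x + R]; as R → ∞ the boundary terms vanish, so only the O(ε²)
term is left. -/
theorem exists_outer_estimate (h : lambda0 < lam) : ∃ C > 0, ∃ ε₀ > 0, ∀ ε ∈ Ioo 0 ε₀, ∀ v,
    IsU5 lam ε v → ∀ x, |v x - upperRoot lam x| ≤ C * ε ^ 2 ∧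
      |deriv v x - deriv (upperRoot lam) x| ≤ C * ε := by
  obtain ⟨D, hD, hbd⟩ := exists_bound_derivs (contDiff_upperRoot h) (periodic_upperRoot h)
  have hk := convexRate_pos h
  have hlam := lam_pos h
  set b0 := upperRoot lam Real.pi with hb0
  have hb : 0 < b0 := (inflection_pos h).trans (inflection_lt_upperRoot h _)
  set C := D / convexRate lam with hC
  have hC0 : 0 < C := by positivity
  refine ⟨C + (2 * C + (3 * (b0 + 1) ^ 2 + lam) * C + D), by positivity, min 1 (1 / C),
    lt_min one_pos (by positivity), fun ε hε v hv => ?_⟩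
  obtain ⟨hε0, hε1⟩ := hε
  rw [lt_min_iff, lt_div_iff₀ hC0] at hε1
  obtain ⟨B, hB⟩ := hv.2.1
  have hA : ∀ x, 0 < upperRoot lam x ∧ upperRoot lam x ≤ b0 := fun x =>
    ⟨(inflection_pos h).trans (inflection_lt_upperRoot h x), upperRoot_le_pi h x⟩
  have hend : ∀ x, |v x - upperRoot lam x| ≤ B + b0 := fun x => by
    refine (abs_sub _ _).trans (add_le_add (hB x) ?_)
    rw [abs_of_pos (hA x).1]; exact (hA x).2
  have hκ : 0 < √(convexRate lam) / ε := div_pos (Real.sqrt_pos.2 hk) hε0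
  have h1 : ∀ x, |v x - upperRoot lam x| ≤ C * ε ^ 2 := fun x => by
    have e1 : ∀ᶠ R in atTop, |v x - upperRoot lam x| ≤ C * ε ^ 2 +
        (B + b0) * (Real.exp (-(√(convexRate lam) / ε * R)) +
          Real.exp (-(√(convexRate lam) / ε * R))) := by
      filter_upwards [eventually_ge_atTop 0] with R hR
      have := hv.1.abs_sub_upperRoot_le h hε0 (fun t => (hbd t).2.2) (hend (x - R)) (hend (x + R))
        (fun t _ => (inflection_lt_of_sq (hv.2.2 t)).le) x ⟨by linarith, by linarith⟩
      rwa [sub_sub_cancel, add_sub_cancel_left] at this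
    have e2 : Tendsto (fun R => Real.exp (-(√(convexRate lam) / ε * R))) atTop (𝓝 0) :=
      Real.tendsto_exp_neg_atTop_nhds_zero.comp (tendsto_id.const_mul_atTop hκ)
    have e3 := ((e2.add e2).const_mul (B + b0)).const_add (C * ε ^ 2)
    rw [add_zero, mul_zero, add_zero] at e3
    exact ge_of_tendsto e3 e1
  have h2 : ∀ x, |v x| ≤ b0 + 1 := fun x => by
    have e1 : C * ε ^ 2 ≤ 1 := by nlinarith
    have e2 := abs_le.1 (h1 x)
    rw [abs_of_pos (hv.2.2 x).1]
    linarith [(hA x).2]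
  intro x
  refine ⟨(h1 x).trans (mul_le_mul_of_nonneg_right ?_ (sq_nonneg ε)),
    (hv.1.abs_deriv_sub_upperRoot_le h hε0 (fun t => (hbd t).2.2) (by linarith)
      fun t _ => ⟨h2 t, h1 t⟩).trans (mul_le_mul_of_nonneg_right ?_ hε0.le)⟩
  · have : 0 ≤ 2 * C + (3 * (b0 + 1) ^ 2 + lam) * C + D := by positivity
    linarith
  · linarith

end Outer

/-! ### First exit times -/

/-- The final equality identifies the set whose supremum defines an exit time with Ioo a e, so that
this supremum is e. -/
lemma exists_first_exit {f : ℝ → ℝ} (hf : Continuous f) {a b c : ℝ} (hac : a < c) (hcb : c < b)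
    (ha : f a < 0) (hc : 0 ≤ f c) : ∃ e, a < e ∧ e ≤ c ∧ f e = 0 ∧ (∀ x ∈ Ico a e, f x < 0) ∧
      {t | t ∈ Ioo a b ∧ ∀ x ∈ Ioc a t, f x < 0} = Ioo a e := by
  obtain ⟨e, ⟨he, hfe⟩, hmin⟩ := (isCompact_Icc.inter_right (isClosed_Ici.preimage hf)).exists_isLeast
    (⟨c, right_mem_Icc.2 hac.le, hc⟩ : (Icc a c ∩ f ⁻¹' Ici 0).Nonempty)
  have hae : a < e := lt_of_le_of_ne he.1 (by rintro rfl; exact absurd hfe (not_le.2 ha))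
  have hlt : ∀ x ∈ Ico a e, f x < 0 := fun x hx => by
    by_contra! hcon
    exact absurd (hmin ⟨⟨hx.1, hx.2.le.trans he.2⟩, hcon⟩) (not_le.2 hx.2)
  refine ⟨e, hae, he.2, le_antisymm ?_ hfe, hlt, ?_⟩
  · obtain ⟨x, hx, hfx⟩ := intermediate_value_Icc hae.le hf.continuousOn ⟨ha.le, hfe⟩
    rcases hx.2.eq_or_lt with rfl | hxe
    · exact hfx.le
    · exact absurd hfx (hlt x ⟨hx.1, hxe⟩).ne
  · ext x
    constructor
    · rintro ⟨h1, h2⟩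
      refine ⟨h1.1, ?_⟩
      by_contra! hcon
      exact absurd (h2 e ⟨hae, hcon⟩) (not_lt.2 hfe)
    · intro hx
      exact ⟨⟨hx.1, hx.2.trans (he.2.trans_lt hcb)⟩, fun y hy => hlt y ⟨hy.1.le, hy.2.trans_lt hx.2⟩⟩

lemma deriv_nonneg_of_first_exit {f : ℝ → ℝ} {f' a e : ℝ} (hf : HasDerivAt f f' e) (hae : a < e)
    (he : f e = 0) (hlt : ∀ x ∈ Ico a e, f x < 0) : 0 ≤ f' := by
  have h1 := (hasDerivWithinAt_iff_tendsto_slope' (s := Iio e) (by simp)).1 hf.hasDerivWithinAt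
  refine ge_of_tendsto h1 ?_
  filter_upwards [Ioo_mem_nhdsLT hae] with x hx
  rw [slope_def_field, he, sub_zero]
  exact div_nonneg_of_nonpos (hlt x ⟨hx.1.le, hx.2⟩).le (by linarith [hx.2])

/-! ### The rate K and the time of exit. -/

section Rate

variable {lam : ℝ}

lemma rateK_pos (h : lambda0 < lam) : 0 < rateK lam :=
  Real.sqrt_pos.2 (by linarith [inflection_lt_upperRoot h 0])

lemma rateK_sq (h : lambda0 < lam) : rateK lam ^ 2 = upperRoot lam 0 - √(lam / 3) :=
  Real.sq_sqrt (by linarith [inflection_lt_upperRoot h 0])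

/-- With r = √(λ/3), K² = 2(`midLevel` - r). The right side is at least (y - r)(y + 2r), and y + 2r
≥ 3r ≥ 2 because 2r³ > 1 forces r > 2/3. -/
lemma rateK_sq_le (h : lambda0 < lam) {x y : ℝ} (hx : √(lam / 3) ≤ x) (hy : midLevel lam ≤ y) :
    rateK lam ^ 2 ≤ y ^ 2 + y * x + x ^ 2 - lam := by
  rw [rateK_sq h]
  have h1 := one_lt_discriminant h
  have h2 := inflection_sq h
  have h3 := inflection_lt_midLevel h
  have h4 := inflection_pos h
  have h5 : upperRoot lam 0 - √(lam / 3) = 2 * (midLevel lam - √(lam / 3)) := by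
    unfold midLevel; ring
  rw [h5]
  set r := √(lam / 3)
  have h6 : 2 / 3 ≤ r := by
    by_contra! hcon
    have : r ^ 3 ≤ (2 / 3) ^ 3 := pow_le_pow_left₀ h4.le hcon.le 3
    norm_num at this
    linarith
  have h7 : y ^ 2 + y * r + r ^ 2 - lam ≤ y ^ 2 + y * x + x ^ 2 - lam := by nlinarith
  have h8 : y ^ 2 + y * r + r ^ 2 - lam = (y - r) * (y + 2 * r) := by rw [← h2]; ring
  have h9 : (y - r) * 2 ≤ (y - r) * (y + 2 * r) :=
    mul_le_mul_of_nonneg_left (by linarith) (by linarith)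
  linarith

theorem time_le_of_rate (h : lambda0 < lam) {ε : ℝ} (hε : 0 < ε) (hε1 : ε < 1) {z : ℝ → ℝ}
    (hz : ContDiff ℝ 2 z) {a b δ g : ℝ} (hab : a ≤ b) (hz0 : 0 ≤ z a)
    (hrate : ∀ x ∈ Icc a b, rateK lam ^ 2 * z x ≤ ε ^ 2 * deriv (deriv z) x) (hzb : z b ≤ δ)
    (hδ : 0 ≤ δ) (hg : 0 < g) (hga : g ≤ deriv z a + rateK lam / ε * z a) :
    b - a ≤ ε / rateK lam * (Real.log (1 + 2 * rateK lam * δ / g) + |Real.log ε|) := by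
  have hK := rateK_pos h
  have h1 := time_le_of_growth hab (div_pos hK hε) hg hz (fun x hx => by
    rw [div_pow, div_mul_eq_mul_div, div_le_iff₀ (by positivity), mul_comm _ (ε ^ 2)]
    exact hrate x hx) hz0 hga hzb hδ
  have h2 : 2 * (rateK lam / ε) * δ / g = 2 * rateK lam * δ / g / ε := by field_simp
  rw [h2] at h1
  have h3 := h1.trans (log_one_add_div_le (by positivity) hε hε1)
  have h4 := mul_le_mul_of_nonneg_left h3 (by positivity : 0 ≤ ε / rateK lam)
  refine (le_of_eq ?_).trans h4
  field_simp

end Rate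

/-! ### The heteroclinic profile -/

section Heteroclinic

variable {lam δ : ℝ} {V v : ℝ → ℝ}

/-- Energy fixes the speed at 0. A positive velocity would never vanish, making V increasing from
its limit √λ at -∞, against V(0) < √λ. -/
lemma IsV0plus.deriv_zero (h : lambda0 < lam) (hδ : 0 < δ)
    (hV : IsV0plus lam δ V) :
    deriv V 0 ^ 2 = (V 0 ^ 2 - lam) ^ 2 / 2 ∧ deriv V 0 ≤ 0 := by
  obtain ⟨hsol, hbot, htop, h0⟩ := hV
  rw [upperRoot_pi_div_two h] at hbot h0
  rw [lowerRoot_pi_div_two h] at htop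
  have hsq := Real.sq_sqrt (lam_pos h).le
  have hE : ∀ τ, deriv V τ ^ 2 = (V τ ^ 2 - lam) ^ 2 / 2 := fun τ => by
    have := hsol.energy_of_tendsto htop τ
    rw [potential_sub_sqrt (by rw [neg_sq, hsq])] at this
    linarith
  refine ⟨hE 0, ?_⟩
  by_contra! hpos
  have hne : ∀ τ, deriv V τ ≠ 0 := fun τ hτ => by
    have h1 := hE τ
    rw [hτ] at h1
    have h2 : V τ ^ 2 - lam = 0 := by nlinarith
    have h3 := hsol.eq_const_of_equilibrium hτ (by linear_combination V τ * h2)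
    have h4 : √lam = V τ := tendsto_nhds_unique hbot (tendsto_const_nhds.congr fun x => (h3 x).symm)
    have h5 := h3 0
    rw [h0, ← h4] at h5
    linarith
  have hall : ∀ τ, 0 < deriv V τ := fun τ => by
    by_contra! hcon
    obtain ⟨x, hx⟩ := mem_range_of_exists_le_of_exists_ge hsol.1.contDiff_one_deriv.continuous
      ⟨τ, hcon⟩ ⟨0, hpos.le⟩
    exact hne x hx
  have hmono := strictMono_of_deriv_pos hall
  have := le_of_tendsto hbot ((eventually_le_atBot 0).mono fun x hx => hmono.monotone hx)
  linarith

theorem IsAdmissible.eq_of_isV0plus (h : lambda0 < lam) (hδ : 0 < δ) (hδ2 : δ < √lam)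
    (hV : IsV0plus lam δ V) (hv : IsAdmissible lam 0 v) (h0 : v 0 = √lam - δ)
    (h1 : deriv v 0 ≤ 0) : v = V := by
  obtain ⟨e1, e2⟩ := hV.deriv_zero h hδ
  have hV0 : V 0 = √lam - δ := by rw [hV.2.2.2, upperRoot_pi_div_two h]
  have hne : ¬∀ τ, v τ = v 0 := by
    rw [← Real.cos_pi_div_two] at hv
    refine hv.nonconst_of_level h (ρ := √lam - δ) ?_ ?_ h0
    · rw [lowerRoot_pi_div_two h]; linarith
    · rw [upperRoot_pi_div_two h]; linarith
  have e3 := hv.sq_deriv_of_zero h hne 0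
  refine hv.sol.eq_of_initial hV.1 (h0.trans hV0.symm) ?_
  rw [h0, ← hV0, ← e1] at e3
  rcases sq_eq_sq_iff_eq_or_eq_neg.1 e3 with e4 | e4
  · exact e4
  · linarith

end Heteroclinic

/-! ### Exit from the outer solutions -/

lemma abs_eq_one_of_sq {σ : ℝ} (hσ : σ ^ 2 = 1) : |σ| = 1 := by
  rw [← sq_eq_sq₀ (abs_nonneg _) zero_le_one, sq_abs, hσ, one_pow]

section Family

variable {ι : Type*} {𝓤 : Ultrafilter ι} {lam δ σ γ : ℝ} {m : ℕ} {ε : ι → ℝ} {u w : ι → ℝ → ℝ}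
  {t s : ι → ℕ → ℝ} {a c : ι → ℝ} {g V : ℝ → ℝ}

/-- Along `𝓤`, the `w i` are solutions close to the outer root `g` of sign `σ`. -/
structure OuterFamily (𝓤 : Ultrafilter ι) (lam : ℝ) (ε : ι → ℝ) (σ : ℝ) (g : ℝ → ℝ)
    (w : ι → ℝ → ℝ) : Prop where
  smooth : ContDiff ℝ 2 g
  periodic : Function.Periodic g (2 * Real.pi)
  level : ∀ x, upperRoot lam 0 ≤ σ * g x
  middle : g (Real.pi / 2) = σ * √lam
  sol : ∀ᶠ i in 𝓤, IsSolution lam (ε i) (w i)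
  near : ∃ C > 0, ∀ᶠ i in 𝓤, ∀ x, |w i x - g x| ≤ C * ε i ^ 2 ∧
    |deriv (w i) x - deriv g x| ≤ C * ε i

namespace OuterFamily

lemma exists_deriv_bound (O : OuterFamily 𝓤 lam ε σ g w) (hlim : Tendsto ε 𝓤 (𝓝 0)) :
    ∃ D > 0, ∀ᶠ i in 𝓤, ∀ x, |deriv (w i) x| ≤ D := by
  obtain ⟨D, hD, hbd⟩ := exists_bound_derivs O.smooth O.periodic
  obtain ⟨C, hC, hnear⟩ := O.near
  refine ⟨C + D, by positivity, ?_⟩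
  filter_upwards [hnear, hlim.eventually_lt_const one_pos] with i e1 e2 x
  have e3 := abs_sub_abs_le_abs_sub (deriv (w i) x) (deriv g x)
  have e4 := mul_le_mul_of_nonneg_left e2.le hC.le
  linarith [(e1 x).2, (hbd x).2.1]

lemma tendsto_apply (O : OuterFamily 𝓤 lam ε σ g w) (hlim : Tendsto ε 𝓤 (𝓝 0))
    (ha : Tendsto a 𝓤 (𝓝 (Real.pi / 2))) : Tendsto (fun i => w i (a i)) 𝓤 (𝓝 (σ * √lam)) := by
  obtain ⟨C, hC, hnear⟩ := O.near
  have h1 : Tendsto (fun i => C * ε i ^ 2) 𝓤 (𝓝 (C * 0 ^ 2)) := (hlim.pow 2).const_mul C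
  rw [zero_pow two_ne_zero, mul_zero] at h1
  have h2 : Tendsto (fun i => w i (a i) - g (a i)) 𝓤 (𝓝 0) :=
    squeeze_zero_norm' (hnear.mono fun i hi => (hi (a i)).1) h1
  have h3 := h2.add ((O.smooth.continuous.tendsto _).comp ha)
  rw [zero_add, O.middle] at h3
  refine h3.congr fun i => ?_
  simp

lemma eventually_level (O : OuterFamily 𝓤 lam ε σ g w) (hσ : σ ^ 2 = 1)
    (hlim : Tendsto ε 𝓤 (𝓝 0)) {ρ : ℝ} (hρ : ρ < upperRoot lam 0) :
    ∀ᶠ i in 𝓤, ∀ x, ρ ≤ σ * w i x := by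
  obtain ⟨C, hC, hnear⟩ := O.near
  have h1 : Tendsto (fun i => C * ε i ^ 2) 𝓤 (𝓝 (C * 0 ^ 2)) := (hlim.pow 2).const_mul C
  rw [zero_pow two_ne_zero, mul_zero] at h1
  filter_upwards [hnear, h1.eventually_lt_const (sub_pos.2 hρ)] with i e1 e2 x
  have e3 : |σ * (w i x - g x)| ≤ C * ε i ^ 2 := by
    rw [abs_mul, abs_eq_one_of_sq hσ, one_mul]; exact (e1 x).1
  have e4 := O.level x
  have e5 := (abs_le.1 e3).1
  rw [mul_sub] at e5
  linarith

end OuterFamily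

/-- One argument for both outer solutions, with σ = ±1 marking the side. Up to its first exit, z =
σ(w - u) satisfies ε²z'' ≥ K²z, and the hypothesis on γ starts the growth. At the exit the position
is σ(√λ - δ) in the limit and the direction is away from the outer root, which determines the
heteroclinic orbit. -/
theorem LayerFamily.exit_profile (h : lambda0 < lam) (F : LayerFamily 𝓤 lam m ε u t s)
    (hδ : 0 < δ) (hδ2 : δ < upperRoot lam 0 - √(lam / 3)) (hV : IsV0plus lam δ V)
    (hσ : σ ^ 2 = 1) (O : OuterFamily 𝓤 lam ε σ g w) (ha : Tendsto a 𝓤 (𝓝 (Real.pi / 2)))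
    (hc : Tendsto c 𝓤 (𝓝 (Real.pi / 2))) (hac : ∀ᶠ i in 𝓤, a i < c i)
    (hua : Tendsto (fun i => u i (a i)) 𝓤 (𝓝 (σ * √lam)))
    (huc : Tendsto (fun i => u i (c i)) 𝓤 (𝓝 (-(σ * √lam))))
    (hle : ∀ᶠ i in 𝓤, ∀ x, 0 ≤ σ * (w i x - u i x)) (hγ : 0 < γ)
    (hγa : ∀ᶠ i in 𝓤, γ ≤ σ * (deriv (w i) (a i) - deriv (u i) (a i)) +
      rateK lam / ε i * (σ * (w i (a i) - u i (a i)))) :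
    ∃ e : ι → ℝ, (∀ᶠ i in 𝓤, a i < e i ∧ e i - a i < 3 * ε i / rateK lam * |Real.log (ε i)| ∧
      {x | x ∈ Ioo (a i) Real.pi ∧ ∀ y ∈ Ioc (a i) x, σ * (w i y - u i y) < δ} =
        Ioo (a i) (e i)) ∧ IsWindow 𝓤 lam ε u e (Real.pi / 2) fun τ => σ * V τ := by
  have hr := inflection_pos h
  have hK := rateK_pos h
  have hsq0 : upperRoot lam 0 ≤ √lam := by
    rw [← upperRoot_pi_div_two h]; exact upperRoot_zero_le h _
  have hδ3 : δ < √lam := by linarith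
  have hpi := Real.pi_pos
  -- the first exit
  have hfa : Tendsto (fun i => σ * (w i (a i) - u i (a i)) - δ) 𝓤 (𝓝 (-δ)) := by
    have := (((O.tendsto_apply F.lim ha).sub hua).const_mul σ).sub_const δ
    simpa using this
  have hfc : Tendsto (fun i => σ * (w i (c i) - u i (c i)) - δ) 𝓤 (𝓝 (2 * √lam - δ)) := by
    have := (((O.tendsto_apply F.lim hc).sub huc).const_mul σ).sub_const δ
    convert this using 2
    linear_combination (-2 * √lam) * hσ
  have hex : ∀ᶠ i in 𝓤, ∃ e, a i < e ∧ e ≤ c i ∧ σ * (w i e - u i e) - δ = 0 ∧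
      (∀ x ∈ Ico (a i) e, σ * (w i x - u i x) - δ < 0) ∧
      {x | x ∈ Ioo (a i) Real.pi ∧ ∀ y ∈ Ioc (a i) x, σ * (w i y - u i y) - δ < 0} =
        Ioo (a i) e := by
    filter_upwards [O.sol, F.layer, hac, hc.eventually_lt_const (by linarith : Real.pi / 2 < Real.pi),
      hfa.eventually_lt_const (by linarith : -δ < 0),
      hfc.eventually_const_lt (by linarith : 0 < 2 * √lam - δ)] with i e1 e2 e3 e4 e5 e6
    refine exists_first_exit ?_ e3 e4 e5 e6.le
    exact ((e1.1.continuous.sub e2.isSolution.1.continuous).const_smul σ).sub continuous_const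
  obtain ⟨e, he⟩ := hex.choice
  have hlim : Tendsto e 𝓤 (𝓝 (Real.pi / 2)) :=
    tendsto_of_tendsto_of_tendsto_of_le_of_le' ha hc (he.mono fun i hi => hi.1.le)
      (he.mono fun i hi => hi.2.1)
  refine ⟨e, ?_, ?_⟩
  · have hlog : Tendsto (fun i => |Real.log (ε i)|) 𝓤 atTop :=
      tendsto_abs_atBot_atTop.comp (Real.tendsto_log_nhdsGT_zero.comp
        (tendsto_nhdsWithin_iff.2 ⟨F.lim, F.pos⟩))
    -- For small ε the constant logarithm is below |log ε|, so the factor 3 suffices. Since σw ≥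
    -- √(λ/3) + δ, u stays beyond the inflection value until the exit.
    filter_upwards [F.pos, F.lim.eventually_lt_const one_pos, F.layer, O.sol, he, hle, hγa,
      O.eventually_level hσ F.lim (midLevel_lt_upperRoot h 0),
      O.eventually_level hσ F.lim (by linarith : √(lam / 3) + δ < upperRoot lam 0),
      hlog.eventually_gt_atTop (Real.log (1 + 2 * rateK lam * δ / γ))]
      with i e0 e1 e2 e3 e4 e5 e6 e7 e8 e9
    obtain ⟨b1, -, b3, b4, b5⟩ := e4
    refine ⟨b1, ?_, by simpa only [sub_neg] using b5⟩
    obtain ⟨w1, w2, -⟩ := hasDerivAt_sub_root e3.1 e2.isSolution.1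
    obtain ⟨g1, g2, g3⟩ := deriv_affine w1 σ 0 1
    simp only [zero_add, one_mul, one_pow, mul_one] at g1 g2 g3
    have key := time_le_of_rate h e0 e1 g1 b1.le (e5 (a i)) (fun x hx => ?_)
      (by linarith : σ * (w i (e i) - u i (e i)) ≤ δ) hδ.le hγ (by rw [g2, w2]; exact e6)
    · refine key.trans_lt ?_
      have hlog0 : 0 ≤ Real.log (1 + 2 * rateK lam * δ / γ) := Real.log_nonneg (by
        have : 0 ≤ 2 * rateK lam * δ / γ := by positivity
        linarith)
      rw [show 3 * ε i / rateK lam * |Real.log (ε i)| =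
        ε i / rateK lam * (3 * |Real.log (ε i)|) by ring]
      refine mul_lt_mul_of_pos_left ?_ (div_pos e0 hK)
      linarith
    · have d1 : σ * (w i x - u i x) ≤ δ := by
        rcases hx.2.eq_or_lt with rfl | hlt
        · linarith
        · linarith [b4 x ⟨hx.1, hlt⟩]
      have d2 := rateK_sq_le h (x := σ * u i x) (y := σ * w i x)
        (by linarith [e8 x]) (e7 x)
      have d3 := mul_le_mul_of_nonneg_right d2 (e5 x)
      have d4 := e2.isSolution.sub_solution e3 x
      rw [g3]
      refine d3.trans (le_of_eq ?_)
      linear_combination (w i x ^ 2 + w i x * u i x + u i x ^ 2) *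
        (σ * (w i x - u i x)) * hσ - σ * d4
  · have hmem : ∀ᶠ i in 𝓤, e i ∈ Icc 0 Real.pi := by
      filter_upwards [hlim.eventually_const_lt (by linarith : 0 < Real.pi / 2),
        hlim.eventually_lt_const (by linarith : Real.pi / 2 < Real.pi)] with i e1 e2
      exact ⟨e1.le, e2.le⟩
    obtain ⟨α, -, v, hv, hadm⟩ := F.exists_window h hmem
    obtain rfl : α = Real.pi / 2 := tendsto_nhds_unique hv.base hlim
    rw [Real.cos_pi_div_two] at hadm
    have hv0 : σ * v 0 = √lam - δ := by
      have h1 : Tendsto (fun i => σ * w i (e i) - δ) 𝓤 (𝓝 (σ * (σ * √lam) - δ)) :=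
        ((O.tendsto_apply F.lim hlim).const_mul σ).sub_const δ
      have h2 := tendsto_nhds_unique (hv.pos_zero.const_mul σ) (h1.congr' (he.mono fun i hi => by
        linear_combination hi.2.2.1))
      rw [h2]
      linear_combination √lam * hσ
    -- At the first exit σ(w' - u') ≥ 0, and w' is bounded, so εw' disappears in the limit.
    have hv1 : σ * deriv v 0 ≤ 0 := by
      obtain ⟨D, hD, hbd⟩ := O.exists_deriv_bound F.lim
      have h1 : Tendsto (fun i => ε i * D) 𝓤 (𝓝 (0 * D)) := F.lim.mul_const D
      rw [zero_mul] at h1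
      refine le_of_tendsto_of_tendsto (hv.vel_zero.const_mul σ) h1 ?_
      filter_upwards [F.pos, F.layer, O.sol, he, hbd] with i e0 e1 e2 e3 e4
      obtain ⟨b1, -, b3, b4, -⟩ := e3
      have d1 := deriv_nonneg_of_first_exit ((((e2.1.hasDerivAt_real (e i)).sub
        (e1.isSolution.1.hasDerivAt_real (e i))).const_mul σ).sub_const δ) b1 b3 b4
      have d2 : |σ * deriv (w i) (e i)| ≤ D := by
        rw [abs_mul, abs_eq_one_of_sq hσ, one_mul]; exact e4 _
      have d3 : σ * deriv (u i) (e i) ≤ D := by linarith [(abs_le.1 d2).2]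
      have d4 := mul_le_mul_of_nonneg_left d3 e0.le
      linarith
    have hvV : (fun τ => σ * V τ) = v := by
      rcases mul_self_eq_one_iff.1 (by rwa [← sq] : σ * σ = 1) with rfl | rfl
      · simp only [one_mul] at hv0 hv1 ⊢
        exact (hadm.eq_of_isV0plus h hδ hδ3 hV hv0 hv1).symm
      · have h1 := hadm.neg
        rw [neg_zero] at h1
        rw [← h1.eq_of_isV0plus h hδ hδ3 hV (by linarith) (by
          rw [IsAutonomousSolution.deriv_neg_apply]; linarith)]
        funext τ; ring
    rwa [hvV]

end Family

/-! ### Internal layers -/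

section Family

variable {ι : Type*} {𝓤 : Ultrafilter ι} {lam δ η : ℝ} {m j : ℕ} {ε : ι → ℝ} {u w : ι → ℝ → ℝ}
  {t s : ι → ℕ → ℝ} {V : ℝ → ℝ}

lemma OuterFamily.of_isU5 (h : lambda0 < lam) (hpos : ∀ᶠ i in 𝓤, 0 < ε i)
    (hlim : Tendsto ε 𝓤 (𝓝 0)) (hw : ∀ᶠ i in 𝓤, IsU5 lam (ε i) (w i)) :
    OuterFamily 𝓤 lam ε 1 (upperRoot lam) w := by
  obtain ⟨C, hC, ε₀, hε₀, hest⟩ := exists_outer_estimate h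
  refine ⟨contDiff_upperRoot h, periodic_upperRoot h, fun x => ?_, ?_, hw.mono fun i hi => hi.1,
    C, hC, ?_⟩
  · rw [one_mul]; exact upperRoot_zero_le h x
  · rw [one_mul, upperRoot_pi_div_two h]
  · filter_upwards [hpos, hlim.eventually_lt_const hε₀, hw] with i e1 e2 e3
    exact hest (ε i) ⟨e1, e2⟩ (w i) e3

lemma OuterFamily.of_isU1 (h : lambda0 < lam) (hpos : ∀ᶠ i in 𝓤, 0 < ε i)
    (hlim : Tendsto ε 𝓤 (𝓝 0)) (hw : ∀ᶠ i in 𝓤, IsU1 lam (ε i) (w i)) :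
    OuterFamily 𝓤 lam ε (-1) (lowerRoot lam) w := by
  obtain ⟨C, hC, hnear⟩ := (of_isU5 h hpos hlim (hw.mono fun i hi => hi.reflect)).near
  refine ⟨contDiff_lowerRoot h, periodic_lowerRoot h, fun x => ?_, ?_, hw.mono fun i hi => hi.1,
    C, hC, hnear.mono fun i hi x => ?_⟩
  · have := upperRoot_zero_le h (Real.pi - x)
    rw [upperRoot_pi_sub h] at this
    linarith
  · rw [lowerRoot_pi_div_two h, neg_one_mul]
  · have h1 := hi (Real.pi - x)
    have h2 : upperRoot lam = ForcedDuffing.reflect (lowerRoot lam) := funext fun y => by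
      rw [ForcedDuffing.reflect, lowerRoot_pi_sub h, neg_neg]
    rw [h2, deriv_reflect, deriv_reflect, sub_sub_cancel] at h1
    simp only [ForcedDuffing.reflect, sub_sub_cancel] at h1
    rwa [neg_sub_neg, abs_sub_comm] at h1

namespace LayerFamily

/-- At t_j one has u' = 0 while u₅' → Ū'(π/2) = 1/(2λ) > 0, so the slope alone starts the growth,
with γ = 1/(4λ). The set equality in the conclusion serves the reflected statement for entry times.
-/
theorem exitTop_spec (h : lambda0 < lam) (hturn : turningPoint lam 1 < 0)
    (F : LayerFamily 𝓤 lam m ε u t s) (hδ : 0 < δ) (hδ2 : δ < upperRoot lam 0 - √(lam / 3))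
    (hV : IsV0plus lam δ V) (h1 : 1 ≤ j) (h2 : j < m) (hw : ∀ᶠ i in 𝓤, IsU5 lam (ε i) (w i))
    (T : ℝ) (hη : 0 < η) : ∀ᶠ i in 𝓤,
      0 < exitTop (u i) (w i) δ (t i j) - t i j ∧
      exitTop (u i) (w i) δ (t i j) - t i j < 3 * ε i / rateK lam * |Real.log (ε i)| ∧
      (∀ τ ∈ Icc 0 T, profileGap (ε i) (u i) V (exitTop (u i) (w i) δ (t i j)) τ < η) ∧
      {x | x ∈ Ioo (t i j) Real.pi ∧ ∀ y ∈ Ioc (t i j) x, w i y - δ < u i y} =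
        Ioo (t i j) (exitTop (u i) (w i) δ (t i j)) := by
  have O := OuterFamily.of_isU5 h F.pos F.lim hw
  have hlam := lam_pos h
  have ht := F.tendsto_t h hturn h1 h2
  have hslope : Tendsto (fun i => deriv (w i) (t i j)) 𝓤 (𝓝 (1 / (2 * lam))) := by
    obtain ⟨C, hC, hnear⟩ := O.near
    have e1 : Tendsto (fun i => C * ε i) 𝓤 (𝓝 (C * 0)) := F.lim.const_mul C
    rw [mul_zero] at e1
    have e2 : Tendsto (fun i => deriv (w i) (t i j) - deriv (upperRoot lam) (t i j)) 𝓤 (𝓝 0) :=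
      squeeze_zero_norm' (hnear.mono fun i hi => (hi _).2) e1
    have e3 := e2.add (((contDiff_upperRoot h).contDiff_one_deriv.continuous.tendsto _).comp ht)
    have e4 : deriv (upperRoot lam) (Real.pi / 2) = 1 / (2 * lam) := by
      have := deriv_upperRoot h (Real.pi / 2)
      rw [upperRoot_pi_div_two h, Real.sq_sqrt hlam.le, Real.sin_pi_div_two] at this
      rw [eq_div_iff (by positivity)]
      linarith
    rw [zero_add, e4] at e3
    refine e3.congr fun i => ?_
    simp
  have hle : ∀ᶠ i in 𝓤, ∀ x, 0 ≤ 1 * (w i x - u i x) := by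
    filter_upwards [F.pos, F.layer, hw] with i e1 e2 e3 x
    have := e3.le h e2.isSolution (e2.isSolution.abs_le_upperRoot_pi h e1 e2.periodic) x
    linarith
  obtain ⟨e, he, hwin⟩ := F.exit_profile h hδ hδ2 hV (one_pow 2) O ht (F.tendsto_s h hturn h1 h2)
    (F.layer.mono fun i hi => hi.t_lt_s h1 h2)
    (by rw [one_mul, ← upperRoot_pi_div_two h]; exact F.tendsto_u_t h hturn h1 h2)
    (by rw [one_mul, ← lowerRoot_pi_div_two h]; exact F.tendsto_u_s h hturn h1 h2) hle
    (γ := 1 / (4 * lam)) (by positivity) (by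
      filter_upwards [F.pos, F.layer, hle, hslope.eventually_const_lt
        (show 1 / (4 * lam) < 1 / (2 * lam) by gcongr; norm_num)] with i e0 e1 e2 e3
      rw [e1.deriv_t h1 h2.le, sub_zero, one_mul]
      have := mul_nonneg (div_pos (rateK_pos h) e0).le (e2 (t i j))
      linarith)
  filter_upwards [he, hwin.eventually_profileGap_lt 0 T hη] with i e1 e2
  obtain ⟨e3, e4, e5⟩ := e1
  simp only [one_mul, sub_lt_comm (b := u i _)] at e2 e5
  have e6 : exitTop (u i) (w i) δ (t i j) = e i := by
    rw [exitTop, e5, csSup_Ioo e3]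
  rw [e6]
  exact ⟨sub_pos.2 e3, e4, e2, e5⟩

theorem entryBottom_spec (h : lambda0 < lam) (hturn : turningPoint lam 1 < 0)
    (F : LayerFamily 𝓤 lam m ε u t s) (hδ : 0 < δ) (hδ2 : δ < upperRoot lam 0 - √(lam / 3))
    (hV : IsV0plus lam δ V) (h1 : 1 ≤ j) (h2 : j < m) (hw : ∀ᶠ i in 𝓤, IsU1 lam (ε i) (w i))
    (T : ℝ) (hη : 0 < η) : ∀ᶠ i in 𝓤,
      0 < s i j - entryBottom (u i) (w i) δ (s i j) ∧
      s i j - entryBottom (u i) (w i) δ (s i j) < 3 * ε i / rateK lam * |Real.log (ε i)| ∧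
      ∀ τ ∈ Icc (-T) 0, profileGap (ε i) (u i) (fun r => -V (-r))
        (entryBottom (u i) (w i) δ (s i j)) τ < η := by
  have key := (F.reflect h hturn (by omega)).exitTop_spec h hturn hδ hδ2 hV (j := m - j)
    (by omega) (by omega) (hw.mono fun i hi => hi.reflect) T hη
  simp_rw [reflectMax_apply h1 h2] at key
  filter_upwards [key] with i hi
  obtain ⟨e1, e2, e3, e4⟩ := hi
  set E := exitTop (ForcedDuffing.reflect (u i)) (ForcedDuffing.reflect (w i)) δ (Real.pi - s i j)
  have e5 : entryBottom (u i) (w i) δ (s i j) = Real.pi - E := by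
    have e6 : {x | x ∈ Ioo 0 (s i j) ∧ ∀ y ∈ Ico x (s i j), u i y < w i y + δ} =
        Ioo (Real.pi - E) (s i j) := by
      ext x
      have e7 : Real.pi - x ∈ Ioo (Real.pi - s i j) E ↔ x ∈ Ioo (Real.pi - E) (s i j) := by
        constructor <;> rintro ⟨a1, a2⟩ <;> constructor <;> linarith
      rw [← e7, ← e4]
      constructor
      · rintro ⟨⟨a1, a2⟩, a3⟩
        refine ⟨⟨by linarith, by linarith⟩, fun y hy => ?_⟩
        have := a3 (Real.pi - y) ⟨by linarith [hy.2], by linarith [hy.1]⟩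
        simp only [ForcedDuffing.reflect]
        linarith
      · rintro ⟨⟨a1, a2⟩, a3⟩
        refine ⟨⟨by linarith, by linarith⟩, fun y hy => ?_⟩
        have := a3 (Real.pi - y) ⟨by linarith [hy.2], by linarith [hy.1]⟩
        simp only [ForcedDuffing.reflect, sub_sub_cancel] at this
        linarith
    rw [entryBottom, e6, csInf_Ioo (by linarith)]
  rw [e5]
  refine ⟨by linarith, by linarith, fun τ hτ => ?_⟩
  have h3 := profileGap_reflect (ε i) (u i) (fun r => -V (-r)) (Real.pi - E) (-τ)
  simp only [neg_neg, sub_sub_cancel] at h3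
  rw [← h3]
  exact e3 (-τ) ⟨by linarith [hτ.2], by linarith [hτ.1]⟩

/-- Forward from s_j the slope of u₁ has the unfavourable sign, so growth must come from the
distance to the lower root. It is obtained by applying `far_from_upper` to the reflected solution,
whose preceding minimum is the image of t_(j+1); hence j + 1 < m. In the constant, C covers the gap
between u₁ and the root, and (D + 1)/K beats the slope. -/
theorem exitBottom_spec (h : lambda0 < lam) (hturn : turningPoint lam 1 < 0)
    (F : LayerFamily 𝓤 lam m ε u t s) (hδ : 0 < δ) (hδ2 : δ < upperRoot lam 0 - √(lam / 3))
    (hV : IsV0plus lam δ V) (h1 : 1 ≤ j) (h2 : j + 1 < m) (hw : ∀ᶠ i in 𝓤, IsU1 lam (ε i) (w i))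
    (T : ℝ) (hη : 0 < η) : ∀ᶠ i in 𝓤,
      0 < exitBottom (u i) (w i) δ (s i j) - s i j ∧
      exitBottom (u i) (w i) δ (s i j) - s i j < 3 * ε i / rateK lam * |Real.log (ε i)| ∧
      ∀ τ ∈ Icc 0 T, profileGap (ε i) (u i) (fun r => -V r)
        (exitBottom (u i) (w i) δ (s i j)) τ < η := by
  have O := OuterFamily.of_isU1 h F.pos F.lim hw
  have hK := rateK_pos h
  have hjm : j < m := by omega
  obtain ⟨D, hD, hbd⟩ := O.exists_deriv_bound F.lim
  obtain ⟨C, hC, hnear⟩ := O.near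
  have hle : ∀ᶠ i in 𝓤, ∀ x, 0 ≤ -1 * (w i x - u i x) := by
    filter_upwards [F.pos, F.layer, hw] with i e1 e2 e3 x
    have := e3.reflect.le h e2.isSolution.reflect
      (e2.isSolution.reflect.abs_le_upperRoot_pi h e1 (reflect_periodic e2.periodic)) (Real.pi - x)
    simp only [ForcedDuffing.reflect, sub_sub_cancel] at this
    linarith
  have F' := F.reflect h hturn (by omega)
  have hfar := F'.far_from_upper h (j := m - j - 1) (by omega) (by omega) (by
    have := F'.tendsto_s h hturn (j := m - j - 1) (by omega) (by omega)
    exact (this.eventually_lt_const (by linarith [Real.pi_lt_d2] : Real.pi / 2 < 7 / 4)).mono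
      fun i hi => hi.le) (C + (D + 1) / rateK lam) (by positivity)
  rw [show m - j - 1 + 1 = m - j by omega] at hfar
  simp_rw [reflectMax_apply h1 hjm] at hfar
  simp only [ForcedDuffing.reflect, sub_sub_cancel, upperRoot_pi_sub h] at hfar
  obtain ⟨e, he, hwin⟩ := F.exit_profile h hδ hδ2 hV (σ := -1) (by norm_num) O
    (F.tendsto_s h hturn h1 hjm) (F.tendsto_t h hturn (by omega : 1 ≤ j + 1) h2)
    (F.layer.mono fun i hi => hi.s_lt_t h1 hjm)
    (by rw [neg_one_mul, ← lowerRoot_pi_div_two h]; exact F.tendsto_u_s h hturn h1 hjm)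
    (by rw [neg_one_mul, neg_neg, ← upperRoot_pi_div_two h]
        exact F.tendsto_u_t h hturn (by omega) h2) hle
    (γ := 1) one_pos (by
      filter_upwards [F.pos, F.layer, hbd, hnear, hfar, F.lim.eventually_lt_const one_pos]
        with i e0 e1 e2 e3 e4 e5
      rw [e1.deriv_s h1 hjm, sub_zero]
      have a1 := (abs_le.1 (e3 (s i j)).1).2
      have a2 := (abs_le.1 (e2 (s i j))).2
      have a3 : C * ε i ^ 2 ≤ C * ε i := by
        rw [sq]
        exact mul_le_mul_of_nonneg_left (mul_le_of_le_one_left e0.le e5.le) hC.le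
      have a4 : (D + 1) / rateK lam * ε i ≤ -1 * (w i (s i j) - u i (s i j)) := by
        linarith
      have a5 := mul_le_mul_of_nonneg_left a4 (div_pos hK e0).le
      have a6 : rateK lam / ε i * ((D + 1) / rateK lam * ε i) = D + 1 := by
        field_simp
      linarith)
  filter_upwards [he, hwin.eventually_profileGap_lt 0 T hη] with i e1 e2
  obtain ⟨e3, e4, e5⟩ := e1
  have e7 : ∀ y, -1 * (w i y - u i y) < δ ↔ u i y < w i y + δ := fun y => by
    constructor <;> intro <;> linarith
  simp only [e7] at e5
  simp only [neg_one_mul] at e2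
  have e6 : exitBottom (u i) (w i) δ (s i j) = e i := by
    rw [exitBottom, e5, csSup_Ioo e3]
  rw [e6]
  exact ⟨sub_pos.2 e3, e4, e2⟩

end LayerFamily

end Family

theorem exists_internal_layers {lam δ : ℝ} (h : lambda0 < lam) (hturn : turningPoint lam 1 < 0)
    (hδ : 0 < δ) (hδ2 : δ < upperRoot lam 0 - √(lam / 3)) {V₀ : ℝ → ℝ} (hV : IsV0plus lam δ V₀)
    (m : ℕ) (T : ℝ) {η : ℝ} (hη : 0 < η) : ∃ ε₁ > (0 : ℝ), ∀ ε ∈ Ioo 0 ε₁,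
      ∀ (u : ℝ → ℝ) (t s : ℕ → ℝ), IsLayerSolution lam ε m u t s →
      ∀ u₁ u₅ : ℝ → ℝ, IsU1 lam ε u₁ → IsU5 lam ε u₅ →
        (∀ j : ℕ, 1 ≤ j → j + 1 ≤ m →
          0 < exitTop u u₅ δ (t j) - t j ∧
          exitTop u u₅ δ (t j) - t j < 3 * ε / rateK lam * |Real.log ε| ∧
          (∀ τ ∈ Icc 0 T, profileGap ε u V₀ (exitTop u u₅ δ (t j)) τ < η) ∧
          0 < s j - entryBottom u u₁ δ (s j) ∧
          s j - entryBottom u u₁ δ (s j) < 3 * ε / rateK lam * |Real.log ε| ∧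
          (∀ τ ∈ Icc (-T) 0,
            profileGap ε u (fun r => -V₀ (-r)) (entryBottom u u₁ δ (s j)) τ < η)) ∧
        (∀ j : ℕ, 1 ≤ j → j + 2 ≤ m →
          0 < exitBottom u u₁ δ (s j) - s j ∧
          exitBottom u u₁ δ (s j) - s j < 3 * ε / rateK lam * |Real.log ε| ∧
          (∀ τ ∈ Icc 0 T, profileGap ε u (fun r => -V₀ r) (exitBottom u u₁ δ (s j)) τ < η)) := by
  refine exists_threshold fun 𝓤 ε u t s F => ?_
  -- The outer solutions are quantified after the threshold, so they too are tested along arbitrary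
  -- choices; along an ultrafilter the implication may be treated with its premise holding
  -- eventually.
  refine eventually_forall_of_choice fun u₁ => eventually_forall_of_choice fun u₅ => ?_
  rw [Ultrafilter.eventually_imp]
  intro hu₁
  rw [Ultrafilter.eventually_imp]
  intro hu₅
  have key1 := eventually_forall_index (l := (𝓤 : Filter ℕ)) (m := m)
    (P := fun i j => 1 ≤ j → _) fun j hj => Ultrafilter.eventually_imp.2 fun h1 =>
      (F.exitTop_spec h hturn hδ hδ2 hV h1.exists.choose_spec hj hu₅ T hη).and
        (F.entryBottom_spec h hturn hδ hδ2 hV h1.exists.choose_spec hj hu₁ T hη)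
  have key2 := eventually_forall_index (l := (𝓤 : Filter ℕ)) (m := m - 1)
    (P := fun i j => 1 ≤ j → _) fun j hj => Ultrafilter.eventually_imp.2 fun h1 =>
      F.exitBottom_spec h hturn hδ hδ2 hV h1.exists.choose_spec (by omega : j + 1 < m) hu₁ T hη
  filter_upwards [key1, key2] with i e1 e2
  refine ⟨fun j h1 h2 => ?_, fun j h1 h2 => e2 j (by omega) h1⟩
  obtain ⟨⟨a1, a2, a3, -⟩, a4⟩ := e1 j h2 h1
  exact ⟨a1, a2, a3, a4⟩

/-! ### The threshold -/

/-- At the root for λ, the cubic for λ' > λ is negative, whereas it is nonnegative from its own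
largest root on. -/
lemma topRoot_lt_topRoot {lam lam' c : ℝ} (h : lambda0 < lam) (hlt : lam < lam') (hc : |c| ≤ 1) :
    topRoot lam c < topRoot lam' c := by
  have h' := h.trans hlt
  have h1 := topRoot_cubic h hc
  have h2 := topRoot_pos h hc
  have h3 := cubic_factor h' hc (topRoot lam c)
  have h4 := topRoot_neg_lt_two_mul h' hc
  have h5 := topRoot_pos h' (abs_neg_le hc)
  set x := topRoot lam c
  set A := topRoot lam' c
  set B := topRoot lam' (-c)
  by_contra! hcon
  have h6 : x ^ 3 - lam' * x + c < 0 := by nlinarith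
  rw [h3] at h6
  have h7 : 0 ≤ (x - A) * (x + B) * (x - (B - A)) :=
    mul_nonneg (mul_nonneg (by linarith) (by linarith)) (by linarith)
  linarith

lemma turningPoint_neg_of_lt {lam lam' : ℝ} (h : lambda0 < lam) (hlt : lam < lam')
    (hneg : turningPoint lam 1 < 0) : turningPoint lam' 1 < 0 := by
  have h1 := topRoot_lt_topRoot (c := 1) h hlt (by norm_num)
  have h2 := topRoot_pos (c := 1) h (by norm_num)
  unfold turningPoint at *
  have h3 : √(2 * 1 / topRoot lam' 1) ≤ √(2 * 1 / topRoot lam 1) :=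
    Real.sqrt_le_sqrt (by gcongr)
  linarith

lemma lambda0_lt_nine_half : lambda0 < 9 / 2 := by
  have h1 : (1 : ℝ) ≤ (2 : ℝ) ^ ((2 : ℝ) / 3) := Real.one_le_rpow (by norm_num) (by norm_num)
  have h2 : lambda0 ≤ 3 := div_le_self (by norm_num) h1
  linarith

lemma upperRoot_nine_half : upperRoot (9 / 2) 0 = 2 := by
  have h := lambda0_lt_nine_half
  have h1 : (2 : ℝ) ∈ roots (9 / 2) 0 := by
    simp only [roots, mem_ofPred_eq, Real.cos_zero]; norm_num
  rw [upperRoot_eq h]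
  rcases (mem_roots_iff h 0 2).1 h1 with h2 | h2 | h2
  · exact h2.symm
  · linarith [topRoot_pos h (abs_neg_le (abs_cos_le 0))]
  · rw [← middleRoot_eq h] at h2
    have h3 := (abs_lt.1 (abs_middleRoot_lt h 0)).2
    have h4 : √((9 / 2 : ℝ) / 3) ≤ 2 := Real.sqrt_le_iff.2 ⟨by norm_num, by norm_num⟩
    linarith

/-- Shows that λ = 9/2 meets the threshold condition: there the turning value of the homoclinic
orbit is exactly -1. -/
lemma neg_one_lt_middleRoot_nine_half : -1 < middleRoot (9 / 2) Real.pi := by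
  have h := lambda0_lt_nine_half
  have h1 := upperRoot_nine_half
  rw [upperRoot_eq h, Real.cos_zero] at h1
  have h2 := (topRoot_vieta (c := 1) h (by norm_num)).1
  rw [h1] at h2
  have h3 := middleRoot_pi_sub h 0
  rw [sub_zero, middleRoot_eq h 0, Real.cos_zero, h1] at h3
  rw [h3]
  nlinarith

/-- The homoclinic orbit for `lam = 9 / 2`. -/
noncomputable def explicitOrbit (τ : ℝ) : ℝ := 2 - 15 / (4 + Real.cosh (√(15 / 2) * τ))

lemma tendsto_cosh_atTop : Tendsto Real.cosh atTop atTop := by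
  refine tendsto_atTop_mono (fun x => ?_)
    (Real.tendsto_exp_atTop.const_mul_atTop (by norm_num : (0 : ℝ) < 1 / 2))
  rw [Real.cosh_eq]
  linarith [Real.exp_pos (-x)]

lemma isV1_explicitOrbit : IsV1 (9 / 2) explicitOrbit := by
  -- The linearised rate at the saddle 2: k² = 3·2² - 9/2.
  set k := √(15 / 2 : ℝ) with hk
  have hk2 : k ^ 2 = 15 / 2 := Real.sq_sqrt (by norm_num)
  have hk0 : 0 < k := Real.sqrt_pos.2 (by norm_num)
  have hpos : ∀ τ, 0 < 4 + Real.cosh (k * τ) := fun τ => by linarith [Real.cosh_pos (k * τ)]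
  have hl : ∀ τ, HasDerivAt (fun τ => k * τ) k τ := fun τ => by
    simpa using (hasDerivAt_id τ).const_mul k
  have hc : ∀ τ, HasDerivAt (fun τ => 4 + Real.cosh (k * τ)) (Real.sinh (k * τ) * k) τ :=
    fun τ => ((hl τ).cosh).const_add 4
  have h1 : ∀ τ, HasDerivAt explicitOrbit
      (15 * k * Real.sinh (k * τ) / (4 + Real.cosh (k * τ)) ^ 2) τ := fun τ =>
    (((hasDerivAt_const τ (15 : ℝ)).div (hc τ) (hpos τ).ne').const_sub 2).congr_deriv (by
      have := (hpos τ).ne'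
      field_simp; ring)
  have h2 : ∀ τ, HasDerivAt (fun τ => 15 * k * Real.sinh (k * τ) / (4 + Real.cosh (k * τ)) ^ 2)
      (explicitOrbit τ ^ 3 - 9 / 2 * explicitOrbit τ + 1) τ := fun τ =>
    ((((hl τ).sinh).const_mul (15 * k)).div ((hc τ).fun_pow 2)
      (pow_ne_zero 2 (hpos τ).ne')).congr_deriv (by
      have h3 := (hpos τ).ne'
      have h4 := Real.cosh_sq (k * τ)
      unfold explicitOrbit
      rw [← hk]
      field_simp
      rw [show Real.sinh (k * τ) ^ 2 = Real.cosh (k * τ) ^ 2 - 1 by linarith, hk2]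
      ring)
  have hcont : Continuous explicitOrbit :=
    continuous_iff_continuousAt.2 fun τ => (h1 τ).continuousAt
  obtain ⟨a1, a2, a3⟩ := contDiff_two_of_hasDerivAt h1 h2 (by fun_prop)
  have htop : Tendsto explicitOrbit atTop (𝓝 2) := by
    have e1 : Tendsto (fun τ => 4 + Real.cosh (k * τ)) atTop atTop :=
      tendsto_atTop_add_const_left _ 4
        (tendsto_cosh_atTop.comp (tendsto_id.const_mul_atTop hk0))
    have e2 := (e1.const_div_atTop 15).const_sub 2
    rwa [sub_zero] at e2
  have heven : ∀ τ, explicitOrbit (-τ) = explicitOrbit τ := fun τ => by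
    unfold explicitOrbit; rw [mul_neg, Real.cosh_neg]
  refine ⟨⟨a1, fun τ => congrFun a3 τ⟩, ?_, ?_, ?_, 0, ?_⟩
  · rwa [upperRoot_nine_half]
  · rw [upperRoot_nine_half]
    exact (htop.comp tendsto_neg_atBot_atTop).congr heven
  · rw [a2]; simp
  · rw [upperRoot_nine_half, explicitOrbit, mul_zero, Real.cosh_zero]; norm_num

/-- Nonemptiness is essential, since the real infimum of the empty set is 0 and would give no
information. Some λ' < λ then satisfies V₁(0) < U₀(π) < 0, and negativity of the turning value
persists as λ grows. -/
theorem turningPoint_neg_of_capLambda_lt {lam : ℝ} (hlam : capLambda < lam) :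
    lambda0 < lam ∧ turningPoint lam 1 < 0 := by
  have hne : {lam : ℝ | lambda0 < lam ∧ ∃ V : ℝ → ℝ, IsV1 lam V ∧
      V 0 < middleRoot lam Real.pi}.Nonempty := by
    refine ⟨9 / 2, lambda0_lt_nine_half, explicitOrbit, isV1_explicitOrbit, ?_⟩
    refine lt_of_eq_of_lt ?_ neg_one_lt_middleRoot_nine_half
    rw [explicitOrbit, mul_zero, Real.cosh_zero]; norm_num
  obtain ⟨lam', ⟨h, V, hV, hV0⟩, hlt⟩ := exists_lt_of_csInf_lt hne hlam
  refine ⟨h.trans hlt, turningPoint_neg_of_lt h hlt ?_⟩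
  rw [← hV.eq_turningPoint h]
  have h1 := middleRoot_pi_sub h 0
  rw [sub_zero] at h1
  linarith [middleRoot_zero_pos h]

end ForcedDuffing

theorem mainTheorem7 (lam : ℝ) (hlam : ForcedDuffing.capLambda < lam)
    (V₁ Vneg₁ : ℝ → ℝ) (hV₁ : ForcedDuffing.IsV1 lam V₁)
    (hVneg₁ : ForcedDuffing.IsVneg1 lam Vneg₁) :
    -- behaviour near `0` and `π`
    (∀ m : ℕ, 1 ≤ m → ∀ T > (0 : ℝ), ∀ η > (0 : ℝ), ∃ ε₁ > (0 : ℝ), ∀ ε ∈ Set.Ioo 0 ε₁,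
      ∀ (u : ℝ → ℝ) (t s : ℕ → ℝ), ForcedDuffing.IsLayerSolution lam ε m u t s →
        |u 0 - V₁ 0| < η ∧
        (∀ τ ∈ Set.Icc 0 T, ForcedDuffing.profileGap ε u V₁ 0 τ < η) ∧
        (2 ≤ m →
          |u Real.pi - Vneg₁ 0| < η ∧
          ∀ τ ∈ Set.Icc (-T) 0, ForcedDuffing.profileGap ε u Vneg₁ Real.pi τ < η)) ∧
    -- interior maxima and minima
    (∀ m : ℕ, 1 ≤ m → ∀ η > (0 : ℝ), ∃ ε₁ > (0 : ℝ), ∀ ε ∈ Set.Ioo 0 ε₁,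
      ∀ (u : ℝ → ℝ) (t s : ℕ → ℝ), ForcedDuffing.IsLayerSolution lam ε m u t s →
        ∀ j : ℕ, 1 ≤ j → j + 1 ≤ m →
          |t j - Real.pi / 2| < η ∧ |s j - Real.pi / 2| < η ∧
          |u (t j) - ForcedDuffing.upperRoot lam (Real.pi / 2)| < η ∧
          |u (s j) - ForcedDuffing.lowerRoot lam (Real.pi / 2)| < η) ∧
    -- widths and profiles of the internal layers
    (∀ δ : ℝ, 0 < δ → δ < ForcedDuffing.upperRoot lam 0 - Real.sqrt (lam / 3) →
      ∀ V₀ : ℝ → ℝ, ForcedDuffing.IsV0plus lam δ V₀ →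
      ∀ m : ℕ, 1 ≤ m → ∀ T > (0 : ℝ), ∀ η > (0 : ℝ), ∃ ε₁ > (0 : ℝ), ∀ ε ∈ Set.Ioo 0 ε₁,
      ∀ (u : ℝ → ℝ) (t s : ℕ → ℝ), ForcedDuffing.IsLayerSolution lam ε m u t s →
      ∀ u₁ u₅ : ℝ → ℝ, ForcedDuffing.IsU1 lam ε u₁ → ForcedDuffing.IsU5 lam ε u₅ →
        (∀ j : ℕ, 1 ≤ j → j + 1 ≤ m →
          0 < ForcedDuffing.exitTop u u₅ δ (t j) - t j ∧
          ForcedDuffing.exitTop u u₅ δ (t j) - t j <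
            3 * ε / ForcedDuffing.rateK lam * |Real.log ε| ∧
          (∀ τ ∈ Set.Icc 0 T,
            ForcedDuffing.profileGap ε u V₀ (ForcedDuffing.exitTop u u₅ δ (t j)) τ < η) ∧
          0 < s j - ForcedDuffing.entryBottom u u₁ δ (s j) ∧
          s j - ForcedDuffing.entryBottom u u₁ δ (s j) <
            3 * ε / ForcedDuffing.rateK lam * |Real.log ε| ∧
          (∀ τ ∈ Set.Icc (-T) 0,
            ForcedDuffing.profileGap ε u (fun r => -V₀ (-r))
              (ForcedDuffing.entryBottom u u₁ δ (s j)) τ < η)) ∧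
        (∀ j : ℕ, 1 ≤ j → j + 2 ≤ m →
          0 < ForcedDuffing.exitBottom u u₁ δ (s j) - s j ∧
          ForcedDuffing.exitBottom u u₁ δ (s j) - s j <
            3 * ε / ForcedDuffing.rateK lam * |Real.log ε| ∧
          (∀ τ ∈ Set.Icc 0 T,
            ForcedDuffing.profileGap ε u (fun r => -V₀ r)
              (ForcedDuffing.exitBottom u u₁ δ (s j)) τ < η))) ∧
    -- behaviour away from `0`, `π / 2` and `π`; the constant depends on `lam` only
    (∃ M > (0 : ℝ), ∀ m : ℕ, 1 ≤ m → ∀ μ > (0 : ℝ), ∃ ε₁ > (0 : ℝ), ∀ ε ∈ Set.Ioo 0 ε₁,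
      ∀ (u : ℝ → ℝ) (t s : ℕ → ℝ), ForcedDuffing.IsLayerSolution lam ε m u t s →
        (∀ x ∈ Set.Icc μ (Real.pi / 2 - μ),
          |u x - ForcedDuffing.upperRoot lam x| +
            ε * |deriv u x - deriv (ForcedDuffing.upperRoot lam) x| ≤ M * ε ^ 2) ∧
        (2 ≤ m → ∀ x ∈ Set.Icc (Real.pi / 2 + μ) (Real.pi - μ),
          |u x - ForcedDuffing.lowerRoot lam x| +
            ε * |deriv u x - deriv (ForcedDuffing.lowerRoot lam) x| ≤ M * ε ^ 2)) := by
  obtain ⟨h, hturn⟩ := ForcedDuffing.turningPoint_neg_of_capLambda_lt hlam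
  exact ⟨fun m _ T hT η hη => ForcedDuffing.exists_profile_ends h hturn hV₁ hVneg₁ m hT hη,
    fun m _ η hη => ForcedDuffing.exists_extrema_near h hturn m hη,
    fun δ hδ hδ2 V₀ hV₀ m _ T _ η hη =>
      ForcedDuffing.exists_internal_layers h hturn hδ hδ2 hV₀ m T hη,
    ForcedDuffing.exists_root_estimate h hturn⟩
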